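/- **Setting.** Let $\mathcal H_X,\mathcal H_Y$ be real separable Hilbert spaces of dimensions $d_X,d_Y\in\{0,1,\dots\}\cup\{\infty\}$ and let $\mathcal Z$ be a measurable space. Let $\mathcal P_0$ be the set of probability distributions $P$ of $(X,Y,Z)\in\mathcal H_X\times\mathcal H_Y\times\mathcal Z$ with $\mathbb E_P\|X\|<\infty$, $\mathbb E_P\|Y\|<\infty$ such that $X$ and $Y$ are conditionally independent given $Z$, i.e. $\mathbb E_P(\varphi(X)\psi(Y)\mid Z)=\mathbb E_P(\varphi(X)\mid Z)\,\mathbb E_P(\psi(Y)\mid Z)$ almost surely for all bounded Borel functions $\varphi,\psi$. For $P\in\mathcal P_0$ put $f_P(z)=\mathbb E_P(X\mid Z=z)$, $g_P(z)=\mathbb E_P(Y\mid Z=z)$, $\varepsilon_P=X-f_P(Z)$, $\xi_P=Y-g_P(Z)$, and $$u_P(z)=\mathbb E_P(\|\varepsilon_P\|^2\mid Z=z),\qquad v_P(z)=\mathbb E_P(\|\xi_P\|^2\mid Z=z),$$ with values in $[0,\infty]$ and the convention $0\cdot\infty=0$. For $g,h$ in (possibly different) Hilbert spaces, $g\otimes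 h$ denotes the operator $x\mapsto\langle x,g\rangle h$; $\otimes_{\mathrm{HS}}$ denotes the same operation in the Hilbert space $\mathrm{HS}$ of Hilbert–Schmidt operators from $\mathcal H_X$ to $\mathcal H_Y$; $\|\cdot\|_{\mathrm{TR}}$ is the trace norm (the sum of the singular values). Let $\tilde{\mathcal P}_0\subseteq\mathcal P_0$. Let $(x_i,y_i,z_i)_{i\ge1}$ be random elements on a measurable space equipped with probability measures $(\mathbb P_P)_{P\in\tilde{\mathcal P}_0}$ such that, under $\mathbb P_P$, they are i.i.d. with distribution $P$. For each $n$, let $\hat f^{(n)}$ be a regression estimate computed from $(x_i,z_i)_{i\le n}$ and $\hat g^{(n)}$ one computed from $(y_i,z_i)_{i\le n}$. Define the residuals $\hat\varepsilon_i=x_i-\hat f^{(n)}(z_i)$ and $\hat\xi_i=y_i-\hat g^{(n)}(z_i)$ and $$\mathscr R_i=\hat\varepsilon_i\otimes\hat\xi_i,\quad \bar{\mathscr R}=\frac1n\sum_{i=1}^n\mathscr R_i,\quad \mathscr T_n=\sqrt n\,\bar{\mathscr R},\quad \hat{\mathscr C}=\frac1{n-1}\sum_{i=1}^n(\mathscr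 R_i-\bar{\mathscr R})\otimes_{\mathrm{HS}}(\mathscr R_i-\bar{\mathscr R}),$$ and the in-sample mean squared prediction errors $$M^f_{n,P}=\frac1n\sum_{i=1}^n\|f_P(z_i)-\hat f^{(n)}(z_i)\|^2,\qquad \tilde M^f_{n,P}=\frac1n\sum_{i=1}^n\|f_P(z_i)-\hat f^{(n)}(z_i)\|^2\,v_P(z_i),$$ $$M^g_{n,P}=\frac1n\sum_{i=1}^n\|g_P(z_i)-\hat g^{(n)}(z_i)\|^2,\qquad \tilde M^g_{n,P}=\frac1n\sum_{i=1}^n\|g_P(z_i)-\hat g^{(n)}(z_i)\|^2\,u_P(z_i).$$ For nonnegative $D_{n,P}$, write $D_{n,P}\overset{P}{\rightrightarrows}0$ if $\lim_n\sup_{P\in\tilde{\mathcal P}_0}\mathbb P_P(D_{n,P}\ge\delta)=0$ for every $\delta>0$. For random elements $T_n$ and probability measures $\nu_P$ on a separable Hilbert space, write $T_n\overset{\mathcal D}{\rightrightarrows}\nu_P$ if $$\lim_n\sup_{P\in\tilde{\mathcal P}_0}\sup_{\varphi}\Big|\mathbb E_P\varphi(T_n)-\int\varphi\,d\nu_P\Big|=0,$$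 the inner supremum being over all $\varphi$ with values in $[-1,1]$ that are Lipschitz with constant at most $1$. **Theorem.** Assume that 1. $n\,M^f_{n,P}\,M^g_{n,P}\overset{P}{\rightrightarrows}0$; 2. $\tilde M^f_{n,P}\overset{P}{\rightrightarrows}0$ and $\tilde M^g_{n,P}\overset{P}{\rightrightarrows}0$; 3. $\inf_{P\in\tilde{\mathcal P}_0}\mathbb E_P(\|\varepsilon_P\|^2\|\xi_P\|^2)>0$, and $\sup_{P\in\tilde{\mathcal P}_0}\mathbb E_P(\|\varepsilon_P\|^{2+\eta}\|\xi_P\|^{2+\eta})<\infty$ for some $\eta>0$; 4. for some orthonormal bases $(e_{X,i})_{i=1}^{d_X}$ of $\mathcal H_X$ and $(e_{Y,j})_{j=1}^{d_Y}$ of $\mathcal H_Y$, $$\lim_{K\to\infty}\ \sup_{P\in\tilde{\mathcal P}_0}\ \sum_{(i,j):\,i+j\ge K}\mathbb E_P\big(\langle e_{X,i},\varepsilon_P\rangle^2\,\langle e_{Y,j},\xi_P\rangle^2\big)=0,$$ an empty sum being $0$. Put $\mathscr C_P=\mathbb E_P\{(\varepsilon_P\otimes\xi_P)\otimes_{\mathrm{HS}}(\varepsilon_P\otimes\xi_P)\}$.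 Then, for every $P\in\tilde{\mathcal P}_0$, the Gaussian distribution $\mathcal N(0,\mathscr C_P)$ on $\mathrm{HS}$ exists, and $$\mathscr T_n\overset{\mathcal D}{\rightrightarrows}\mathcal N(0,\mathscr C_P)\qquad\text{and}\qquad \|\hat{\mathscr C}-\mathscr C_P\|_{\mathrm{TR}}\overset{P}{\rightrightarrows}0 .$$ -/

import Mathlib

open MeasureTheory ProbabilityTheory Filter Topology
open scoped ENNReal NNReal RealInnerProductSpace

noncomputable section

namespace GHCM

/-! ### Hilbert--Schmidt operators -/

section HilbertSchmidt

variable {E F : Type*}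
  [NormedAddCommGroup E] [InnerProductSpace ℝ E] [CompleteSpace E]
  [NormedAddCommGroup F] [InnerProductSpace ℝ F] [CompleteSpace F]

/-- The outer product `g ⊗ h` of `g : E` and `h : F`: the operator `x ↦ ⟪x, g⟫ h`. -/
def outer (g : E) (h : F) : E →L[ℝ] F := (innerSL ℝ g).smulRight h

lemma outer_apply (g : E) (h : F) (x : E) : outer g h x = ⟪x, g⟫ • h := by
  simp [outer, real_inner_comm]

variable (E) in
/-- The index set of a fixed orthonormal basis of the Hilbert space `E`. -/
def basisIndex : Set E := (exists_hilbertBasis ℝ E).choose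

variable (E) in
/-- A fixed orthonormal basis of the Hilbert space `E`. -/
def stdBasis : HilbertBasis (basisIndex E) ℝ E := (exists_hilbertBasis ℝ E).choose_spec.choose

lemma tsum_enorm_inner_sq {ι : Type*} (b : HilbertBasis ι ℝ E) (x : E) :
    ∑' i, ‖⟪b i, x⟫‖ₑ ^ 2 = ‖x‖ₑ ^ 2 := by
  have h := b.hasSum_inner_mul_inner x x
  have h' : HasSum (fun i => ⟪b i, x⟫ ^ 2) (‖x‖ ^ 2) := by
    have e0 : (fun i => ⟪b i, x⟫ ^ 2) = fun i => ⟪x, b i⟫ * ⟪b i, x⟫ := by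
      funext i; rw [real_inner_comm (b i) x, sq]
    rw [e0, ← real_inner_self_eq_norm_sq x]
    exact h
  have e1 : ∀ i, ‖⟪b i, x⟫‖ₑ ^ 2 = ENNReal.ofReal (⟪b i, x⟫ ^ 2) := fun i => by
    rw [← sq_abs, ENNReal.ofReal_pow (abs_nonneg _), Real.enorm_eq_ofReal_abs]
  simp_rw [e1]
  rw [← ENNReal.ofReal_tsum_of_nonneg (fun i => sq_nonneg _) h'.summable, h'.tsum_eq,
    ENNReal.ofReal_pow (norm_nonneg _), ofReal_norm]

lemma tsum_enorm_sq_eq_adjoint {ι κ : Type*} (b : HilbertBasis ι ℝ E) (c : HilbertBasis κ ℝ F)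
    (A : E →L[ℝ] F) :
    ∑' i, ‖A (b i)‖ₑ ^ 2 = ∑' j, ‖(ContinuousLinearMap.adjoint A) (c j)‖ₑ ^ 2 := by
  simp_rw [← tsum_enorm_inner_sq c (A (b _)), ← tsum_enorm_inner_sq b (_ : E)]
  rw [ENNReal.tsum_comm]
  refine tsum_congr fun j => tsum_congr fun i => ?_
  rw [ContinuousLinearMap.adjoint_inner_right, real_inner_comm]

/-- The squared Hilbert--Schmidt norm does not depend on the orthonormal basis. -/
lemma tsum_enorm_sq_basis_indep {ι κ : Type*} (b : HilbertBasis ι ℝ E) (c : HilbertBasis κ ℝ E)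
    (A : E →L[ℝ] F) : ∑' i, ‖A (b i)‖ₑ ^ 2 = ∑' j, ‖A (c j)‖ₑ ^ 2 := by
  rw [tsum_enorm_sq_eq_adjoint b (stdBasis F), tsum_enorm_sq_eq_adjoint c (stdBasis F)]

lemma memℓp_two_iff {ι : Type*} (v : ι → F) :
    Memℓp v 2 ↔ ∑' i, ‖v i‖ₑ ^ 2 ≠ ∞ := by
  rw [memℓp_gen_iff (by norm_num)]
  have e1 : ∀ i, ‖v i‖ₑ ^ 2 = ((‖v i‖₊ ^ 2 : ℝ≥0) : ℝ≥0∞) := fun i => by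
    simp [enorm_eq_nnnorm]
  simp_rw [e1]
  rw [ENNReal.tsum_coe_ne_top_iff_summable, ← NNReal.summable_coe]
  simp

variable (E F) in
/-- The bounded operators `A` with `∑ ‖A e_i‖² < ∞` for an orthonormal basis `(e_i)` of `E`
(for the fixed one, hence by `mem_hsSubmodule_iff` for every one). -/
def hsSubmodule : Submodule ℝ (E →L[ℝ] F) where
  carrier := {A | Memℓp (fun i => A (stdBasis E i)) 2}
  add_mem' {A B} hA hB := by
    have := Memℓp.add hA hB
    exact this
  zero_mem' := by
    have : Memℓp (0 : basisIndex E → F) 2 := zero_memℓp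
    exact this
  smul_mem' c A hA := by
    have := Memℓp.const_smul hA c
    exact this

lemma mem_hsSubmodule_iff {ι : Type*} (b : HilbertBasis ι ℝ E) (A : E →L[ℝ] F) :
    A ∈ hsSubmodule E F ↔ ∑' i, ‖A (b i)‖ₑ ^ 2 ≠ ∞ := by
  rw [tsum_enorm_sq_basis_indep b (stdBasis E), ← memℓp_two_iff]; rfl

variable (E F) in
/-- The space of Hilbert--Schmidt operators from `E` to `F`. (A new type, since it carries the
Hilbert--Schmidt norm and not the operator norm.) -/
def HS : Type _ := hsSubmodule E F

instance : AddCommGroup (HS E F) := inferInstanceAs (AddCommGroup (hsSubmodule E F))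
instance : Module ℝ (HS E F) := inferInstanceAs (Module ℝ (hsSubmodule E F))

/-- The bounded operator underlying a Hilbert--Schmidt operator. -/
def HS.toCLM (A : HS E F) : E →L[ℝ] F := A.1

variable (E F) in
/-- The map `A ↦ (A e_i)_i`, along which the Hilbert space structure
`⟪A, B⟫ = ∑ ⟪A e_i, B e_i⟫` is defined. -/
def HS.toLp : HS E F →ₗ[ℝ] lp (fun _ : basisIndex E => F) 2 where
  toFun A := ⟨fun i => A.toCLM (stdBasis E i), A.2⟩
  map_add' _ _ := rfl
  map_smul' _ _ := rfl

lemma HS.toLp_injective : Function.Injective (HS.toLp E F) := by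
  intro A B h
  refine Subtype.ext (ContinuousLinearMap.ext_on (s := Set.range (stdBasis E)) ?_ ?_)
  · have := (stdBasis E).dense_span
    rw [Submodule.dense_iff_topologicalClosure_eq_top]
    exact this
  · rintro _ ⟨i, rfl⟩
    exact congrFun (congrArg (fun v : lp (fun _ : basisIndex E => F) 2 => (v : basisIndex E → F)) h) i

instance : NormedAddCommGroup (HS E F) :=
  NormedAddCommGroup.induced (HS E F) (lp (fun _ : basisIndex E => F) 2) (HS.toLp E F)
    HS.toLp_injective

lemma HS.norm_def (A : HS E F) : ‖A‖ = ‖HS.toLp E F A‖ := rfl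

instance : NormedSpace ℝ (HS E F) where
  norm_smul_le c A := by
    rw [HS.norm_def, HS.norm_def, map_smul]
    exact norm_smul_le c _

instance : InnerProductSpace ℝ (HS E F) where
  inner A B := ⟪HS.toLp E F A, HS.toLp E F B⟫
  norm_sq_eq_re_inner A := by
    rw [HS.norm_def]
    exact norm_sq_eq_re_inner (𝕜 := ℝ) _
  conj_inner_symm A B := inner_conj_symm (𝕜 := ℝ) _ _
  add_left A B C := by rw [map_add]; exact inner_add_left _ _ _
  smul_left A B c := by rw [map_smul]; exact inner_smul_left _ _ _

lemma HS.inner_def (A B : HS E F) : ⟪A, B⟫ = ⟪HS.toLp E F A, HS.toLp E F B⟫ := rfl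

/-- The Hilbert--Schmidt inner product is `∑ ⟪A e_i, B e_i⟫`. -/
lemma HS.inner_eq_tsum (A B : HS E F) :
    ⟪A, B⟫ = ∑' i, ⟪A.toCLM (stdBasis E i), B.toCLM (stdBasis E i)⟫ :=
  lp.inner_eq_tsum _ _

variable (E F) in
/-- `HS.toLp` as an isometry. -/
def HS.toLpₗᵢ : HS E F →ₗᵢ[ℝ] lp (fun _ : basisIndex E => F) 2 where
  toLinearMap := HS.toLp E F
  norm_map' _ := rfl

lemma HS.toLp_surjective : Function.Surjective (HS.toLp E F) := by
  intro v
  have key : ∀ x : E, (Summable fun i => ‖(stdBasis E).repr x i‖ * ‖v i‖) ∧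
      ∑' i, ‖(stdBasis E).repr x i‖ * ‖v i‖ ≤ ‖v‖ * ‖x‖ := fun x => by
    have h1 : Summable fun i => ‖(stdBasis E).repr x i‖ ^ (2 : ℝ) := by
      simpa using (memℓp_gen_iff (p := 2) (by norm_num)).1 (lp.memℓp ((stdBasis E).repr x))
    have h2 : Summable fun i => ‖v i‖ ^ (2 : ℝ) := by
      simpa using (memℓp_gen_iff (p := 2) (by norm_num)).1 (lp.memℓp v)
    have hpq : Real.HolderConjugate 2 2 := Real.holderConjugate_iff.2 ⟨by norm_num, by norm_num⟩
    refine ⟨Real.summable_mul_of_Lp_Lq_of_nonneg hpq (fun i => norm_nonneg _)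
      (fun i => norm_nonneg _) h1 h2, (Real.inner_le_Lp_mul_Lq_tsum_of_nonneg hpq
      (fun i => norm_nonneg _) (fun i => norm_nonneg _) h1 h2).trans (le_of_eq ?_)⟩
    have n1 := lp.norm_eq_tsum_rpow (p := 2) (by norm_num) ((stdBasis E).repr x)
    have n2 := lp.norm_eq_tsum_rpow (p := 2) (by norm_num) v
    rw [LinearIsometryEquiv.norm_map] at n1
    simp only [ENNReal.toReal_ofNat] at n1 n2
    rw [n1, n2, mul_comm]
  have hs : ∀ x : E, Summable fun i => (stdBasis E).repr x i • v i := fun x =>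
    Summable.of_norm (by simpa only [norm_smul] using (key x).1)
  let L : E →ₗ[ℝ] F :=
    { toFun := fun x => ∑' i, (stdBasis E).repr x i • v i
      map_add' := fun x y => by
        rw [← (hs x).tsum_add (hs y)]
        exact tsum_congr fun i => by simp [add_smul]
      map_smul' := fun c x => by
        rw [RingHom.id_apply, ← (hs x).tsum_const_smul]
        exact tsum_congr fun i => by simp [mul_smul] }
  let A : E →L[ℝ] F := L.mkContinuous ‖v‖ fun x => by
    refine (norm_tsum_le_tsum_norm ?_).trans ?_
    · simpa only [norm_smul] using (key x).1
    · simpa only [norm_smul] using (key x).2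
  have hA : ∀ i, A (stdBasis E i) = v i := fun i => by
    classical
    change ∑' j, (stdBasis E).repr (stdBasis E i) j • v j = v i
    rw [tsum_eq_single i]
    · rw [HilbertBasis.repr_self]; simp
    · intro j hj
      rw [HilbertBasis.repr_self]; simp [lp.single_apply, hj]
  refine ⟨⟨A, ?_⟩, ?_⟩
  · change Memℓp (fun i => A (stdBasis E i)) 2
    simp_rw [hA]
    exact lp.memℓp v
  · exact lp.ext (funext hA)

instance : CompleteSpace (HS E F) := by
  have h : IsUniformInducing (HS.toLp E F) := (HS.toLpₗᵢ E F).isometry.isUniformInducing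
  refine (completeSpace_iff_isComplete_range h).2 ?_
  rw [Set.range_eq_univ.2 HS.toLp_surjective]
  exact isComplete_univ

instance : MeasurableSpace (HS E F) := borel _
instance : BorelSpace (HS E F) := ⟨rfl⟩

/-- The outer product `g ⊗ h` as a Hilbert--Schmidt operator. -/
def HS.outer (g : E) (h : F) : HS E F :=
  ⟨GHCM.outer g h, (mem_hsSubmodule_iff (stdBasis E) _).2 (by
    simp_rw [outer_apply, enorm_smul, mul_pow, ENNReal.tsum_mul_right,
      tsum_enorm_inner_sq]
    simp [ENNReal.mul_eq_top])⟩

end HilbertSchmidt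

/-! ### Trace norm -/

section TraceNorm

variable {K : Type*} [NormedAddCommGroup K] [InnerProductSpace ℝ K]

/-- The trace norm of a bounded operator: the supremum of `∑ |⟪A e_i, f_i⟫|` over finite
orthonormal families `(e_i)`, `(f_i)`. By `traceNorm_eq_tsum_singularValues` it is the sum of the
singular values whenever `A` has a singular value decomposition. -/
def traceNorm (A : K →L[ℝ] K) : ℝ≥0∞ :=
  ⨆ (N : ℕ) (e : Fin N → K) (f : Fin N → K) (_ : Orthonormal ℝ e) (_ : Orthonormal ℝ f),
    ∑ i, ‖⟪A (e i), f i⟫‖ₑ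

lemma traceNorm_eq_tsum_singularValues {ι : Type*} (A : K →L[ℝ] K) (e f : ι → K) (s : ι → ℝ≥0)
    (he : Orthonormal ℝ e) (hf : Orthonormal ℝ f)
    (hA : ∀ x, HasSum (fun k => (s k : ℝ) • ⟪e k, x⟫ • f k) (A x)) :
    traceNorm A = ∑' k, (s k : ℝ≥0∞) := by
  classical
  have hAe : ∀ k, A (e k) = (s k : ℝ) • f k := fun k => by
    refine (hA (e k)).unique ?_
    have := hasSum_single (f := fun j => (s j : ℝ) • ⟪e j, e k⟫ • f j) k (fun j hj => by
      simp [orthonormal_iff_ite.1 he, hj])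
    simpa [orthonormal_iff_ite.1 he, he.1 k] using this
  apply le_antisymm
  · refine iSup_le fun N => iSup_le fun u => iSup_le fun w => iSup_le fun hu => iSup_le fun hw => ?_
    have hterm : ∀ i, ‖⟪A (u i), w i⟫‖ₑ
        ≤ ∑' k, (s k : ℝ≥0∞) * ENNReal.ofReal (|⟪u i, e k⟫| * |⟪w i, f k⟫|) := fun i => by
      have h1 : HasSum (fun k => (s k : ℝ) * (⟪e k, u i⟫ * ⟪f k, w i⟫)) ⟪A (u i), w i⟫ := by
        have h := (innerSL ℝ (w i)).hasSum (hA (u i))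
        have h0 : innerSL ℝ (w i) (A (u i)) = ⟪A (u i), w i⟫ := by
          rw [innerSL_apply_apply, real_inner_comm]
        rw [h0] at h
        refine h.congr_fun ?_
        intro k
        simp [real_inner_comm]
      rw [← h1.tsum_eq]
      refine (enorm_tsum_le_tsum_enorm).trans (le_of_eq ?_)
      refine tsum_congr fun k => ?_
      rw [enorm_mul, enorm_mul, real_inner_comm, real_inner_comm (w i),
        ENNReal.ofReal_mul (abs_nonneg _), ← Real.enorm_eq_ofReal_abs, ← Real.enorm_eq_ofReal_abs]
      congr 1
      simp [Real.enorm_eq_ofReal_abs]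
    calc ∑ i, ‖⟪A (u i), w i⟫‖ₑ
        ≤ ∑ i, ∑' k, (s k : ℝ≥0∞) * ENNReal.ofReal (|⟪u i, e k⟫| * |⟪w i, f k⟫|) :=
          Finset.sum_le_sum fun i _ => hterm i
      _ = ∑' k, ∑ i, (s k : ℝ≥0∞) * ENNReal.ofReal (|⟪u i, e k⟫| * |⟪w i, f k⟫|) :=
          (Summable.tsum_finsetSum fun _ _ => ENNReal.summable).symm
      _ ≤ ∑' k, (s k : ℝ≥0∞) := by
          refine ENNReal.tsum_le_tsum fun k => ?_
          rw [← Finset.mul_sum, ← ENNReal.ofReal_sum_of_nonneg fun i _ => by positivity]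
          refine mul_le_of_le_one_right zero_le (ENNReal.ofReal_le_one.2 ?_)
          have b1 := hu.sum_inner_products_le (x := e k) (s := Finset.univ)
          have b2 := hw.sum_inner_products_le (x := f k) (s := Finset.univ)
          rw [he.1 k] at b1
          rw [hf.1 k] at b2
          simp only [Real.norm_eq_abs, sq_abs] at b1 b2
          calc ∑ i, |⟪u i, e k⟫| * |⟪w i, f k⟫|
              ≤ ∑ i, (⟪u i, e k⟫ ^ 2 + ⟪w i, f k⟫ ^ 2) / 2 := by
                refine Finset.sum_le_sum fun i _ => ?_
                rw [← sq_abs ⟪u i, e k⟫, ← sq_abs ⟪w i, f k⟫]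
                nlinarith [sq_nonneg (|⟪u i, e k⟫| - |⟪w i, f k⟫|)]
            _ ≤ 1 := by
                rw [← Finset.sum_div, Finset.sum_add_distrib]
                linarith
  · rw [ENNReal.tsum_eq_iSup_sum]
    refine iSup_le fun t => ?_
    have hinj : Function.Injective fun i : Fin t.card => (t.equivFin.symm i : ι) :=
      Subtype.val_injective.comp t.equivFin.symm.injective
    refine le_trans (le_of_eq ?_) (le_iSup_of_le t.card (le_iSup_of_le
      (fun i => e (t.equivFin.symm i)) (le_iSup_of_le (fun i => f (t.equivFin.symm i))
      (le_iSup_of_le (he.comp _ hinj) (le_iSup_of_le (hf.comp _ hinj) le_rfl)))))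
    rw [← Finset.sum_coe_sort t, ← t.equivFin.symm.sum_comp]
    refine Finset.sum_congr rfl fun i _ => ?_
    rw [hAe, real_inner_smul_left, orthonormal_iff_ite.1 hf, if_pos rfl, mul_one]
    simp

end TraceNorm

/-! ### Uniform stochastic convergence -/

section Convergence

/-- The bounded Lipschitz distance: the supremum of `|∫ φ dμ - ∫ φ dν|` over all
`φ : B → [-1, 1]` that are Lipschitz with constant at most `1`. -/
def dBL {B : Type*} [NormedAddCommGroup B] [MeasurableSpace B] (μ ν : Measure B) : ℝ≥0∞ :=
  ⨆ (φ : B → ℝ) (_ : LipschitzWith 1 φ) (_ : ∀ x, |φ x| ≤ 1),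
    ENNReal.ofReal |∫ x, φ x ∂μ - ∫ x, φ x ∂ν|

variable {Θ Ω : Type*} [MeasurableSpace Ω]

/-- The random variables `T n`, under the measures `Pr θ`, converge in distribution to `ν θ`
uniformly over `θ ∈ S`. -/
def UnifTendstoInDistribution {B : Type*} [NormedAddCommGroup B] [MeasurableSpace B]
    (S : Set Θ) (Pr : Θ → Measure Ω) (T : ℕ → Ω → B) (ν : Θ → Measure B) : Prop :=
  Tendsto (fun n => ⨆ θ ∈ S, dBL ((Pr θ).map (T n)) (ν θ)) atTop (𝓝 0)

/-- The nonnegative random variables `D n θ`, under the measures `Pr θ`, converge to `0` in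
probability uniformly over `θ ∈ S`. -/
def UnifTendstoZeroInProb (S : Set Θ) (Pr : Θ → Measure Ω) (D : ℕ → Θ → Ω → ℝ≥0∞) : Prop :=
  ∀ δ : ℝ, 0 < δ →
    Tendsto (fun n => ⨆ θ ∈ S, Pr θ {ω | ENNReal.ofReal δ ≤ D n θ ω}) atTop (𝓝 0)

/-- Under `Pr`, the `W i` are i.i.d. copies of a random element with distribution `P`. -/
def IsIIDSample {S : Type*} [MeasurableSpace S] (Pr : Measure Ω) (W : ℕ → Ω → S) (P : Measure S) :
    Prop :=
  (∀ i, Measurable (W i)) ∧ iIndepFun W Pr ∧ ∀ i, Pr.map (W i) = P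

end Convergence

/-- `μ` is the Gaussian distribution `N(0, C)` on the Hilbert space `H`. -/
def IsCenteredGaussian {H : Type*} [NormedAddCommGroup H] [InnerProductSpace ℝ H] [CompleteSpace H]
    [MeasurableSpace H] [BorelSpace H] (C : H →L[ℝ] H) (μ : Measure H) : Prop :=
  IsGaussian μ ∧ ∫ x, x ∂μ = 0 ∧ covarianceOperator μ = C

/-! ### The model: conditional means, conditional variances, errors -/

section Model

variable {HX HY 𝒵 : Type*}
  [NormedAddCommGroup HX] [InnerProductSpace ℝ HX] [CompleteSpace HX]
  [SecondCountableTopology HX] [MeasurableSpace HX] [BorelSpace HX]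
  [NormedAddCommGroup HY] [InnerProductSpace ℝ HY] [CompleteSpace HY]
  [SecondCountableTopology HY] [MeasurableSpace HY] [BorelSpace HY]
  [MeasurableSpace 𝒵]

/-- `X` and `Y` are conditionally independent given `Z` when `(X, Y, Z)` has distribution `P`. -/
def CondIndepGiven (P : Measure (HX × HY × 𝒵)) : Prop :=
  ∀ (φ : HX → ℝ) (ψ : HY → ℝ), Measurable φ → Measurable ψ →
    (∃ c, ∀ x, |φ x| ≤ c) → (∃ c, ∀ y, |ψ y| ≤ c) →
    P[fun w => φ w.1 * ψ w.2.1 | MeasurableSpace.comap (fun w => w.2.2) inferInstance] =ᵐ[P]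
      P[fun w => φ w.1 | MeasurableSpace.comap (fun w => w.2.2) inferInstance] *
      P[fun w => ψ w.2.1 | MeasurableSpace.comap (fun w => w.2.2) inferInstance]

/-- The regression function `f_P(z) = E_P(X | Z = z)`. -/
def fReg (P : ProbabilityMeasure (HX × HY × 𝒵)) (z : 𝒵) : HX :=
  ∫ x, x ∂(condDistrib (fun w : HX × HY × 𝒵 => w.1) (fun w => w.2.2) (P : Measure _) z)

/-- The regression function `g_P(z) = E_P(Y | Z = z)`. -/
def gReg (P : ProbabilityMeasure (HX × HY × 𝒵)) (z : 𝒵) : HY :=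
  ∫ y, y ∂(condDistrib (fun w : HX × HY × 𝒵 => w.2.1) (fun w => w.2.2) (P : Measure _) z)

/-- The error `ε_P = X - f_P(Z)`. -/
def eps (P : ProbabilityMeasure (HX × HY × 𝒵)) (w : HX × HY × 𝒵) : HX := w.1 - fReg P w.2.2

/-- The error `ξ_P = Y - g_P(Z)`. -/
def xi (P : ProbabilityMeasure (HX × HY × 𝒵)) (w : HX × HY × 𝒵) : HY := w.2.1 - gReg P w.2.2

/-- The conditional variance `u_P(z) = E_P(‖ε_P‖² | Z = z)`, with values in `[0, ∞]`. -/
def uVar (P : ProbabilityMeasure (HX × HY × 𝒵)) (z : 𝒵) : ℝ≥0∞ :=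
  ∫⁻ x, ‖x - fReg P z‖ₑ ^ 2
    ∂(condDistrib (fun w : HX × HY × 𝒵 => w.1) (fun w => w.2.2) (P : Measure _) z)

/-- The conditional variance `v_P(z) = E_P(‖ξ_P‖² | Z = z)`, with values in `[0, ∞]`. -/
def vVar (P : ProbabilityMeasure (HX × HY × 𝒵)) (z : 𝒵) : ℝ≥0∞ :=
  ∫⁻ y, ‖y - gReg P z‖ₑ ^ 2
    ∂(condDistrib (fun w : HX × HY × 𝒵 => w.2.1) (fun w => w.2.2) (P : Measure _) z)

/-- The covariance operator `C_P = E_P[(ε_P ⊗ ξ_P) ⊗ (ε_P ⊗ ξ_P)]` on the space of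
Hilbert--Schmidt operators from `HX` to `HY`. -/
def covP (P : ProbabilityMeasure (HX × HY × 𝒵)) : HS HX HY →L[ℝ] HS HX HY :=
  ∫ w, outer (HS.outer (eps P w) (xi P w)) (HS.outer (eps P w) (xi P w)) ∂(P : Measure _)

end Model

/-! ### The statistics -/

section Statistics

/-- A regression method: for each `n`, it maps responses `(h_1, …, h_n)` and covariates
`(z_1, …, z_n)` to an estimated regression function. -/
abbrev RegressionMethod (𝒵 H : Type*) := (n : ℕ) → (Fin n → H) → (Fin n → 𝒵) → 𝒵 → H

variable {H 𝒵 : Type*} [NormedAddCommGroup H]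

/-- The fitted values of the regression method are measurable functions of the data. -/
def RegressionMethod.IsMeasurable [MeasurableSpace H] [MeasurableSpace 𝒵]
    (r : RegressionMethod 𝒵 H) : Prop :=
  ∀ (n : ℕ) (i : Fin n), Measurable fun d : (Fin n → H) × (Fin n → 𝒵) => r n d.1 d.2 (d.2 i)

/-- The in-sample mean squared prediction error
`n⁻¹ ∑ ‖h(z_i) - ĥ(z_i)‖²` of the estimate `ĥ` of `h`. -/
def mspe (r : RegressionMethod 𝒵 H) (h : 𝒵 → H) (n : ℕ) (x : Fin n → H) (z : Fin n → 𝒵) : ℝ≥0∞ :=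
  (∑ i, ‖h (z i) - r n x z (z i)‖ₑ ^ 2) / n

/-- The weighted in-sample mean squared prediction error
`n⁻¹ ∑ ‖h(z_i) - ĥ(z_i)‖² a(z_i)` of the estimate `ĥ` of `h`. -/
def wmspe (r : RegressionMethod 𝒵 H) (h : 𝒵 → H) (a : 𝒵 → ℝ≥0∞) (n : ℕ) (x : Fin n → H)
    (z : Fin n → 𝒵) : ℝ≥0∞ :=
  (∑ i, ‖h (z i) - r n x z (z i)‖ₑ ^ 2 * a (z i)) / n

variable {HX HY Ω : Type*}
  [NormedAddCommGroup HX] [InnerProductSpace ℝ HX] [CompleteSpace HX]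
  [NormedAddCommGroup HY] [InnerProductSpace ℝ HY] [CompleteSpace HY]

/-- The first `n` observations `x_1, …, x_n` of the `X`-component. -/
def xData (W : ℕ → Ω → HX × HY × 𝒵) (n : ℕ) (ω : Ω) : Fin n → HX := fun i => (W i ω).1

/-- The first `n` observations `y_1, …, y_n` of the `Y`-component. -/
def yData (W : ℕ → Ω → HX × HY × 𝒵) (n : ℕ) (ω : Ω) : Fin n → HY := fun i => (W i ω).2.1

/-- The first `n` observations `z_1, …, z_n` of the `Z`-component. -/
def zData (W : ℕ → Ω → HX × HY × 𝒵) (n : ℕ) (ω : Ω) : Fin n → 𝒵 := fun i => (W i ω).2.2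

/-- The residual `h_i - ĥ(z_i)`. -/
def resid (r : RegressionMethod 𝒵 H) (n : ℕ) (x : Fin n → H) (z : Fin n → 𝒵) (i : Fin n) : H :=
  x i - r n x z (z i)

variable (fhat : RegressionMethod 𝒵 HX) (ghat : RegressionMethod 𝒵 HY)
  (W : ℕ → Ω → HX × HY × 𝒵)

/-- `R_i = ε̂_i ⊗ ξ̂_i`, the outer product of the `i`th residuals of the two regressions. -/
def scrR (n : ℕ) (ω : Ω) (i : Fin n) : HS HX HY :=
  HS.outer (resid fhat n (xData W n ω) (zData W n ω) i)
    (resid ghat n (yData W n ω) (zData W n ω) i)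

/-- The mean of `R_1, …, R_n`. -/
def scrRbar (n : ℕ) (ω : Ω) : HS HX HY := (n : ℝ)⁻¹ • ∑ i, scrR fhat ghat W n ω i

/-- The operator-valued test statistic: `√n` times the mean of `R_1, …, R_n`. -/
def scrT (n : ℕ) (ω : Ω) : HS HX HY := √(n : ℝ) • scrRbar fhat ghat W n ω

/-- The empirical covariance operator of `R_1, …, R_n`. -/
def scrChat (n : ℕ) (ω : Ω) : HS HX HY →L[ℝ] HS HX HY :=
  ((n : ℝ) - 1)⁻¹ • ∑ i, outer (scrR fhat ghat W n ω i - scrRbar fhat ghat W n ω)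
    (scrR fhat ghat W n ω i - scrRbar fhat ghat W n ω)

end Statistics

/-- The index set `{1, …, d}`, or `{1, 2, …}` if `d = ∞`. -/
abbrev Idx (d : ℕ∞) : Type := {i : ℕ // 1 ≤ i ∧ (i : ℕ∞) ≤ d}

end GHCM

end

/-!
Write `a_i`, `b_i` for the in-sample prediction errors `f_P(z_i) - f̂(z_i)` and
`g_P(z_i) - ĝ(z_i)`. Then `R_i = (ε_i + a_i) ⊗ (ξ_i + b_i)` differs from `ε_i ⊗ ξ_i` by
`a_i ⊗ ξ_i + ε_i ⊗ b_i + a_i ⊗ b_i`. By Cauchy–Schwarz the last term is controlled by the product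
of the two mean squared prediction errors. For the first, conditional independence says that
redrawing `y_i` from its conditional law given `z_i` does not change the law of the data; hence,
given all `(x_j, z_j)`, the `a_i ⊗ ξ_i` are centred and orthogonal with second moments
`‖a_i‖² v_P(z_i)`, and one can restrict to the event that the weighted prediction error is small,
since this event depends on the `(x_j, z_j)` only. The second term is symmetric.

The `ε_i ⊗ ξ_i` are i.i.d. and centred, with bounded moments of order `2 + η` and uniformly small
tails in the basis `(e_i ⊗ f_j)`. The tails make the laws of the normalized sums uniformly tight,
and a Taylor expansion puts their characteristic functions uniformly close to
`t ↦ exp (-⟪𝒞_P t, t⟫ / 2)`. Compactness turns this into the existence of the Gaussian limits and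
convergence that is uniform in the bounded Lipschitz distance. For the covariance operators, the
tails reduce the trace norm to finitely many matrix entries, each of which obeys a uniform weak
law of large numbers because its moments of order `1 + η / 2` are bounded.
-/

noncomputable section

namespace GHCM

/-! ### Outer products, Hilbert–Schmidt operators and the trace norm -/

section Outer

variable {E F : Type*} [NormedAddCommGroup E] [InnerProductSpace ℝ E]
  [NormedAddCommGroup F] [InnerProductSpace ℝ F]

lemma outer_eq_rankOne (g : E) (h : F) : outer g h = InnerProductSpace.rankOne ℝ h g := rfl

lemma outer_add_left (g g' : E) (h : F) : outer (g + g') h = outer g h + outer g' h := by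
  simp only [outer_eq_rankOne, map_add]

lemma outer_add_right (g : E) (h h' : F) : outer g (h + h') = outer g h + outer g h' := by
  simp only [outer_eq_rankOne, map_add, add_apply]

lemma outer_sub_left (g g' : E) (h : F) : outer (g - g') h = outer g h - outer g' h := by
  simp only [outer_eq_rankOne, map_sub]

lemma outer_sub_right (g : E) (h h' : F) : outer g (h - h') = outer g h - outer g h' := by
  simp only [outer_eq_rankOne, map_sub, sub_apply]

lemma outer_smul_left (c : ℝ) (g : E) (h : F) : outer (c • g) h = c • outer g h := by
  simp [outer_eq_rankOne]

lemma outer_smul_right (c : ℝ) (g : E) (h : F) : outer g (c • h) = c • outer g h := by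
  simp [outer_eq_rankOne]

lemma outer_sum_left {ι : Type*} (s : Finset ι) (g : ι → E) (h : F) :
    outer (∑ i ∈ s, g i) h = ∑ i ∈ s, outer (g i) h := by
  simp only [outer_eq_rankOne, map_sum]

lemma outer_sum_right {ι : Type*} (s : Finset ι) (g : E) (h : ι → F) :
    outer g (∑ i ∈ s, h i) = ∑ i ∈ s, outer g (h i) := by
  simp [outer_eq_rankOne]

lemma norm_outer (g : E) (h : F) : ‖outer g h‖ = ‖g‖ * ‖h‖ := by
  rw [outer_eq_rankOne, InnerProductSpace.norm_rankOne, mul_comm]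

lemma continuous_outer : Continuous fun p : E × F => outer p.1 p.2 := by
  unfold outer
  fun_prop

lemma enorm_inner_le_mul (x y : E) : ‖⟪x, y⟫‖ₑ ≤ ‖x‖ₑ * ‖y‖ₑ := by
  simp only [enorm_eq_nnnorm]
  exact_mod_cast nnnorm_inner_le_nnnorm (𝕜 := ℝ) x y

end Outer

namespace HS

variable {E F : Type*} [NormedAddCommGroup E] [InnerProductSpace ℝ E] [CompleteSpace E]
  [NormedAddCommGroup F] [InnerProductSpace ℝ F] [CompleteSpace F]

omit [CompleteSpace F] in
lemma toCLM_injective : Function.Injective (toCLM : HS E F → E →L[ℝ] F) := Subtype.val_injective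

lemma toCLM_outer (g : E) (h : F) : (outer g h).toCLM = GHCM.outer g h := rfl

lemma outer_add_left (g g' : E) (h : F) : outer (g + g') h = outer g h + outer g' h :=
  toCLM_injective (GHCM.outer_add_left g g' h)

lemma outer_add_right (g : E) (h h' : F) : outer g (h + h') = outer g h + outer g h' :=
  toCLM_injective (GHCM.outer_add_right g h h')

lemma inner_outer_right (A : HS E F) (g : E) (h : F) : ⟪A, outer g h⟫ = ⟪A.toCLM g, h⟫ := by
  have hasSum_left : HasSum
      (fun i => ⟪A.toCLM (stdBasis E i), (outer g h).toCLM (stdBasis E i)⟫) ⟪A, outer g h⟫ :=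
    lp.hasSum_inner (toLp E F A) (toLp E F (outer g h))
  have hasSum_right := (innerSL ℝ h).hasSum (A.toCLM.hasSum ((stdBasis E).hasSum_repr g))
  rw [innerSL_apply_apply, real_inner_comm] at hasSum_right
  refine hasSum_left.unique (hasSum_right.congr_fun fun i => ?_)
  simp [toCLM_outer, outer_apply, HilbertBasis.repr_apply_apply, inner_smul_right,
    real_inner_comm]

lemma inner_outer_outer (g g' : E) (h h' : F) : ⟪outer g h, outer g' h'⟫ = ⟪g, g'⟫ * ⟪h, h'⟫ := by
  rw [inner_outer_right, toCLM_outer, outer_apply, real_inner_smul_left, real_inner_comm]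

lemma norm_outer (g : E) (h : F) : ‖outer g h‖ = ‖g‖ * ‖h‖ := by
  have norm_sq : ‖outer g h‖ ^ 2 = (‖g‖ * ‖h‖) ^ 2 := by
    simp only [← real_inner_self_eq_norm_sq, inner_outer_outer, mul_pow]
  exact (pow_left_inj₀ (norm_nonneg _) (by positivity) two_ne_zero).1 norm_sq

lemma enorm_outer (g : E) (h : F) : ‖outer g h‖ₑ = ‖g‖ₑ * ‖h‖ₑ := by
  rw [← ofReal_norm, norm_outer, ENNReal.ofReal_mul (norm_nonneg _), ofReal_norm, ofReal_norm]

variable (E F) in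
/-- The outer product as a continuous bilinear map into the Hilbert–Schmidt operators. -/
def outerL : E →L[ℝ] F →L[ℝ] HS E F :=
  LinearMap.mkContinuous₂
    (LinearMap.mk₂ ℝ outer outer_add_left
      (fun c g h => toCLM_injective (GHCM.outer_smul_left c g h)) outer_add_right
      (fun c g h => toCLM_injective (GHCM.outer_smul_right c g h)))
    1 fun g h => by simp [norm_outer]

lemma outerL_apply (g : E) (h : F) : outerL E F g h = outer g h := rfl

lemma continuous_outer : Continuous fun p : E × F => outer p.1 p.2 := by
  simp_rw [← outerL_apply]
  fun_prop

lemma orthonormal_outer {ι κ : Type*} {e : ι → E} {f : κ → F} (he : Orthonormal ℝ e)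
    (hf : Orthonormal ℝ f) : Orthonormal ℝ fun p : ι × κ => outer (e p.1) (f p.2) := by
  classical
  rw [orthonormal_iff_ite] at he hf ⊢
  rintro ⟨i, j⟩ ⟨i', j'⟩
  simp [inner_outer_outer, he, hf, Prod.ext_iff, ← ite_and, and_comm]

lemma eq_zero_of_inner_outer_eq_zero {ι κ : Type*} (b : HilbertBasis ι ℝ E)
    (c : HilbertBasis κ ℝ F) {A : HS E F} (hA : ∀ i j, ⟪outer (b i) (c j), A⟫ = 0) : A = 0 := by
  have apply_basis : ∀ i, A.toCLM (b i) = 0 := fun i => by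
    refine (c.hasSum_repr (A.toCLM (b i))).unique ?_
    simp [HilbertBasis.repr_apply_apply, ← real_inner_comm (c _), ← inner_outer_right,
      ← real_inner_comm A, hA]
  refine toCLM_injective (ContinuousLinearMap.ext fun x => ?_)
  refine (A.toCLM.hasSum (b.hasSum_repr x)).unique ?_
  simp only [map_smul, apply_basis, smul_zero]
  exact hasSum_zero

/-- The orthonormal basis `(e_i ⊗ f_j)` of the Hilbert–Schmidt operators attached to orthonormal
bases `(e_i)` and `(f_j)` of the two spaces. -/
def outerBasis {ι κ : Type*} (b : HilbertBasis ι ℝ E) (c : HilbertBasis κ ℝ F) :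
    HilbertBasis (ι × κ) ℝ (HS E F) :=
  HilbertBasis.mkOfOrthogonalEqBot (orthonormal_outer b.orthonormal c.orthonormal) <| by
    refine (Submodule.eq_bot_iff _).2 fun A hA => eq_zero_of_inner_outer_eq_zero b c fun i j => ?_
    exact hA _ (Submodule.subset_span ⟨(i, j), rfl⟩)

lemma outerBasis_apply {ι κ : Type*} (b : HilbertBasis ι ℝ E) (c : HilbertBasis κ ℝ F)
    (p : ι × κ) : outerBasis b c p = outer (b p.1) (c p.2) := by
  rw [outerBasis, HilbertBasis.coe_mkOfOrthogonalEqBot]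

end HS

lemma secondCountableTopology_of_hilbertBasis {E ι : Type*} [NormedAddCommGroup E]
    [InnerProductSpace ℝ E] [Countable ι] (b : HilbertBasis ι ℝ E) :
    SecondCountableTopology E := by
  have separable_closure := ((Set.countable_range b).isSeparable.span (R := ℝ)).closure
  rw [← Submodule.topologicalClosure_coe, b.dense_span, Submodule.top_coe,
    TopologicalSpace.isSeparable_univ_iff] at separable_closure
  exact UniformSpace.secondCountable_of_separable E

section TraceNorm

variable {K : Type*} [NormedAddCommGroup K] [InnerProductSpace ℝ K]

lemma traceNorm_le {A : K →L[ℝ] K} {c : ℝ≥0∞}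
    (h : ∀ (N : ℕ) (e f : Fin N → K), Orthonormal ℝ e → Orthonormal ℝ f →
      ∑ i, ‖⟪A (e i), f i⟫‖ₑ ≤ c) : traceNorm A ≤ c := by
  simpa only [traceNorm, iSup_le_iff] using h

lemma sum_enorm_inner_le_traceNorm (A : K →L[ℝ] K) {N : ℕ} {e f : Fin N → K}
    (he : Orthonormal ℝ e) (hf : Orthonormal ℝ f) : ∑ i, ‖⟪A (e i), f i⟫‖ₑ ≤ traceNorm A :=
  le_iSup_of_le N (le_iSup_of_le e (le_iSup_of_le f (le_iSup₂_of_le he hf le_rfl)))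

lemma traceNorm_zero : traceNorm (0 : K →L[ℝ] K) = 0 :=
  le_antisymm (traceNorm_le fun N e f _ _ => by simp) zero_le

lemma traceNorm_add_le (A B : K →L[ℝ] K) : traceNorm (A + B) ≤ traceNorm A + traceNorm B := by
  refine traceNorm_le fun N e f he hf => ?_
  calc ∑ i, ‖⟪(A + B) (e i), f i⟫‖ₑ
      ≤ ∑ i, (‖⟪A (e i), f i⟫‖ₑ + ‖⟪B (e i), f i⟫‖ₑ) := by
        gcongr with i
        rw [add_apply, inner_add_left]
        exact enorm_add_le _ _
    _ ≤ traceNorm A + traceNorm B := by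
        rw [Finset.sum_add_distrib]
        exact add_le_add (sum_enorm_inner_le_traceNorm A he hf)
          (sum_enorm_inner_le_traceNorm B he hf)

lemma traceNorm_smul_le (c : ℝ) (A : K →L[ℝ] K) : traceNorm (c • A) ≤ ‖c‖ₑ * traceNorm A := by
  refine traceNorm_le fun N e f he hf => ?_
  simp only [smul_apply, real_inner_smul_left, enorm_mul, ← Finset.mul_sum]
  gcongr
  exact sum_enorm_inner_le_traceNorm A he hf

lemma traceNorm_sub_le (A B : K →L[ℝ] K) : traceNorm (A - B) ≤ traceNorm A + traceNorm B := by
  have traceNorm_neg_le : traceNorm (-B) ≤ traceNorm B := by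
    simpa using traceNorm_smul_le (-1) B
  rw [sub_eq_add_neg]
  exact (traceNorm_add_le _ _).trans (by gcongr)

lemma traceNorm_sum_le {ι : Type*} (s : Finset ι) (A : ι → K →L[ℝ] K) :
    traceNorm (∑ i ∈ s, A i) ≤ ∑ i ∈ s, traceNorm (A i) :=
  Finset.le_sum_of_subadditive _ traceNorm_zero.le traceNorm_add_le _ _

lemma sum_abs_inner_outer_le {ι : Type*} [Fintype ι] {e f : ι → K} (he : Orthonormal ℝ e)
    (hf : Orthonormal ℝ f) (g h : K) : ∑ i, |⟪outer g h (e i), f i⟫| ≤ ‖g‖ * ‖h‖ :=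
  calc ∑ i, |⟪outer g h (e i), f i⟫|
      = ∑ i, ‖⟪e i, g⟫‖ * ‖⟪f i, h⟫‖ := by
        refine Finset.sum_congr rfl fun i _ => ?_
        rw [outer_eq_rankOne, InnerProductSpace.rankOne_apply, real_inner_smul_left, abs_mul,
          real_inner_comm (e i), real_inner_comm (f i)]
        rfl
    _ ≤ √(∑ i, ‖⟪e i, g⟫‖ ^ 2) * √(∑ i, ‖⟪f i, h⟫‖ ^ 2) := Real.sum_mul_le_sqrt_mul_sqrt _ _ _
    _ ≤ ‖g‖ * ‖h‖ := by
        gcongr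
        · exact Real.sqrt_le_iff.2 ⟨norm_nonneg g, he.sum_inner_products_le g⟩
        · exact Real.sqrt_le_iff.2 ⟨norm_nonneg h, hf.sum_inner_products_le h⟩

lemma traceNorm_outer_le (g h : K) : traceNorm (outer g h) ≤ ‖g‖ₑ * ‖h‖ₑ := by
  refine traceNorm_le fun N e f he hf => ?_
  simp only [Real.enorm_eq_ofReal_abs]
  rw [← ofReal_norm, ← ofReal_norm, ← ENNReal.ofReal_sum_of_nonneg fun i _ => abs_nonneg _,
    ← ENNReal.ofReal_mul (norm_nonneg _)]
  exact ENNReal.ofReal_le_ofReal (sum_abs_inner_outer_le he hf g h)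

lemma traceNorm_outer_self_sub_le (u w : K) :
    traceNorm (outer u u - outer w w) ≤ ‖u - w‖ₑ * (‖u‖ₑ + ‖w‖ₑ) := by
  have telescope : outer u u - outer w w = outer (u - w) u + outer w (u - w) := by
    rw [outer_sub_left, outer_sub_right]; abel
  rw [telescope, mul_add, mul_comm _ ‖w‖ₑ]
  exact (traceNorm_add_le _ _).trans
    (add_le_add (traceNorm_outer_le _ _) (traceNorm_outer_le _ _))

lemma inner_integral_apply [CompleteSpace K] {α : Type*} [MeasurableSpace α] {μ : Measure α}
    {A : α → K →L[ℝ] K} (hA : Integrable A μ) (x y : K) :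
    ⟪(∫ a, A a ∂μ) x, y⟫ = ∫ a, ⟪A a x, y⟫ ∂μ := by
  simp_rw [ContinuousLinearMap.integral_apply hA, real_inner_comm y,
    integral_inner (hA.apply_continuousLinearMap x)]

lemma traceNorm_integral_le [CompleteSpace K] {α : Type*} [MeasurableSpace α] {μ : Measure α}
    {A : α → K →L[ℝ] K} {G : α → ℝ≥0∞} (hA : Integrable A μ) (hG : ∀ a, traceNorm (A a) ≤ G a) :
    traceNorm (∫ a, A a ∂μ) ≤ ∫⁻ a, G a ∂μ := by
  refine traceNorm_le fun N e f he hf => ?_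
  have coord_integrable (i : Fin N) : Integrable (fun a => ⟪A a (e i), f i⟫) μ :=
    (hA.apply_continuousLinearMap (e i)).inner_const (f i)
  calc ∑ i, ‖⟪(∫ a, A a ∂μ) (e i), f i⟫‖ₑ
      ≤ ∑ i, ∫⁻ a, ‖⟪A a (e i), f i⟫‖ₑ ∂μ := by
        gcongr with i
        rw [inner_integral_apply hA]
        exact enorm_integral_le_lintegral_enorm _
    _ = ∫⁻ a, ∑ i, ‖⟪A a (e i), f i⟫‖ₑ ∂μ :=
        (lintegral_finsetSum' _ fun i _ => (coord_integrable i).1.enorm).symm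
    _ ≤ ∫⁻ a, G a ∂μ := lintegral_mono fun a => (sum_enorm_inner_le_traceNorm _ he hf).trans (hG a)

end TraceNorm

/-! ### Bounded Lipschitz distance and tightness -/

lemma integrableOn_measureReal_of_antitone {α : Type*} [MeasurableSpace α] {ν : Measure α}
    [IsFiniteMeasure ν] {A : ℝ → Set α} (hA : Antitone A) (a b : ℝ) :
    IntegrableOn (fun t => ν.real (A t)) (Set.Ioc a b) := by
  have h_anti : Antitone fun t => ν.real (A t) := fun _ _ hst => measureReal_mono (hA hst)
  exact ((h_anti.antitoneOn _).integrableOn_isCompact isCompact_Icc).mono_set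
    Set.Ioc_subset_Icc_self
section BoundedLipschitz

variable {B : Type*} [NormedAddCommGroup B] [MeasurableSpace B]

lemma abs_integral_sub_le_dBL {μ ν : Measure B} {φ : B → ℝ} (hφ : LipschitzWith 1 φ)
    (hφ_le : ∀ x, |φ x| ≤ 1) :
    ENNReal.ofReal |∫ x, φ x ∂μ - ∫ x, φ x ∂ν| ≤ dBL μ ν :=
  le_iSup_of_le φ (le_iSup_of_le hφ (le_iSup_of_le hφ_le le_rfl))

lemma dBL_le {μ ν : Measure B} {c : ℝ≥0∞} (h : ∀ φ : B → ℝ, LipschitzWith 1 φ → (∀ x, |φ x| ≤ 1) →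
    ENNReal.ofReal |∫ x, φ x ∂μ - ∫ x, φ x ∂ν| ≤ c) : dBL μ ν ≤ c :=
  iSup_le fun φ => iSup_le fun hφ => iSup_le fun hφ_le => h φ hφ hφ_le

lemma dBL_comm (μ ν : Measure B) : dBL μ ν = dBL ν μ := by
  simp_rw [dBL, abs_sub_comm (∫ _, _ ∂μ)]

lemma dBL_triangle (μ ν ρ : Measure B) : dBL μ ρ ≤ dBL μ ν + dBL ν ρ := by
  refine dBL_le fun φ hφ hφ_le => ?_
  calc ENNReal.ofReal |∫ x, φ x ∂μ - ∫ x, φ x ∂ρ|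
      ≤ ENNReal.ofReal (|∫ x, φ x ∂μ - ∫ x, φ x ∂ν| + |∫ x, φ x ∂ν - ∫ x, φ x ∂ρ|) :=
        ENNReal.ofReal_le_ofReal (abs_sub_le _ _ _)
    _ ≤ dBL μ ν + dBL ν ρ := by
        rw [ENNReal.ofReal_add (abs_nonneg _) (abs_nonneg _)]
        exact add_le_add (abs_integral_sub_le_dBL hφ hφ_le) (abs_integral_sub_le_dBL hφ hφ_le)

variable [BorelSpace B]

lemma integrable_of_lipschitzWith_of_abs_le {μ : Measure B} [IsFiniteMeasure μ] {φ : B → ℝ}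
    (hφ : LipschitzWith 1 φ) {c : ℝ} (hφ_le : ∀ x, |φ x| ≤ c) : Integrable φ μ :=
  Integrable.of_bound hφ.continuous.measurable.aestronglyMeasurable c (ae_of_all _ hφ_le)

omit [MeasurableSpace B] [BorelSpace B] in
lemma thickening_setOf_le_subset {φ : B → ℝ} (hφ : LipschitzWith 1 φ) (ε t : ℝ) :
    Metric.thickening ε {x | t ≤ φ x} ⊆ {x | t ≤ φ x + ε} := by
  intro x hx
  obtain ⟨a, ha : t ≤ φ a, hxa⟩ := Metric.mem_thickening_iff.1 hx
  have hφ_dist : |φ a - φ x| ≤ dist x a := by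
    simpa [Real.dist_eq, dist_comm a x] using hφ.dist_le_mul a x
  change t ≤ φ x + ε
  linarith [(abs_le.1 hφ_dist).2]

open BoundedContinuousFunction in
lemma integral_le_integral_add_of_levyProkhorovEDist_lt {μ ν : Measure B}
    [IsFiniteMeasure μ] [IsFiniteMeasure ν] {ε : ℝ} (hε : 0 < ε)
    (h : levyProkhorovEDist μ ν < ENNReal.ofReal ε) (f : B →ᵇ ℝ) (hf : LipschitzWith 1 f)
    (hf_nonneg : ∀ x, 0 ≤ f x) :
    ∫ x, f x ∂μ ≤ ∫ x, (f x + ε) ∂ν + ε * ‖f‖ := by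
  let g : B →ᵇ ℝ := f + const B ε
  have hfg : ‖f‖ ≤ ‖g‖ := (norm_le (norm_nonneg _)).2 fun x => by
    refine le_trans ?_ (g.norm_coe_le_norm x)
    rw [Real.norm_of_nonneg (hf_nonneg x)]
    exact (le_add_of_nonneg_right hε.le).trans (Real.le_norm_self _)
  have h_anti : Antitone fun t : ℝ => Metric.thickening ε {x | t ≤ f x} := fun s t hst =>
    Metric.thickening_subset_of_subset _ fun x (hx : t ≤ f x) => hst.trans hx
  have h_anti' : Antitone fun t : ℝ => {x | t ≤ g x} := fun s t hst x (hx : t ≤ g x) =>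
    hst.trans hx
  calc ∫ x, f x ∂μ
      ≤ (∫ t in Set.Ioc 0 ‖f‖, ν.real (Metric.thickening ε {x | t ≤ f x})) + ε * ‖f‖ :=
        integral_le_of_levyProkhorovEDist_lt μ ν hε h f (ae_of_all _ hf_nonneg)
    _ ≤ (∫ t in Set.Ioc 0 ‖g‖, ν.real {x | t ≤ g x}) + ε * ‖f‖ := by
        refine add_le_add_left (le_trans (setIntegral_mono_set
          (integrableOn_measureReal_of_antitone h_anti 0 ‖g‖) (ae_of_all _ fun _ =>
          measureReal_nonneg) (Set.Ioc_subset_Ioc_right hfg).eventuallyLE) ?_) _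
        exact integral_mono (integrableOn_measureReal_of_antitone h_anti 0 ‖g‖)
          (integrableOn_measureReal_of_antitone h_anti' 0 ‖g‖)
          fun t => measureReal_mono (thickening_setOf_le_subset hf ε t)
    _ = ∫ x, (f x + ε) ∂ν + ε * ‖f‖ := by
        rw [← integral_eq_integral_meas_le g ν
          (ae_of_all _ fun x => add_nonneg (hf_nonneg x) hε.le)]
        rfl

lemma integral_sub_le_of_levyProkhorovEDist_lt {μ ν : Measure B} [IsProbabilityMeasure μ]
    [IsProbabilityMeasure ν] {ε : ℝ} (hε : 0 < ε)
    (h : levyProkhorovEDist μ ν < ENNReal.ofReal ε) {φ : B → ℝ} (hφ : LipschitzWith 1 φ)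
    (hφ_le : ∀ x, |φ x| ≤ 1) : ∫ x, φ x ∂μ - ∫ x, φ x ∂ν ≤ 3 * ε := by
  have h_bound : ∀ x, ‖φ x + 1‖ ≤ 2 := fun x => by
    rw [Real.norm_eq_abs, abs_le]
    constructor <;> linarith [abs_le.1 (hφ_le x)]
  let f := BoundedContinuousFunction.ofNormedAddCommGroup (fun x => φ x + 1)
    (hφ.continuous.add continuous_const) 2 h_bound
  have hf : LipschitzWith 1 f := by
    have h_add := hφ.add (LipschitzWith.const (1 : ℝ))
    rwa [add_zero] at h_add
  have hf_norm : ‖f‖ ≤ 2 :=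
    BoundedContinuousFunction.norm_ofNormedAddCommGroup_le _ zero_le_two h_bound
  have key : ∫ x, (φ x + 1) ∂μ ≤ ∫ x, (φ x + 1 + ε) ∂ν + ε * ‖f‖ :=
    integral_le_integral_add_of_levyProkhorovEDist_lt hε h f hf fun x => by
      change 0 ≤ φ x + 1
      linarith [(abs_le.1 (hφ_le x)).1]
  have hφμ : Integrable φ μ := integrable_of_lipschitzWith_of_abs_le hφ hφ_le
  have hφν : Integrable φ ν := integrable_of_lipschitzWith_of_abs_le hφ hφ_le
  simp_rw [add_assoc] at key
  rw [integral_add hφμ (integrable_const _), integral_add hφν (integrable_const _)] at key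
  simp only [integral_const, probReal_univ, one_smul] at key
  nlinarith

lemma dBL_le_levyProkhorovEDist (μ ν : Measure B) [IsProbabilityMeasure μ]
    [IsProbabilityMeasure ν] : dBL μ ν ≤ 3 * levyProkhorovEDist μ ν := by
  refine ENNReal.le_of_forall_pos_le_add fun r hr h_fin => ?_
  have h_ne_top : levyProkhorovEDist μ ν ≠ ∞ := fun h => by simp [h] at h_fin
  set ε : ℝ := (levyProkhorovEDist μ ν).toReal + r / 3 with hε_def
  have hε : 0 < ε := by positivity
  have h_ofReal : ENNReal.ofReal ε = levyProkhorovEDist μ ν + ENNReal.ofReal (r / 3) := by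
    rw [hε_def, ENNReal.ofReal_add ENNReal.toReal_nonneg (by positivity),
      ENNReal.ofReal_toReal h_ne_top]
  have h_lt : levyProkhorovEDist μ ν < ENNReal.ofReal ε := by
    rw [h_ofReal]
    exact ENNReal.lt_add_right h_ne_top (by simpa using hr)
  refine dBL_le fun φ hφ hφ_le => ?_
  calc ENNReal.ofReal |∫ x, φ x ∂μ - ∫ x, φ x ∂ν|
      ≤ ENNReal.ofReal (3 * ε) := ENNReal.ofReal_le_ofReal <| abs_sub_le_iff.2
        ⟨integral_sub_le_of_levyProkhorovEDist_lt hε h_lt hφ hφ_le,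
          integral_sub_le_of_levyProkhorovEDist_lt hε (levyProkhorovEDist_comm μ ν ▸ h_lt)
            hφ hφ_le⟩
    _ = 3 * levyProkhorovEDist μ ν + r := by
        rw [ENNReal.ofReal_mul zero_le_three, h_ofReal, mul_add, ENNReal.ofReal_ofNat,
          ← ENNReal.ofReal_ofNat 3, ← ENNReal.ofReal_mul zero_le_three,
          mul_div_cancel₀ _ three_ne_zero, ENNReal.ofReal_coe_nnreal]

lemma tendsto_dBL [SecondCountableTopology B] {ι : Type*} {l : Filter ι}
    {μ : ι → ProbabilityMeasure B} {ν : ProbabilityMeasure B} (h : Tendsto μ l (𝓝 ν)) :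
    Tendsto (fun i => dBL (μ i : Measure B) (ν : Measure B)) l (𝓝 0) := by
  have h_prokhorov :
      Tendsto (fun i => levyProkhorovEDist (μ i : Measure B) (ν : Measure B)) l (𝓝 0) :=
    tendsto_iff_edist_tendsto_0.1
      (((LevyProkhorov.continuous_ofMeasure_probabilityMeasure (Ω := B)).tendsto ν).comp h)
  have h_mul := ENNReal.Tendsto.const_mul (a := 3) h_prokhorov (Or.inr (by simp))
  rw [mul_zero] at h_mul
  exact tendsto_of_tendsto_of_tendsto_of_le_of_le tendsto_const_nhds h_mul (fun _ => zero_le)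
    fun _ => dBL_le_levyProkhorovEDist _ _

omit [MeasurableSpace B] [BorelSpace B] in
lemma enorm_sub_le_add_indicator {φ : B → ℝ} (hφ : LipschitzWith 1 φ) (hφ_le : ∀ x, |φ x| ≤ 1)
    (δ : ℝ≥0∞) (x y : B) :
    ‖φ x - φ y‖ₑ ≤ δ + {p : B × B | δ ≤ ‖p.1 - p.2‖ₑ}.indicator (fun _ => 2) (x, y) := by
  by_cases hxy : δ ≤ ‖x - y‖ₑ
  · rw [Set.indicator_of_mem (by exact hxy), Real.enorm_eq_ofReal_abs, ← ENNReal.ofReal_ofNat 2]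
    refine le_add_left (ENNReal.ofReal_le_ofReal ?_)
    linarith [abs_sub (φ x) (φ y), hφ_le x, hφ_le y]
  · rw [Set.indicator_of_notMem (by exact hxy), add_zero]
    have h_lip := hφ.edist_le_mul x y
    rw [edist_eq_enorm_sub, edist_eq_enorm_sub, ENNReal.coe_one, one_mul] at h_lip
    exact h_lip.trans (not_le.1 hxy).le

lemma dBL_map_le [SecondCountableTopology B] {Ω : Type*} [MeasurableSpace Ω] {μ : Measure Ω}
    [IsProbabilityMeasure μ] {T T' : Ω → B} (hT : Measurable T) (hT' : Measurable T')
    (δ : ℝ≥0∞) :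
    dBL (μ.map T) (μ.map T') ≤ δ + 2 * μ {ω | δ ≤ ‖T ω - T' ω‖ₑ} := by
  refine dBL_le fun φ hφ hφ_le => ?_
  have hφm := hφ.continuous.measurable
  have h_int : ∀ {U : Ω → B}, Measurable U → Integrable (fun ω => φ (U ω)) μ := fun hU =>
    Integrable.of_bound (hφm.comp hU).aestronglyMeasurable 1 (ae_of_all _ fun ω => hφ_le _)
  have h_meas : MeasurableSet {ω | δ ≤ ‖T ω - T' ω‖ₑ} :=
    measurableSet_le measurable_const (hT.sub hT').enorm
  rw [integral_map hT.aemeasurable hφm.aestronglyMeasurable,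
    integral_map hT'.aemeasurable hφm.aestronglyMeasurable,
    ← integral_sub (h_int hT) (h_int hT'), ← Real.enorm_eq_ofReal_abs]
  calc ‖∫ ω, (φ (T ω) - φ (T' ω)) ∂μ‖ₑ
      ≤ ∫⁻ ω, ‖φ (T ω) - φ (T' ω)‖ₑ ∂μ := enorm_integral_le_lintegral_enorm _
    _ ≤ ∫⁻ ω, (δ + {ω | δ ≤ ‖T ω - T' ω‖ₑ}.indicator (fun _ => 2) ω) ∂μ :=
        lintegral_mono fun ω => enorm_sub_le_add_indicator hφ hφ_le δ (T ω) (T' ω)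
    _ = δ + 2 * μ {ω | δ ≤ ‖T ω - T' ω‖ₑ} := by
        rw [lintegral_add_left measurable_const, lintegral_const, measure_univ, mul_one,
          lintegral_indicator_const h_meas]

end BoundedLipschitz

section Projection

variable {H : Type*} [NormedAddCommGroup H] [InnerProductSpace ℝ H] {ι : Type*}

/-- The orthogonal projection of `x` on the span of the basis vectors with index in `s`. -/
def basisProj (b : HilbertBasis ι ℝ H) (s : Finset ι) (x : H) : H := ∑ p ∈ s, ⟪b p, x⟫ • b p

lemma continuous_basisProj (b : HilbertBasis ι ℝ H) (s : Finset ι) :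
    Continuous (basisProj b s) := by
  unfold basisProj; fun_prop

lemma totallyBounded_basisProj_image (b : HilbertBasis ι ℝ H) (s : Finset ι) {K : Set H}
    (hK : Bornology.IsBounded K) : TotallyBounded (basisProj b s '' K) := by
  obtain ⟨R, hR⟩ := hK.exists_norm_le
  let combination : (s → ℝ) → H := fun c => ∑ p, c p • b p
  have h_compact : IsCompact (combination '' Set.univ.pi fun _ => Set.Icc (-R) R) :=
    (isCompact_univ_pi fun _ => isCompact_Icc).image (by fun_prop)
  refine h_compact.totallyBounded.subset ?_
  rintro _ ⟨x, hx, rfl⟩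
  refine ⟨fun p => ⟪b p, x⟫, fun p _ => abs_le.1 ?_, Finset.sum_coe_sort s fun p => ⟪b p, x⟫ • b p⟩
  calc |⟪b p, x⟫| ≤ ‖b p‖ * ‖x‖ := abs_real_inner_le_norm _ _
    _ ≤ R := by rw [b.orthonormal.1 p, one_mul]; exact hR x hx

lemma totallyBounded_of_basisProj (b : HilbertBasis ι ℝ H) {K : Set H}
    (hK : Bornology.IsBounded K)
    (h_tail : ∀ ε : ℝ≥0∞, 0 < ε → ∃ s : Finset ι, ∀ x ∈ K, ‖x - basisProj b s x‖ₑ < ε) :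
    TotallyBounded K := by
  refine EMetric.totallyBounded_iff.2 fun ε hε => ?_
  obtain ⟨s, hs⟩ := h_tail (ε / 2) (ENNReal.half_pos hε.ne')
  obtain ⟨t, ht_fin, ht⟩ := EMetric.totallyBounded_iff.1 (totallyBounded_basisProj_image b s hK)
    (ε / 2) (ENNReal.half_pos hε.ne')
  refine ⟨t, ht_fin, fun x hx => ?_⟩
  obtain ⟨y, hy, hxy⟩ := Set.mem_iUnion₂.1 (ht ⟨x, hx, rfl⟩)
  refine Set.mem_iUnion₂.2 ⟨y, hy, ?_⟩
  calc edist x y ≤ edist x (basisProj b s x) + edist (basisProj b s x) y := edist_triangle _ _ _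
    _ < ε / 2 + ε / 2 := ENNReal.add_lt_add (by rw [edist_eq_enorm_sub]; exact hs x hx) hxy
    _ = ε := ENNReal.add_halves ε

lemma inner_basisProj [DecidableEq ι] (b : HilbertBasis ι ℝ H) (s : Finset ι) (x : H) (p : ι) :
    ⟪b p, basisProj b s x⟫ = if p ∈ s then ⟪b p, x⟫ else 0 := by
  simp [basisProj, inner_sum, inner_smul_right, orthonormal_iff_ite.1 b.orthonormal]

variable [CompleteSpace H]

lemma enorm_sub_basisProj_sq (b : HilbertBasis ι ℝ H) (s : Finset ι) (x : H) :
    ‖x - basisProj b s x‖ₑ ^ 2 = ∑' p : {p // p ∉ s}, ‖⟪b p, x⟫‖ₑ ^ 2 := by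
  classical
  rw [← tsum_enorm_inner_sq b]
  refine (tsum_congr fun p => ?_).trans
    (tsum_subtype {p | p ∉ s} fun p => ‖⟪b p, x⟫‖ₑ ^ 2).symm
  rw [inner_sub_right, inner_basisProj]
  by_cases hp : p ∈ s <;> simp [hp]

lemma enorm_basisProj_le (b : HilbertBasis ι ℝ H) (s : Finset ι) (x : H) :
    ‖basisProj b s x‖ₑ ≤ ‖x‖ₑ := by
  classical
  rw [← ENNReal.pow_le_pow_left_iff two_ne_zero, ← tsum_enorm_inner_sq b, ← tsum_enorm_inner_sq b]
  refine ENNReal.tsum_le_tsum fun p => ?_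
  rw [inner_basisProj]
  split_ifs <;> simp

end Projection

lemma measure_lt_le_lintegral_sq_div {α : Type*} [MeasurableSpace α] {μ : Measure α}
    {f : α → ℝ≥0∞} (hf : AEMeasurable f μ) {r : ℝ≥0∞} (hr : r ≠ 0) (hr_top : r ≠ ∞) :
    μ {x | r < f x} ≤ (∫⁻ x, f x ^ 2 ∂μ) / r ^ 2 :=
  calc μ {x | r < f x} ≤ μ {x | r ^ 2 ≤ f x ^ 2} :=
        measure_mono fun _ hx => pow_le_pow_left' (le_of_lt hx) 2
    _ ≤ _ := meas_ge_le_lintegral_div (hf.pow_const 2) (pow_ne_zero 2 hr)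
        (ENNReal.pow_ne_top hr_top)

section Tightness

variable {H : Type*} [NormedAddCommGroup H] [InnerProductSpace ℝ H] [CompleteSpace H] {ι : Type*}

lemma isCompact_setOf_basisProj (b : HilbertBasis ι ℝ H) (R : ℝ≥0) (s : ℕ → Finset ι)
    {r : ℕ → ℝ≥0∞} (hr : Tendsto r atTop (𝓝 0)) :
    IsCompact ({x : H | ‖x‖ₑ ≤ R} ∩ ⋂ m, {x | ‖x - basisProj b (s m) x‖ₑ ≤ r m}) := by
  refine TotallyBounded.isCompact_of_isClosed (totallyBounded_of_basisProj b ?_ fun ε hε => ?_) ?_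
  · refine (Metric.isBounded_closedBall (x := (0 : H)) (r := R)).subset fun x hx => ?_
    have hx_norm : ‖x‖ₑ ≤ R := hx.1
    rw [enorm_eq_nnnorm, ENNReal.coe_le_coe] at hx_norm
    exact mem_closedBall_zero_iff.2 hx_norm
  · obtain ⟨m, hm⟩ := ((tendsto_order.1 hr).2 ε hε).exists
    exact ⟨s m, fun x hx => (Set.mem_iInter.1 hx.2 m).trans_lt hm⟩
  · refine (isClosed_le continuous_enorm continuous_const).inter (isClosed_iInter fun m => ?_)
    exact isClosed_le (continuous_id.sub (continuous_basisProj b _)).enorm continuous_const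

variable [MeasurableSpace H] [BorelSpace H]

lemma isTightMeasureSet_of_basisProj (b : HilbertBasis ι ℝ H) {S : Set (Measure H)} {C : ℝ≥0}
    (hC : ∀ μ ∈ S, ∫⁻ x, ‖x‖ₑ ^ 2 ∂μ ≤ C)
    (h_tail : ∀ δ : ℝ≥0∞, 0 < δ → ∃ s : Finset ι, ∀ μ ∈ S,
      ∫⁻ x, ‖x - basisProj b s x‖ₑ ^ 2 ∂μ ≤ δ) :
    IsTightMeasureSet S := by
  refine isTightMeasureSet_iff_exists_isCompact_measure_compl_le.2 fun ε hε => ?_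
  have hε2 : ε / 2 ≠ 0 := (ENNReal.half_pos hε.ne').ne'
  obtain ⟨R, hR_pos, hR⟩ := ENNReal.exists_nat_pos_inv_mul_lt (ENNReal.coe_ne_top (r := C)) hε2
  obtain ⟨δ, hδ_pos, hδ⟩ := ENNReal.exists_pos_sum_of_countable' hε2 ℕ
  let r : ℕ → ℝ≥0∞ := fun m => ((m + 1 : ℕ) : ℝ≥0∞)⁻¹
  have hr : ∀ m, r m ≠ 0 := fun m => ENNReal.inv_ne_zero.2 (ENNReal.natCast_ne_top _)
  have hr_top : ∀ m, r m ≠ ∞ := fun m => ENNReal.inv_ne_top.2 (by simp)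
  choose s hs using fun m => h_tail (δ m * r m ^ 2)
    (ENNReal.mul_pos (hδ_pos m).ne' (pow_ne_zero 2 (hr m)))
  refine ⟨_, isCompact_setOf_basisProj b R s
    (ENNReal.tendsto_inv_nat_nhds_zero.comp (tendsto_add_atTop_nat 1)), fun μ hμ => ?_⟩
  have h_ball : μ {x | ((R : ℝ≥0) : ℝ≥0∞) < ‖x‖ₑ} ≤ ε / 2 := by
    have hR_one : (1 : ℝ≥0∞) ≤ R := by exact_mod_cast hR_pos
    calc μ {x | ((R : ℝ≥0) : ℝ≥0∞) < ‖x‖ₑ} ≤ (∫⁻ x, ‖x‖ₑ ^ 2 ∂μ) / R ^ 2 := by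
          simpa using measure_lt_le_lintegral_sq_div (μ := μ) measurable_enorm.aemeasurable
            (Nat.cast_ne_zero.2 hR_pos.ne') (ENNReal.natCast_ne_top R)
      _ ≤ (R : ℝ≥0∞)⁻¹ * C := by
          rw [mul_comm, ← div_eq_mul_inv]
          exact ENNReal.div_le_div (hC μ hμ) (le_self_pow₀ hR_one two_ne_zero)
      _ ≤ ε / 2 := hR.le
  have h_proj : ∀ m, μ {x | r m < ‖x - basisProj b (s m) x‖ₑ} ≤ δ m := fun m =>
    (measure_lt_le_lintegral_sq_div (continuous_id.sub
      (continuous_basisProj b _)).enorm.measurable.aemeasurable (hr m) (hr_top m)).trans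
      (ENNReal.div_le_of_le_mul (hs m μ hμ))
  calc μ ({x | ‖x‖ₑ ≤ (R : ℝ≥0)} ∩ ⋂ m, {x | ‖x - basisProj b (s m) x‖ₑ ≤ r m})ᶜ
      = μ ({x | ((R : ℝ≥0) : ℝ≥0∞) < ‖x‖ₑ} ∪ ⋃ m, {x | r m < ‖x - basisProj b (s m) x‖ₑ}) := by
        simp only [Set.compl_inter, Set.compl_iInter, Set.compl_ofPred, not_le]
    _ ≤ ε / 2 + ∑' m, δ m := (measure_union_le _ _).trans (add_le_add h_ball
        ((measure_iUnion_le _).trans (ENNReal.tsum_le_tsum h_proj)))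
    _ ≤ ε := (add_le_add_right hδ.le _).trans_eq (ENNReal.add_halves ε)

end Tightness

/-! ### Uniform convergence in probability -/

section UniformConvergence

variable {Θ Ω : Type*} [MeasurableSpace Ω] {S : Set Θ} {Pr : Θ → Measure Ω}
  {D D' : ℕ → Θ → Ω → ℝ≥0∞}

lemma measure_le_le_of_le_add {P : Measure Ω} {f g h : Ω → ℝ≥0∞} (hfg : ∀ ω, f ω ≤ g ω + h ω)
    (δ : ℝ) :
    P {ω | ENNReal.ofReal δ ≤ f ω} ≤
      P {ω | ENNReal.ofReal (δ / 2) ≤ g ω} + P {ω | ENNReal.ofReal (δ / 2) ≤ h ω} := by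
  refine (measure_mono fun ω (hω : ENNReal.ofReal δ ≤ f ω) => ?_).trans (measure_union_le _ _)
  by_contra! h_not
  simp only [Set.mem_union, Set.mem_ofPred_eq, not_or, not_le] at h_not
  refine (ENNReal.add_lt_add h_not.1 h_not.2).not_ge ?_
  rw [ENNReal.ofReal_div_of_pos two_pos, ENNReal.ofReal_ofNat, ENNReal.add_halves]
  exact hω.trans (hfg ω)

namespace UnifTendstoZeroInProb

lemma of_le_eventually (h : UnifTendstoZeroInProb S Pr D')
    (hle : ∀ᶠ n in atTop, ∀ θ ∈ S, ∀ ω, D n θ ω ≤ D' n θ ω) : UnifTendstoZeroInProb S Pr D := by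
  intro δ hδ
  refine tendsto_of_tendsto_of_tendsto_of_le_of_le' tendsto_const_nhds (h δ hδ)
    (Eventually.of_forall fun _ => zero_le) (hle.mono fun n hn => ?_)
  exact iSup₂_mono fun θ hθ => measure_mono fun ω hω => le_trans hω (hn θ hθ ω)

lemma add (h : UnifTendstoZeroInProb S Pr D) (h' : UnifTendstoZeroInProb S Pr D') :
    UnifTendstoZeroInProb S Pr fun n θ ω => D n θ ω + D' n θ ω := by
  intro δ hδ
  have h_add := (h (δ / 2) (half_pos hδ)).add (h' (δ / 2) (half_pos hδ))
  rw [add_zero] at h_add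
  refine tendsto_of_tendsto_of_tendsto_of_le_of_le tendsto_const_nhds h_add
    (fun _ => zero_le) fun n => iSup₂_le fun θ hθ => ?_
  exact (measure_le_le_of_le_add (fun _ => le_rfl) δ).trans
    (add_le_add (le_iSup₂ (f := fun θ (_ : θ ∈ S) => Pr θ _) θ hθ)
      (le_iSup₂ (f := fun θ (_ : θ ∈ S) => Pr θ _) θ hθ))

lemma zero : UnifTendstoZeroInProb S Pr fun _ _ _ => 0 := by
  intro δ hδ
  simp [hδ.not_ge]

lemma sum {ι : Type*} (s : Finset ι) {D : ι → ℕ → Θ → Ω → ℝ≥0∞}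
    (h : ∀ i ∈ s, UnifTendstoZeroInProb S Pr (D i)) :
    UnifTendstoZeroInProb S Pr fun n θ ω => ∑ i ∈ s, D i n θ ω := by
  classical
  induction s using Finset.induction_on with
  | empty => simpa using zero
  | insert a s ha ih =>
    simp_rw [Finset.sum_insert ha]
    exact (h a (Finset.mem_insert_self _ _)).add
      (ih fun i hi => h i (Finset.mem_insert_of_mem hi))

lemma const_mul (c : ℝ≥0) (h : UnifTendstoZeroInProb S Pr D) :
    UnifTendstoZeroInProb S Pr fun n θ ω => c * D n θ ω := by
  intro δ hδ
  rcases eq_or_ne c 0 with rfl | hc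
  · simp [hδ.not_ge]
  · have hc_pos : (0 : ℝ) < c := by positivity
    refine (h (δ / c) (by positivity)).congr fun n => iSup_congr fun θ => iSup_congr fun _ => ?_
    congr 1
    ext ω
    rw [Set.mem_ofPred_eq, Set.mem_ofPred_eq, ENNReal.ofReal_div_of_pos hc_pos,
      ENNReal.ofReal_coe_nnreal, ENNReal.div_le_iff (by simpa using hc) (by simp), mul_comm]

lemma of_le_add_of_lintegral_le (h : ∀ κ : ℝ≥0, 0 < κ → ∃ D' E : ℕ → Θ → Ω → ℝ≥0∞,
      UnifTendstoZeroInProb S Pr D' ∧ ∀ᶠ n in atTop, ∀ θ ∈ S,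
        (∀ ω, D n θ ω ≤ D' n θ ω + E n θ ω) ∧ AEMeasurable (E n θ) (Pr θ) ∧
        ∫⁻ ω, E n θ ω ∂(Pr θ) ≤ κ) :
    UnifTendstoZeroInProb S Pr D := by
  intro δ hδ
  refine ENNReal.tendsto_nhds_zero.2 fun ε hε => ?_
  have hδ2 : ENNReal.ofReal (δ / 2) ≠ 0 := (ENNReal.ofReal_pos.2 (half_pos hδ)).ne'
  obtain ⟨κ, hκ_pos, hκ⟩ := ENNReal.lt_iff_exists_nnreal_btwn.1
    (ENNReal.mul_pos (ENNReal.half_pos hε.ne').ne' hδ2)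
  obtain ⟨D', E, hD', hDE⟩ := h κ (ENNReal.coe_pos.1 hκ_pos)
  filter_upwards [ENNReal.tendsto_nhds_zero.1 (hD' (δ / 2) (half_pos hδ)) (ε / 2)
    (ENNReal.half_pos hε.ne'), hDE] with n hn hDEn
  refine iSup₂_le fun θ hθ => ?_
  obtain ⟨hle, hE_meas, hE_le⟩ := hDEn θ hθ
  calc Pr θ {ω | ENNReal.ofReal δ ≤ D n θ ω}
      ≤ Pr θ {ω | ENNReal.ofReal (δ / 2) ≤ D' n θ ω} +
          Pr θ {ω | ENNReal.ofReal (δ / 2) ≤ E n θ ω} := measure_le_le_of_le_add hle δ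
    _ ≤ ε / 2 + ε / 2 := add_le_add
        ((le_iSup₂ (f := fun θ (_ : θ ∈ S) =>
          Pr θ {ω | ENNReal.ofReal (δ / 2) ≤ D' n θ ω}) θ hθ).trans hn)
        ((meas_ge_le_lintegral_div hE_meas hδ2 ENNReal.ofReal_ne_top).trans
          (ENNReal.div_le_of_le_mul (hE_le.trans hκ.le)))
    _ = ε := ENNReal.add_halves ε

lemma of_lintegral {c : ℕ → ℝ≥0∞} (hc : Tendsto c atTop (𝓝 0))
    (h : ∀ᶠ n in atTop, ∀ θ ∈ S, AEMeasurable (D n θ) (Pr θ) ∧ ∫⁻ ω, D n θ ω ∂(Pr θ) ≤ c n) :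
    UnifTendstoZeroInProb S Pr D := by
  refine of_le_add_of_lintegral_le fun κ hκ => ⟨fun _ _ _ => 0, D, zero, ?_⟩
  filter_upwards [h, ENNReal.tendsto_nhds_zero.1 hc κ (by simpa using hκ)] with n hn hcn θ hθ
  exact ⟨fun ω => by simp, (hn θ hθ).1, (hn θ hθ).2.trans hcn⟩

end UnifTendstoZeroInProb

lemma UnifTendstoInDistribution.of_sub {B : Type*} [NormedAddCommGroup B] [MeasurableSpace B]
    [BorelSpace B] [SecondCountableTopology B] {T : ℕ → Ω → B} {T' : ℕ → Θ → Ω → B}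
    {N : Θ → Measure B} (hPr : ∀ θ ∈ S, IsProbabilityMeasure (Pr θ))
    (hT : ∀ n, ∀ θ ∈ S, Measurable (T n)) (hT' : ∀ n, ∀ θ ∈ S, Measurable (T' n θ))
    (hN : Tendsto (fun n => ⨆ θ ∈ S, dBL ((Pr θ).map (T' n θ)) (N θ)) atTop (𝓝 0))
    (h : UnifTendstoZeroInProb S Pr fun n θ ω => ‖T n ω - T' n θ ω‖ₑ) :
    UnifTendstoInDistribution S Pr T N := by
  refine ENNReal.tendsto_nhds_zero.2 fun ε hε => ?_
  obtain ⟨δ, hδ_pos, hδ⟩ := ENNReal.lt_iff_exists_nnreal_btwn.1 (ENNReal.half_pos hε.ne')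
  have h_add := (ENNReal.Tendsto.const_mul (a := 2) (h δ (by simpa using hδ_pos))
    (Or.inr (by simp))).add hN
  rw [mul_zero, add_zero] at h_add
  simp only [ENNReal.ofReal_coe_nnreal] at h_add
  filter_upwards [ENNReal.tendsto_nhds_zero.1 h_add (ε / 2) (ENNReal.half_pos hε.ne')] with n hn
  refine iSup₂_le fun θ hθ => ?_
  have := hPr θ hθ
  calc dBL ((Pr θ).map (T n)) (N θ)
      ≤ (δ + 2 * Pr θ {ω | δ ≤ ‖T n ω - T' n θ ω‖ₑ}) + dBL ((Pr θ).map (T' n θ)) (N θ) :=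
        (dBL_triangle _ ((Pr θ).map (T' n θ)) _).trans
          (add_le_add (dBL_map_le (hT n θ hθ) (hT' n θ hθ) δ) le_rfl)
    _ ≤ δ + (2 * (⨆ θ ∈ S, Pr θ {ω | δ ≤ ‖T n ω - T' n θ ω‖ₑ}) +
        ⨆ θ ∈ S, dBL ((Pr θ).map (T' n θ)) (N θ)) := by
        rw [add_assoc]
        gcongr
        · exact le_iSup₂ (f := fun θ (_ : θ ∈ S) => Pr θ {ω | δ ≤ ‖T n ω - T' n θ ω‖ₑ}) θ hθ
        · exact le_iSup₂ (f := fun θ (_ : θ ∈ S) => dBL ((Pr θ).map (T' n θ)) (N θ)) θ hθ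
    _ ≤ ε / 2 + ε / 2 := add_le_add hδ.le hn
    _ = ε := ENNReal.add_halves ε

end UniformConvergence

section SquareIntegrable

variable {α H : Type*} [MeasurableSpace α] {ν : Measure α} [NormedAddCommGroup H]

lemma memLp_two_of_lintegral_ne_top {X : α → H} (hm : AEStronglyMeasurable X ν)
    (hX : ∫⁻ a, ‖X a‖ₑ ^ 2 ∂ν ≠ ∞) : MemLp X 2 ν := by
  refine ⟨hm, ?_⟩
  rw [eLpNorm_lt_top_iff_lintegral_rpow_enorm_lt_top (by norm_num) (by norm_num)]
  simpa using hX.lt_top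

lemma lintegral_enorm_sq_eq_ofReal {X : α → H} (hX : MemLp X 2 ν) :
    ∫⁻ a, ‖X a‖ₑ ^ 2 ∂ν = ENNReal.ofReal (∫ a, ‖X a‖ ^ 2 ∂ν) := by
  rw [ofReal_integral_eq_lintegral_ofReal ((memLp_two_iff_integrable_sq_norm hX.1).1 hX)
    (ae_of_all _ fun _ => sq_nonneg _)]
  simp_rw [ENNReal.ofReal_pow (norm_nonneg _), ofReal_norm]

variable [InnerProductSpace ℝ H]

lemma integrable_inner_of_memLp_two {X Y : α → H} (hX : MemLp X 2 ν) (hY : MemLp Y 2 ν) :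
    Integrable (fun a => ⟪X a, Y a⟫) ν :=
  (hX.norm.integrable_mul hY.norm).mono' (hX.1.inner hY.1)
    (ae_of_all _ fun _ => norm_inner_le_norm _ _)

lemma integral_norm_sum_sq_of_orthogonal {ι : Type*} [Fintype ι] {V : ι → α → H}
    (hV : ∀ i, MemLp (V i) 2 ν) (hij : ∀ i j, i ≠ j → ∫ a, ⟪V i a, V j a⟫ ∂ν = 0) :
    ∫ a, ‖∑ i, V i a‖ ^ 2 ∂ν = ∑ i, ∫ a, ‖V i a‖ ^ 2 ∂ν := by
  have hcross : ∀ i j, Integrable (fun a => ⟪V i a, V j a⟫) ν := fun i j =>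
    integrable_inner_of_memLp_two (hV i) (hV j)
  simp_rw [← real_inner_self_eq_norm_sq, sum_inner, inner_sum]
  rw [integral_finsetSum _ fun i _ => integrable_finsetSum _ fun j _ => hcross i j]
  refine Finset.sum_congr rfl fun i _ => ?_
  rw [integral_finsetSum _ fun j _ => hcross i j]
  exact Finset.sum_eq_single i (fun j _ hj => hij i j hj.symm) (by simp)

lemma lintegral_enorm_sum_sq_of_orthogonal {ι : Type*} [Fintype ι] {V : ι → α → H}
    (hV : ∀ i, MemLp (V i) 2 ν) (hij : ∀ i j, i ≠ j → ∫ a, ⟪V i a, V j a⟫ ∂ν = 0) :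
    ∫⁻ a, ‖∑ i, V i a‖ₑ ^ 2 ∂ν = ∑ i, ∫⁻ a, ‖V i a‖ₑ ^ 2 ∂ν := by
  have hsum : MemLp (fun a => ∑ i, V i a) 2 ν := memLp_finsetSum _ fun i _ => hV i
  rw [lintegral_enorm_sq_eq_ofReal hsum,
    integral_norm_sum_sq_of_orthogonal hV hij,
    ENNReal.ofReal_sum_of_nonneg fun i _ => integral_nonneg fun a => sq_nonneg _]
  exact Finset.sum_congr rfl fun i _ => (lintegral_enorm_sq_eq_ofReal (hV i)).symm

end SquareIntegrable

lemma enorm_natCast_inv {n : ℕ} (hn : n ≠ 0) : ‖((n : ℝ)⁻¹)‖ₑ = (n : ℝ≥0∞)⁻¹ := by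
  rw [enorm_inv (by exact_mod_cast hn), Real.enorm_natCast]

lemma enorm_inv_sqrt_natCast_sq {n : ℕ} (hn : n ≠ 0) :
    ‖(√(n : ℝ))⁻¹‖ₑ ^ 2 = (n : ℝ≥0∞)⁻¹ := by
  rw [← enorm_pow, inv_pow, Real.sq_sqrt n.cast_nonneg, enorm_natCast_inv hn]

section IIDSample

variable {Ω T : Type*} [MeasurableSpace Ω] [MeasurableSpace T] {μ : Measure Ω}
  {W : ℕ → Ω → T} {P : Measure T}

lemma IsIIDSample.comp {T' : Type*} [MeasurableSpace T'] (h : IsIIDSample μ W P) {f : T → T'}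
    (hf : Measurable f) : IsIIDSample μ (fun i ω => f (W i ω)) (P.map f) :=
  ⟨fun i => hf.comp (h.1 i), h.2.1.comp (fun _ => f) fun _ => hf, fun i => by
    rw [← h.2.2 i, Measure.map_map hf (h.1 i)]; rfl⟩

lemma IsIIDSample.iIndepFun_fin (h : IsIIDSample μ W P) (n : ℕ) :
    iIndepFun (fun i : Fin n => W i) μ :=
  h.2.1.precomp Fin.val_injective

lemma IsIIDSample.measurePreserving (h : IsIIDSample μ W P) (i : ℕ) :
    MeasurePreserving (W i) μ P :=
  ⟨h.1 i, h.2.2 i⟩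

lemma IsIIDSample.isProbabilityMeasure [IsProbabilityMeasure μ] (h : IsIIDSample μ W P) :
    IsProbabilityMeasure P := by
  rw [← h.2.2 0]
  exact Measure.isProbabilityMeasure_map (h.1 0).aemeasurable

lemma IsIIDSample.isProbabilityMeasure_sampleSpace [hP : IsProbabilityMeasure P]
    (h : IsIIDSample μ W P) : IsProbabilityMeasure μ := by
  rw [← h.2.2 0] at hP
  exact Measure.isProbabilityMeasure_of_map (W 0)

lemma IsIIDSample.lintegral_average_le (h : IsIIDSample μ W P) {G : T → ℝ≥0∞} (hG : Measurable G)
    (n : ℕ) : ∫⁻ ω, (n : ℝ≥0∞)⁻¹ * ∑ i : Fin n, G (W i ω) ∂μ ≤ ∫⁻ x, G x ∂P := by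
  have hm : ∀ i : Fin n, Measurable fun ω => G (W i ω) := fun i => hG.comp (h.1 i)
  rw [lintegral_const_mul _ (Finset.measurable_sum _ fun i _ => hm i),
    lintegral_finsetSum _ fun i _ => hm i]
  simp_rw [(h.measurePreserving _).lintegral_comp hG]
  rw [Finset.sum_const, Finset.card_univ, Fintype.card_fin, nsmul_eq_mul, ← mul_assoc]
  exact mul_le_of_le_one_left' (ENNReal.inv_mul_le_one _)

lemma IsIIDSample.lintegral_enorm_sum_sq (h : IsIIDSample μ W P) {f : T → ℝ} (hf : Measurable f)
    (hf2 : MemLp f 2 P) (hf0 : ∫ x, f x ∂P = 0) (n : ℕ) :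
    ∫⁻ ω, ‖∑ i : Fin n, f (W i ω)‖ₑ ^ 2 ∂μ = n * ∫⁻ x, ‖f x‖ₑ ^ 2 ∂P := by
  have hmean : ∀ i, ∫ ω, f (W i ω) ∂μ = 0 := fun i => by
    rw [← hf0, ← (h.measurePreserving i).map_eq,
      integral_map (h.1 i).aemeasurable hf.aestronglyMeasurable]
  have hL2 : ∀ i : Fin n, MemLp (fun ω => f (W i ω)) 2 μ := fun i =>
    hf2.comp_measurePreserving (h.measurePreserving i)
  rw [lintegral_enorm_sum_sq_of_orthogonal hL2 fun i j hij => ?_]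
  · simp_rw [(h.measurePreserving _).lintegral_comp (hf.enorm.pow_const 2)]
    simp
  · have hindep : IndepFun (fun ω => f (W j ω)) (fun ω => f (W i ω)) μ :=
      ((h.iIndepFun_fin n).indepFun hij.symm).comp hf hf
    simpa [hmean] using hindep.integral_fun_mul_eq_mul_integral
      (hf.comp (h.1 j)).aestronglyMeasurable (hf.comp (h.1 i)).aestronglyMeasurable

end IIDSample

/-! ### The uniform central limit theorem -/

section Taylor

lemma norm_cexp_mul_I_sub_le_of_abs_le_one {y : ℝ} (hy : |y| ≤ 1) :
    ‖Complex.exp (y * Complex.I) - (1 + y * Complex.I - (y : ℂ) ^ 2 / 2)‖ ≤ |y| ^ 3 := by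
  have hnorm : ‖(y * Complex.I : ℂ)‖ = |y| := by simp
  have hsum : ∑ m ∈ Finset.range 3, (y * Complex.I : ℂ) ^ m / (m.factorial : ℂ) =
      1 + y * Complex.I - (y : ℂ) ^ 2 / 2 := by
    simp [Finset.sum_range_succ, mul_pow, Complex.I_sq, Nat.factorial]
    ring
  have hexp := Complex.exp_bound (x := y * Complex.I) (by rwa [hnorm]) (n := 3) (by norm_num)
  rw [hnorm, hsum] at hexp
  refine hexp.trans (mul_le_of_le_one_right (by positivity) ?_)
  norm_num [Nat.factorial]

lemma norm_cexp_mul_I_sub_le (y : ℝ) :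
    ‖Complex.exp (y * Complex.I) - (1 + y * Complex.I - (y : ℂ) ^ 2 / 2)‖ ≤
      2 + |y| + y ^ 2 / 2 := by
  calc ‖Complex.exp (y * Complex.I) - (1 + y * Complex.I - (y : ℂ) ^ 2 / 2)‖
      ≤ ‖Complex.exp (y * Complex.I)‖ + (‖(1 : ℂ)‖ + ‖y * Complex.I‖ + ‖(y : ℂ) ^ 2 / 2‖) := by
        refine (norm_sub_le _ _).trans ?_
        gcongr
        exact (norm_sub_le _ _).trans (by gcongr; exact norm_add_le _ _)
    _ = 2 + |y| + y ^ 2 / 2 := by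
        rw [Complex.norm_exp_ofReal_mul_I]
        simp
        ring

lemma norm_cexp_mul_I_sub_le_rpow {η : ℝ} (h0 : 0 ≤ η) (h1 : η ≤ 1) (y : ℝ) :
    ‖Complex.exp (y * Complex.I) - (1 + y * Complex.I - (y : ℂ) ^ 2 / 2)‖ ≤
      4 * |y| ^ (2 + η) := by
  rcases le_or_gt |y| 1 with hy | hy
  · have hpow : |y| ^ (3 : ℝ) ≤ |y| ^ (2 + η) :=
      Real.rpow_le_rpow_of_exponent_ge_of_imp (abs_nonneg y) hy (by linarith)
        fun _ h => absurd h (by linarith)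
    norm_cast at hpow
    linarith [norm_cexp_mul_I_sub_le_of_abs_le_one hy, pow_nonneg (abs_nonneg y) 3]
  · have hpow : |y| ^ (2 : ℝ) ≤ |y| ^ (2 + η) :=
      Real.rpow_le_rpow_of_exponent_le hy.le (by linarith)
    norm_cast at hpow
    nlinarith [norm_cexp_mul_I_sub_le y, sq_abs y]

lemma abs_exp_neg_sub_le {s : ℝ} (hs : 0 ≤ s) : |Real.exp (-s) - (1 - s)| ≤ s ^ 2 := by
  rcases le_or_gt s 1 with h | h
  · have := Real.abs_exp_sub_one_sub_id_le (x := -s) (by rwa [abs_neg, abs_of_nonneg hs])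
    rwa [neg_sq, sub_sub, ← sub_eq_add_neg] at this
  · have hle : Real.exp (-s) ≤ 1 := Real.exp_le_one_iff.2 (by linarith)
    rw [abs_of_nonneg (by linarith [Real.add_one_le_exp (-s)])]
    nlinarith

lemma norm_pow_sub_pow_le_mul {a b : ℂ} (ha : ‖a‖ ≤ 1) (hb : ‖b‖ ≤ 1) (n : ℕ) :
    ‖a ^ n - b ^ n‖ ≤ n * ‖a - b‖ := by
  induction n with
  | zero => simp
  | succ n ih =>
    calc ‖a ^ (n + 1) - b ^ (n + 1)‖ = ‖a ^ n * (a - b) + (a ^ n - b ^ n) * b‖ := by ring_nf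
      _ ≤ ‖a ^ n‖ * ‖a - b‖ + ‖a ^ n - b ^ n‖ * ‖b‖ := by
          simpa only [norm_mul] using norm_add_le (a ^ n * (a - b)) ((a ^ n - b ^ n) * b)
      _ ≤ 1 * ‖a - b‖ + n * ‖a - b‖ * 1 := by
          gcongr
          rw [norm_pow]
          exact pow_le_one₀ (norm_nonneg _) ha
      _ = (n + 1 : ℕ) * ‖a - b‖ := by push_cast; ring

lemma norm_integral_cexp_mul_I_sub_le {α : Type*} [MeasurableSpace α] {μ : Measure α}
    [IsProbabilityMeasure μ] {f : α → ℝ} {η : ℝ} (h0 : 0 ≤ η) (h1 : η ≤ 1) (hf : MemLp f 2 μ)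
    (hf0 : ∫ a, f a ∂μ = 0) (hfη : Integrable (fun a => |f a| ^ (2 + η)) μ) :
    ‖∫ a, Complex.exp (f a * Complex.I) ∂μ - (1 - (∫ a, f a ^ 2 ∂μ) / 2 : ℝ)‖ ≤
      4 * ∫ a, |f a| ^ (2 + η) ∂μ := by
  have hexp : Integrable (fun a => Complex.exp (f a * Complex.I)) μ := by
    refine Integrable.of_bound (hf.1.aemeasurable.complex_ofReal.mul_const
      Complex.I).cexp.aestronglyMeasurable 1 (ae_of_all _ fun a => ?_)
    rw [Complex.norm_exp_ofReal_mul_I]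
  have hlin : Integrable (fun a => 1 + (f a : ℂ) * Complex.I) μ :=
    (integrable_const _).add ((hf.integrable one_le_two).ofReal.mul_const _)
  have hquad : Integrable (fun a => (f a : ℂ) ^ 2 / 2) μ := by
    simpa using (hf.integrable_sq.ofReal (𝕜 := ℂ)).div_const 2
  have hpoly : ((1 - (∫ a, f a ^ 2 ∂μ) / 2 : ℝ) : ℂ) =
      ∫ a, (1 + f a * Complex.I - (f a : ℂ) ^ 2 / 2) ∂μ := by
    rw [integral_sub hlin hquad, integral_add (integrable_const _)
      ((hf.integrable one_le_two).ofReal.mul_const _), integral_mul_const, integral_div,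
      integral_complex_ofReal, hf0]
    simp_rw [← Complex.ofReal_pow]
    rw [integral_complex_ofReal]
    simp
  have hpoly_int : Integrable (fun a => 1 + f a * Complex.I - (f a : ℂ) ^ 2 / 2) μ :=
    hlin.sub hquad
  rw [hpoly, ← integral_sub hexp hpoly_int, ← integral_const_mul]
  exact norm_integral_le_of_norm_le (hfη.const_mul 4)
    (ae_of_all _ fun a => norm_cexp_mul_I_sub_le_rpow h0 h1 (f a))

end Taylor

section Moments

variable {α B : Type*} [MeasurableSpace α] {μ : Measure α} [NormedAddCommGroup B]

lemma integral_le_of_lintegral_enorm_le {f : α → ℝ} {C : ℝ≥0} (hf : ∫⁻ a, ‖f a‖ₑ ∂μ ≤ C) :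
    ∫ a, f a ∂μ ≤ C := by
  have h := (enorm_integral_le_lintegral_enorm f).trans hf
  rw [enorm_le_coe] at h
  exact (Real.le_norm_self _).trans (by exact_mod_cast h)

lemma rpow_le_one_add_rpow {r s : ℝ} (hr : 0 ≤ r) (hrs : r ≤ s) (x : ℝ≥0∞) :
    x ^ r ≤ 1 + x ^ s := by
  rcases le_total x 1 with hx | hx
  · exact (ENNReal.rpow_le_one hx hr).trans le_self_add
  · exact (ENNReal.rpow_le_rpow_of_exponent_le hx hrs).trans le_add_self

lemma lintegral_enorm_sq_le_of_lintegral_rpow_le [IsProbabilityMeasure μ] {η : ℝ} {C : ℝ≥0}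
    {X : α → B} (h0 : 0 ≤ η) (hC : ∫⁻ a, ‖X a‖ₑ ^ (2 + η) ∂μ ≤ C) :
    ∫⁻ a, ‖X a‖ₑ ^ 2 ∂μ ≤ (1 + C : ℝ≥0) := by
  simp_rw [← ENNReal.rpow_two]
  refine (lintegral_mono fun a =>
    rpow_le_one_add_rpow two_pos.le (le_add_of_nonneg_right h0) ‖X a‖ₑ).trans ?_
  rw [lintegral_add_left measurable_const, lintegral_const, measure_univ, mul_one]
  push_cast
  gcongr

lemma enorm_norm_rpow {p : ℝ} (hp : 0 ≤ p) (x : B) : ‖‖x‖ ^ p‖ₑ = ‖x‖ₑ ^ p := by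
  rw [Real.enorm_rpow_of_nonneg (norm_nonneg x) hp, enorm_norm]

end Moments

section Covariance

variable {H : Type*} [NormedAddCommGroup H] [InnerProductSpace ℝ H]
  [MeasurableSpace H]

/-- The uncentred covariance operator `∫ x ⊗ x dλ(x)`. -/
def covOp (lam : Measure H) : H →L[ℝ] H := ∫ x, outer x x ∂lam

/-- Uniformly over `θ ∈ S`, the probability measures `lam θ` are centred, have bounded moments of
order `2 + η`, and small tails of the expansion in the orthonormal basis `b`. The bound `η ≤ 1` is
a normalization. -/
structure UnifCentredMoments {Θ ι : Type*} (S : Set Θ) (lam : Θ → Measure H) (η : ℝ) (C : ℝ≥0)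
    (b : HilbertBasis ι ℝ H) : Prop where
  prob : ∀ θ ∈ S, IsProbabilityMeasure (lam θ)
  pos : 0 < η
  le_one : η ≤ 1
  mean : ∀ θ ∈ S, ∀ t, ∫ x, ⟪t, x⟫ ∂(lam θ) = 0
  mom : ∀ θ ∈ S, ∫⁻ x, ‖x‖ₑ ^ (2 + η) ∂(lam θ) ≤ C
  tail : ∀ δ : ℝ≥0∞, 0 < δ → ∃ s : Finset ι, ∀ θ ∈ S,
    ∫⁻ x, ‖x - basisProj b s x‖ₑ ^ 2 ∂(lam θ) ≤ δ

lemma UnifCentredMoments.lintegral_enorm_sq_le {Θ ι : Type*} {S : Set Θ} {lam : Θ → Measure H}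
    {η : ℝ} {C : ℝ≥0} {b : HilbertBasis ι ℝ H} (h : UnifCentredMoments S lam η C b) {θ : Θ}
    (hθ : θ ∈ S) : ∫⁻ x, ‖x‖ₑ ^ 2 ∂(lam θ) ≤ (1 + C : ℝ≥0) :=
  have := h.prob θ hθ
  lintegral_enorm_sq_le_of_lintegral_rpow_le h.pos.le (h.mom θ hθ)

variable [BorelSpace H] [SecondCountableTopology H]

lemma UnifCentredMoments.memLp_two {Θ ι : Type*} {S : Set Θ} {lam : Θ → Measure H}
    {η : ℝ} {C : ℝ≥0} {b : HilbertBasis ι ℝ H} (h : UnifCentredMoments S lam η C b) {θ : Θ}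
    (hθ : θ ∈ S) : MemLp id 2 (lam θ) :=
  memLp_two_of_lintegral_ne_top aestronglyMeasurable_id
    ((h.lintegral_enorm_sq_le hθ).trans_lt ENNReal.coe_lt_top).ne

variable {lam : Measure H}

lemma integrable_outer_self (h2 : MemLp id 2 lam) : Integrable (fun x : H => outer x x) lam := by
  refine ((memLp_two_iff_integrable_sq_norm h2.1).1 h2).mono'
    (continuous_outer.comp (continuous_id.prodMk continuous_id)).aestronglyMeasurable
    (ae_of_all _ fun x => ?_)
  rw [norm_outer, sq, id]

variable [CompleteSpace H]

lemma inner_covOp (h2 : MemLp id 2 lam) (t u : H) :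
    ⟪covOp lam t, u⟫ = ∫ x, ⟪t, x⟫ * ⟪u, x⟫ ∂lam := by
  have hint := integrable_outer_self h2
  rw [covOp, ContinuousLinearMap.integral_apply hint, real_inner_comm,
    ← integral_inner (hint.apply_continuousLinearMap t)]
  simp [outer_apply, inner_smul_right]

lemma traceNorm_covOp_le {C : ℝ≥0} (hC : ∫⁻ x, ‖x‖ₑ ^ 2 ∂lam ≤ C) :
    traceNorm (covOp lam) ≤ C := by
  have h2 : MemLp id 2 lam := memLp_two_of_lintegral_ne_top aestronglyMeasurable_id
    (hC.trans_lt ENNReal.coe_lt_top).ne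
  refine (traceNorm_integral_le (integrable_outer_self h2) fun x => traceNorm_outer_le x x).trans ?_
  simpa only [← sq] using hC

lemma inner_covOp_self_nonneg (h2 : MemLp id 2 lam) (t : H) : 0 ≤ ⟪covOp lam t, t⟫ := by
  rw [inner_covOp h2]
  exact integral_nonneg fun x => mul_self_nonneg _

lemma inner_covOp_self_le {C : ℝ≥0} (hC : ∫⁻ x, ‖x‖ₑ ^ 2 ∂lam ≤ C) (t : H) :
    ⟪covOp lam t, t⟫ ≤ C * ‖t‖ ^ 2 := by
  have h2 : MemLp id 2 lam := memLp_two_of_lintegral_ne_top aestronglyMeasurable_id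
    (hC.trans_lt ENNReal.coe_lt_top).ne
  rw [inner_covOp h2]
  refine (integral_le_of_lintegral_enorm_le (C := C * ‖t‖₊ ^ 2) ?_).trans_eq (by simp)
  calc ∫⁻ x, ‖⟪t, x⟫ * ⟪t, x⟫‖ₑ ∂lam
      ≤ ∫⁻ x, ‖t‖ₑ ^ 2 * ‖x‖ₑ ^ 2 ∂lam := by
        refine lintegral_mono fun x => ?_
        rw [enorm_mul, ← sq, ← mul_pow]
        gcongr
        exact enorm_inner_le_mul t x
    _ = ‖t‖ₑ ^ 2 * ∫⁻ x, ‖x‖ₑ ^ 2 ∂lam := lintegral_const_mul' _ _ (by simp)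
    _ ≤ ‖t‖ₑ ^ 2 * C := by gcongr
    _ = (C * ‖t‖₊ ^ 2 : ℝ≥0) := by push_cast; rw [mul_comm]; rfl

variable [IsProbabilityMeasure lam] {η : ℝ} {C : ℝ≥0}

lemma norm_charFun_sub_le (h0 : 0 ≤ η) (h1 : η ≤ 1) (hC : ∫⁻ x, ‖x‖ₑ ^ (2 + η) ∂lam ≤ C)
    (hmean : ∀ t, ∫ x, ⟪t, x⟫ ∂lam = 0) (t : H) :
    ‖charFun lam t - (1 - ⟪covOp lam t, t⟫ / 2 : ℝ)‖ ≤ 4 * C * ‖t‖ ^ (2 + η) := by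
  have h2 : MemLp id 2 lam := memLp_two_of_lintegral_ne_top aestronglyMeasurable_id
    ((lintegral_enorm_sq_le_of_lintegral_rpow_le h0 hC).trans_lt ENNReal.coe_lt_top).ne
  have hnorm : ∫⁻ x, ‖‖x‖ ^ (2 + η)‖ₑ ∂lam ≤ C := by
    simpa only [enorm_norm_rpow (by positivity : 0 ≤ 2 + η)] using hC
  have hint : Integrable (fun x => ‖x‖ ^ (2 + η)) lam :=
    ⟨by fun_prop (disch := positivity), hnorm.trans_lt ENNReal.coe_lt_top⟩
  have hle : ∀ x, |⟪t, x⟫| ^ (2 + η) ≤ ‖t‖ ^ (2 + η) * ‖x‖ ^ (2 + η) := fun x => by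
    rw [← Real.mul_rpow (norm_nonneg _) (norm_nonneg _)]
    exact Real.rpow_le_rpow (abs_nonneg _) (abs_real_inner_le_norm t x) (by positivity)
  have hint_inner : Integrable (fun x => |⟪t, x⟫| ^ (2 + η)) lam :=
    (hint.const_mul _).mono' (by fun_prop (disch := positivity)) (ae_of_all _ fun x => by
      rw [Real.norm_of_nonneg (by positivity)]
      exact hle x)
  have htaylor := norm_integral_cexp_mul_I_sub_le h0 h1 (h2.const_inner t) (hmean t) hint_inner
  rw [charFun_apply, inner_covOp h2]
  simp_rw [real_inner_comm t, ← sq]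
  calc _ ≤ 4 * ∫ x, |⟪t, x⟫| ^ (2 + η) ∂lam := htaylor
    _ ≤ 4 * (‖t‖ ^ (2 + η) * ∫ x, ‖x‖ ^ (2 + η) ∂lam) := by
        rw [← integral_const_mul (‖t‖ ^ (2 + η))]
        exact mul_le_mul_of_nonneg_left (integral_mono hint_inner (hint.const_mul _) hle)
          (by norm_num)
    _ ≤ 4 * (‖t‖ ^ (2 + η) * C) := by
        gcongr
        exact integral_le_of_lintegral_enorm_le hnorm
    _ = 4 * C * ‖t‖ ^ (2 + η) := by ring

lemma norm_charFun_sub_cexp_le (h0 : 0 ≤ η) (h1 : η ≤ 1) (hC : ∫⁻ x, ‖x‖ₑ ^ (2 + η) ∂lam ≤ C)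
    (hmean : ∀ t, ∫ x, ⟪t, x⟫ ∂lam = 0) (t : H) :
    ‖charFun lam t - Complex.exp (-(⟪covOp lam t, t⟫ / 2 : ℝ))‖ ≤
      4 * C * ‖t‖ ^ (2 + η) + ((1 + C) * ‖t‖ ^ 2 / 2) ^ 2 := by
  have hsq := lintegral_enorm_sq_le_of_lintegral_rpow_le h0 hC
  have h2 : MemLp id 2 lam := memLp_two_of_lintegral_ne_top aestronglyMeasurable_id
    (hsq.trans_lt ENNReal.coe_lt_top).ne
  have hs0 : 0 ≤ ⟪covOp lam t, t⟫ / 2 := div_nonneg (inner_covOp_self_nonneg h2 t) two_pos.le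
  have hs1 : ⟪covOp lam t, t⟫ ≤ (1 + C) * ‖t‖ ^ 2 := by
    simpa using inner_covOp_self_le hsq t
  refine (norm_sub_le_norm_sub_add_norm_sub _ ((1 - ⟪covOp lam t, t⟫ / 2 : ℝ) : ℂ) _).trans
    (add_le_add (norm_charFun_sub_le h0 h1 hC hmean t) ?_)
  rw [← Complex.ofReal_neg, ← Complex.ofReal_exp, ← Complex.ofReal_sub, Complex.norm_real,
    Real.norm_eq_abs, abs_sub_comm]
  refine (abs_exp_neg_sub_le hs0).trans ?_
  gcongr

end Covariance

section NormSum

variable {Ω H : Type*} [MeasurableSpace Ω] {μ : Measure Ω} [NormedAddCommGroup H]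
  [InnerProductSpace ℝ H]

/-- The normalized sum `n^{-1/2} ∑_{i < n} V_i` of the central limit theorem. -/
def normSum (V : ℕ → Ω → H) (n : ℕ) (ω : Ω) : H := (√(n : ℝ))⁻¹ • ∑ i : Fin n, V i ω

variable [MeasurableSpace H] [BorelSpace H] [SecondCountableTopology H]
  {V : ℕ → Ω → H} {lam : Measure H}

lemma measurable_normSum (hV : ∀ i, Measurable (V i)) (n : ℕ) : Measurable (normSum V n) := by
  unfold normSum; fun_prop

lemma lintegral_inner_normSum_sq_le (hV : IsIIDSample μ V lam) (h2 : MemLp id 2 lam)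
    (hmean : ∀ t, ∫ x, ⟪t, x⟫ ∂lam = 0) (n : ℕ) (t : H) :
    ∫⁻ ω, ‖⟪t, normSum V n ω⟫‖ₑ ^ 2 ∂μ ≤ ∫⁻ x, ‖⟪t, x⟫‖ₑ ^ 2 ∂lam := by
  rcases eq_or_ne n 0 with rfl | hn
  · simp [normSum]
  have hsum := hV.lintegral_enorm_sum_sq (f := fun x => ⟪t, x⟫) (by fun_prop)
    (h2.const_inner t) (hmean t) n
  simp_rw [normSum, inner_smul_right, inner_sum, enorm_mul, mul_pow,
    enorm_inv_sqrt_natCast_sq hn]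
  rw [lintegral_const_mul' _ _ (by simpa using hn), hsum, ← mul_assoc]
  exact mul_le_of_le_one_left' (ENNReal.inv_mul_le_one _)

lemma charFun_map_normSum [IsProbabilityMeasure μ] (hV : IsIIDSample μ V lam) (n : ℕ) (t : H) :
    charFun (μ.map (normSum V n)) t = charFun lam ((√(n : ℝ))⁻¹ • t) ^ n := by
  have hsum := iIndepFun.charFun_map_fun_sum_eq_prod (X := fun i : Fin n => V i)
    (fun i => (hV.1 i).aemeasurable) (hV.iIndepFun_fin n)
  have hm : Measurable fun ω => ∑ i : Fin n, V i ω := Finset.measurable_sum _ fun i _ => hV.1 i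
  have hmap : μ.map (normSum V n) =
      (μ.map fun ω => ∑ i : Fin n, V i ω).map fun x => (√(n : ℝ))⁻¹ • x :=
    (Measure.map_map (measurable_const_smul _) hm).symm
  rw [hmap, charFun_map_smul, hsum]
  simp [hV.2.2]

variable [CompleteSpace H] {η : ℝ} {C : ℝ≥0}

lemma lintegral_sub_basisProj_normSum_le {ι : Type*} [Countable ι] (b : HilbertBasis ι ℝ H)
    (s : Finset ι) (hV : IsIIDSample μ V lam) (h2 : MemLp id 2 lam)
    (hmean : ∀ t, ∫ x, ⟪t, x⟫ ∂lam = 0) (n : ℕ) :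
    ∫⁻ ω, ‖normSum V n ω - basisProj b s (normSum V n ω)‖ₑ ^ 2 ∂μ ≤
      ∫⁻ x, ‖x - basisProj b s x‖ₑ ^ 2 ∂lam := by
  have hm := measurable_normSum hV.1 n
  simp_rw [enorm_sub_basisProj_sq]
  rw [lintegral_tsum fun p => by fun_prop, lintegral_tsum fun p => by fun_prop]
  exact ENNReal.tsum_le_tsum fun p => lintegral_inner_normSum_sq_le hV h2 hmean n _

lemma lintegral_normSum_sq_le {ι : Type*} [Countable ι] (b : HilbertBasis ι ℝ H)
    (hV : IsIIDSample μ V lam) (h2 : MemLp id 2 lam)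
    (hmean : ∀ t, ∫ x, ⟪t, x⟫ ∂lam = 0) (n : ℕ) :
    ∫⁻ ω, ‖normSum V n ω‖ₑ ^ 2 ∂μ ≤ ∫⁻ x, ‖x‖ₑ ^ 2 ∂lam := by
  simpa [basisProj] using lintegral_sub_basisProj_normSum_le b ∅ hV h2 hmean n

/-- A bound on the distance at a point of norm `r` between the characteristic functions of the
`n`-th normalized sum and of its Gaussian limit. -/
def charFunRate (η : ℝ) (C : ℝ≥0) (r : ℝ) (n : ℕ) : ℝ :=
  n * (4 * C * ((√(n : ℝ))⁻¹ * r) ^ (2 + η) + ((1 + C) * ((√(n : ℝ))⁻¹ * r) ^ 2 / 2) ^ 2)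

lemma norm_charFun_normSum_sub_le [IsProbabilityMeasure μ] (hV : IsIIDSample μ V lam)
    (h0 : 0 ≤ η) (h1 : η ≤ 1) (hC : ∫⁻ x, ‖x‖ₑ ^ (2 + η) ∂lam ≤ C)
    (hmean : ∀ t, ∫ x, ⟪t, x⟫ ∂lam = 0) {n : ℕ} (hn : n ≠ 0) (t : H) :
    ‖charFun (μ.map (normSum V n)) t - Complex.exp (-(⟪covOp lam t, t⟫ / 2 : ℝ))‖ ≤
      charFunRate η C ‖t‖ n := by
  have := hV.isProbabilityMeasure
  have h2 : MemLp id 2 lam := memLp_two_of_lintegral_ne_top aestronglyMeasurable_id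
    ((lintegral_enorm_sq_le_of_lintegral_rpow_le h0 hC).trans_lt ENNReal.coe_lt_top).ne
  set u : H := (√(n : ℝ))⁻¹ • t
  have hu : ‖u‖ = (√(n : ℝ))⁻¹ * ‖t‖ := by
    rw [norm_smul, Real.norm_of_nonneg (by positivity)]
  have hpow : Complex.exp (-(⟪covOp lam t, t⟫ / 2 : ℝ)) =
      Complex.exp (-(⟪covOp lam u, u⟫ / 2 : ℝ)) ^ n := by
    have hcov : n * ⟪covOp lam u, u⟫ = ⟪covOp lam t, t⟫ := by
      rw [map_smul, real_inner_smul_left, real_inner_smul_right, ← mul_assoc, ← mul_assoc,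
        mul_assoc (n : ℝ), ← mul_inv, Real.mul_self_sqrt n.cast_nonneg,
        mul_inv_cancel₀ (by exact_mod_cast hn), one_mul]
    rw [← Complex.exp_nat_mul, ← hcov]
    push_cast
    ring_nf
  have hexp : ‖Complex.exp (-(⟪covOp lam u, u⟫ / 2 : ℝ))‖ ≤ 1 := by
    rw [← Complex.ofReal_neg, Complex.norm_exp_ofReal, Real.exp_le_one_iff, neg_nonpos]
    exact div_nonneg (inner_covOp_self_nonneg h2 u) two_pos.le
  rw [charFun_map_normSum hV, hpow]
  refine (norm_pow_sub_pow_le_mul (norm_charFun_le_one _) hexp n).trans ?_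
  rw [charFunRate, ← hu]
  exact mul_le_mul_of_nonneg_left (norm_charFun_sub_cexp_le h0 h1 hC hmean u) n.cast_nonneg

lemma tendsto_charFunRate (h0 : 0 < η) (C : ℝ≥0) {r : ℝ} (hr : 0 ≤ r) :
    Tendsto (charFunRate η C r) atTop (𝓝 0) := by
  have hs : Tendsto (fun n : ℕ => (√(n : ℝ))⁻¹ * r) atTop (𝓝 0) := by
    simpa using (tendsto_inv_atTop_zero.comp
      (Real.tendsto_sqrt_atTop.comp tendsto_natCast_atTop_atTop)).mul_const r
  have hη : Tendsto (fun n : ℕ => ((√(n : ℝ))⁻¹ * r) ^ η) atTop (𝓝 0) := by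
    simpa [Real.zero_rpow h0.ne'] using hs.rpow_const (p := η) (Or.inr h0.le)
  have hlim : Tendsto (fun n : ℕ => 4 * C * r ^ 2 * ((√(n : ℝ))⁻¹ * r) ^ η +
      ((1 + C) / 2) ^ 2 * r ^ 2 * ((√(n : ℝ))⁻¹ * r) ^ 2) atTop (𝓝 0) := by
    simpa using (hη.const_mul (4 * C * r ^ 2)).add
      ((hs.pow 2).const_mul (((1 + C) / 2) ^ 2 * r ^ 2))
  refine hlim.congr' ?_
  filter_upwards [eventually_ne_atTop 0] with n hn
  have hsq : (n : ℝ) * ((√(n : ℝ))⁻¹ * r) ^ 2 = r ^ 2 := by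
    rw [mul_pow, inv_pow, Real.sq_sqrt n.cast_nonneg, ← mul_assoc,
      mul_inv_cancel₀ (by exact_mod_cast hn), one_mul]
  rw [charFunRate, Real.rpow_add_of_nonneg (by positivity) two_pos.le h0.le, Real.rpow_two, ← hsq]
  ring

end NormSum

section GaussianLimit

lemma tendsto_iSup_of_forall_seq {Θ : Type*} {S : Set Θ} {d : ℕ → Θ → ℝ≥0∞}
    (h : ∀ θ : ℕ → Θ, (∀ n, θ n ∈ S) → Tendsto (fun n => d n (θ n)) atTop (𝓝 0)) :
    Tendsto (fun n => ⨆ θ ∈ S, d n θ) atTop (𝓝 0) := by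
  rcases S.eq_empty_or_nonempty with rfl | ⟨θ₀, hθ₀⟩
  · simp
  refine ENNReal.tendsto_nhds_zero.2 fun ε hε => ?_
  have hbad (n : ℕ) : ∃ θ ∈ S, (∃ θ' ∈ S, ε < d n θ') → ε < d n θ := by
    by_cases hn : ∃ θ' ∈ S, ε < d n θ'
    · obtain ⟨θ', hθ', hlt⟩ := hn
      exact ⟨θ', hθ', fun _ => hlt⟩
    · exact ⟨θ₀, hθ₀, fun hn' => absurd hn' hn⟩
  choose θ hθS hθ using hbad
  filter_upwards [ENNReal.tendsto_nhds_zero.1 (h θ hθS) ε hε] with n hn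
  refine iSup₂_le fun θ' hθ' => ?_
  by_contra! hlt
  exact (hθ n ⟨θ', hθ', hlt⟩).not_ge hn

variable {H : Type*} [NormedAddCommGroup H] [InnerProductSpace ℝ H] [MeasurableSpace H]
  [BorelSpace H]

lemma tendsto_charFun {α : Type*} {l : Filter α} {ρ : α → ProbabilityMeasure H}
    {ν : ProbabilityMeasure H} (h : Tendsto ρ l (𝓝 ν)) (t : H) :
    Tendsto (fun a => charFun (ρ a : Measure H) t) l (𝓝 (charFun (ν : Measure H) t)) := by
  rw [ProbabilityMeasure.tendsto_iff_forall_integral_rclike_tendsto ℂ] at h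
  simp_rw [charFun_eq_integral_innerProbChar]
  exact h (BoundedContinuousFunction.innerProbChar t)

variable [SecondCountableTopology H] {Θ Ω : Type*} [MeasurableSpace Ω] {S : Set Θ}
  {Pr : Θ → Measure Ω} {V : Θ → ℕ → Ω → H}

/-- The laws of all the normalized sums of the samples `V θ`, `θ ∈ S`. -/
def normSumLaws (S : Set Θ) (Pr : Θ → Measure Ω) (V : Θ → ℕ → Ω → H) :
    Set (ProbabilityMeasure H) :=
  {ρ | ∃ n, ∃ θ ∈ S, (ρ : Measure H) = (Pr θ).map (normSum (V θ) n)}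

lemma exists_mem_normSumLaws {lam : Θ → Measure H} (hPr : ∀ θ ∈ S, IsProbabilityMeasure (Pr θ))
    (hV : ∀ θ ∈ S, IsIIDSample (Pr θ) (V θ) (lam θ)) {θ : Θ} (hθ : θ ∈ S) (n : ℕ) :
    ∃ ρ ∈ normSumLaws S Pr V, (ρ : Measure H) = (Pr θ).map (normSum (V θ) n) :=
  have := hPr θ hθ
  ⟨⟨_, Measure.isProbabilityMeasure_map (measurable_normSum (hV θ hθ).1 n).aemeasurable⟩,
    ⟨n, θ, hθ, rfl⟩, rfl⟩

variable [CompleteSpace H]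

lemma isCenteredGaussian_of_charFun {lam ν : Measure H} [IsProbabilityMeasure ν]
    (h2 : MemLp id 2 lam)
    (h : ∀ t, charFun ν t = Complex.exp (-(⟪covOp lam t, t⟫ / 2 : ℝ))) :
    IsCenteredGaussian (covOp lam) ν := by
  let f : H →L[ℝ] H →L[ℝ] ℝ := (innerSL ℝ).comp (covOp lam)
  have hf (t u : H) : f t u = ⟪covOp lam t, u⟫ := rfl
  have hpos : f.toBilinForm.IsPosSemidef := by
    refine ⟨⟨fun x y => ?_⟩, ⟨fun x => ?_⟩⟩
    · simp only [ContinuousLinearMap.toBilinForm_apply, hf, inner_covOp h2, mul_comm]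
    · simpa only [ContinuousLinearMap.toBilinForm_apply, hf] using inner_covOp_self_nonneg h2 x
  have hchar (t : H) : charFun ν t =
      Complex.exp ((⟪t, (0 : H)⟫ : ℝ) * Complex.I - (f t t : ℝ) / 2) := by
    rw [h, hf, inner_zero_right]
    congr 1
    push_cast
    ring
  have hG : IsGaussian ν := isGaussian_iff_gaussian_charFun.2 ⟨0, f, hpos, hchar⟩
  obtain ⟨hmean, hcov⟩ := gaussian_charFun_congr 0 f hpos hchar
  refine ⟨hG, hmean.symm, ContinuousLinearMap.ext fun t => ext_inner_right ℝ fun u => ?_⟩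
  have hL : MemLp id 2 ν := IsGaussian.memLp_two_id
  have hid : ν[id] = 0 := hmean.symm
  rw [covarianceOperator_inner hL, ← hf, hcov, covarianceBilin_apply hL, hid]
  simp

lemma tendsto_dBL_of_tendsto_charFun_sub {α : Type*} {l : Filter α}
    {K : Set (ProbabilityMeasure H)} (hK : IsCompact K) {ρ ν : α → ProbabilityMeasure H}
    (hρ : ∀ a, ρ a ∈ K) (hν : ∀ a, ν a ∈ K)
    (h : ∀ t, Tendsto (fun a => charFun (ρ a : Measure H) t - charFun (ν a : Measure H) t) l
      (𝓝 0)) :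
    Tendsto (fun a => dBL (ρ a : Measure H) (ν a)) l (𝓝 0) := by
  refine (tendsto_iff_ultrafilter _ _ _).2 fun U hU => ?_
  obtain ⟨ρ', -, hρ'⟩ := hK.ultrafilter_le_nhds' (U.map ρ) (mem_map.2 (univ_mem' hρ))
  obtain ⟨ν', -, hν'⟩ := hK.ultrafilter_le_nhds' (U.map ν) (mem_map.2 (univ_mem' hν))
  have h_eq : ρ' = ν' := Subtype.ext <|
    Measure.ext_of_charFun (μ := (ρ' : Measure H)) (ν := (ν' : Measure H)) <| funext fun t =>
    sub_eq_zero.1 <| tendsto_nhds_unique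
      ((tendsto_charFun hρ' t).sub (tendsto_charFun hν' t)) ((h t).mono_left hU)
  subst h_eq
  have hsum := (tendsto_dBL hρ').add (tendsto_dBL hν')
  rw [add_zero] at hsum
  refine tendsto_of_tendsto_of_tendsto_of_le_of_le tendsto_const_nhds hsum
    (fun _ => zero_le) fun a => ?_
  exact (dBL_triangle _ (ρ' : Measure H) _).trans_eq (by rw [dBL_comm (ρ' : Measure H)])

namespace UnifCentredMoments

variable {ι : Type*} {lam : Θ → Measure H} {η : ℝ} {C : ℝ≥0} {b : HilbertBasis ι ℝ H}

lemma tendsto_charFun_normSum_sub (h : UnifCentredMoments S lam η C b)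
    (hPr : ∀ θ ∈ S, IsProbabilityMeasure (Pr θ))
    (hV : ∀ θ ∈ S, IsIIDSample (Pr θ) (V θ) (lam θ)) {θ : ℕ → Θ} (hθ : ∀ n, θ n ∈ S) (t : H) :
    Tendsto (fun n => charFun ((Pr (θ n)).map (normSum (V (θ n)) n)) t -
      Complex.exp (-(⟪covOp (lam (θ n)) t, t⟫ / 2 : ℝ))) atTop (𝓝 0) := by
  refine squeeze_zero_norm' ?_ (tendsto_charFunRate h.pos C (norm_nonneg t))
  filter_upwards [eventually_ne_atTop 0] with n hn
  have := hPr _ (hθ n)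
  exact norm_charFun_normSum_sub_le (hV _ (hθ n)) h.pos.le h.le_one (h.mom _ (hθ n))
    (h.mean _ (hθ n)) hn t

variable [Countable ι]

lemma isCompact_closure_normSumLaws (h : UnifCentredMoments S lam η C b)
    (hV : ∀ θ ∈ S, IsIIDSample (Pr θ) (V θ) (lam θ)) :
    IsCompact (closure (normSumLaws S Pr V)) := by
  have hmap {θ : Θ} (hθ : θ ∈ S) (n : ℕ) {G : H → ℝ≥0∞} (hG : Measurable G) :
      ∫⁻ x, G x ∂((Pr θ).map (normSum (V θ) n)) = ∫⁻ ω, G (normSum (V θ) n ω) ∂(Pr θ) :=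
    lintegral_map hG (measurable_normSum (hV θ hθ).1 n)
  refine isCompact_closure_of_isTightMeasureSet
    (isTightMeasureSet_of_basisProj b (C := 1 + C) ?_ fun δ hδ => ?_)
  · rintro _ ⟨ρ, ⟨n, θ, hθ, hρ⟩, rfl⟩
    rw [hρ, hmap hθ n (by fun_prop)]
    exact (lintegral_normSum_sq_le b (hV θ hθ) (h.memLp_two hθ) (h.mean θ hθ) n).trans
      (h.lintegral_enorm_sq_le hθ)
  · obtain ⟨s, hs⟩ := h.tail δ hδ
    refine ⟨s, ?_⟩
    rintro _ ⟨ρ, ⟨n, θ, hθ, hρ⟩, rfl⟩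
    have hmeas : Measurable fun x => ‖x - basisProj b s x‖ₑ ^ 2 :=
      (continuous_id.sub (continuous_basisProj b s)).enorm.measurable.pow_const 2
    rw [hρ, hmap hθ n hmeas]
    exact (lintegral_sub_basisProj_normSum_le b s (hV θ hθ) (h.memLp_two hθ) (h.mean θ hθ)
      n).trans (hs θ hθ)

lemma exists_charFun_eq (h : UnifCentredMoments S lam η C b)
    (hPr : ∀ θ ∈ S, IsProbabilityMeasure (Pr θ))
    (hV : ∀ θ ∈ S, IsIIDSample (Pr θ) (V θ) (lam θ)) {θ : Θ} (hθ : θ ∈ S) :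
    ∃ ν ∈ closure (normSumLaws S Pr V), ∀ t,
      charFun (ν : Measure H) t = Complex.exp (-(⟪covOp (lam θ) t, t⟫ / 2 : ℝ)) := by
  choose ρ hρ hρ_eq using exists_mem_normSumLaws hPr hV hθ
  obtain ⟨ν, hν, hlim⟩ := (h.isCompact_closure_normSumLaws hV).ultrafilter_le_nhds'
    ((Ultrafilter.of atTop).map ρ) (mem_map.2 (univ_mem' fun n => subset_closure (hρ n)))
  refine ⟨ν, hν, fun t => tendsto_nhds_unique (tendsto_charFun hlim t) ?_⟩
  have hsub := (h.tendsto_charFun_normSum_sub hPr hV (fun _ => hθ) t).mono_left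
    (Ultrafilter.of_le atTop)
  simp_rw [hρ_eq]
  simpa using hsub.add_const (Complex.exp (-(⟪covOp (lam θ) t, t⟫ / 2 : ℝ)))

theorem exists_gaussian_limit (h : UnifCentredMoments S lam η C b)
    (hPr : ∀ θ ∈ S, IsProbabilityMeasure (Pr θ))
    (hV : ∀ θ ∈ S, IsIIDSample (Pr θ) (V θ) (lam θ)) :
    ∃ N : Θ → Measure H, (∀ θ ∈ S, IsCenteredGaussian (covOp (lam θ)) (N θ)) ∧
      Tendsto (fun n => ⨆ θ ∈ S, dBL ((Pr θ).map (normSum (V θ) n)) (N θ)) atTop (𝓝 0) := by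
  have : Nonempty (ProbabilityMeasure H) := ⟨⟨Measure.dirac 0, inferInstance⟩⟩
  choose! N hN hN_char using fun θ hθ => h.exists_charFun_eq hPr hV (θ := θ) hθ
  refine ⟨fun θ => (N θ : Measure H),
    fun θ hθ => isCenteredGaussian_of_charFun (h.memLp_two hθ) (hN_char θ hθ),
    tendsto_iSup_of_forall_seq fun θ hθ => ?_⟩
  choose ρ hρ hρ_eq using fun n => exists_mem_normSumLaws hPr hV (hθ n) n
  simp_rw [← hρ_eq]
  refine tendsto_dBL_of_tendsto_charFun_sub (h.isCompact_closure_normSumLaws hV)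
    (fun n => subset_closure (hρ n)) (fun n => hN _ (hθ n)) fun t => ?_
  simp_rw [hρ_eq, hN_char _ (hθ _)]
  exact h.tendsto_charFun_normSum_sub hPr hV hθ t

end UnifCentredMoments

end GaussianLimit

/-! ### Uniform laws of large numbers -/

section ScalarLLN

lemma mul_le_mul_sq_add_inv_mul_sq (a b : ℝ≥0∞) {c : ℝ≥0} (hc : 0 < c) :
    a * b ≤ c * a ^ 2 + (c⁻¹ : ℝ≥0) * b ^ 2 := by
  have hc' : (c : ℝ≥0∞) ≠ 0 := by simpa using hc.ne'
  rcases le_total b (c * a) with h | h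
  · calc a * b ≤ a * (c * a) := by gcongr
      _ = c * a ^ 2 := by ring
      _ ≤ _ := le_self_add
  · calc a * b = (c : ℝ≥0∞)⁻¹ * (c * a) * b := by
          rw [ENNReal.inv_mul_cancel_left' (by simp [hc']) (by simp)]
      _ ≤ (c : ℝ≥0∞)⁻¹ * b * b := by gcongr
      _ = (c⁻¹ : ℝ≥0) * b ^ 2 := by rw [ENNReal.coe_inv hc.ne']; ring
      _ ≤ _ := le_add_self

lemma UnifTendstoZeroInProb.of_sq {Θ Ω : Type*} [MeasurableSpace Ω] {S : Set Θ}
    {Pr : Θ → Measure Ω} {D : ℕ → Θ → Ω → ℝ≥0∞}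
    (h : UnifTendstoZeroInProb S Pr fun n θ ω => D n θ ω ^ 2) :
    UnifTendstoZeroInProb S Pr D := by
  intro δ hδ
  refine (h (δ ^ 2) (by positivity)).congr fun n => iSup_congr fun θ => iSup_congr fun _ => ?_
  congr 1
  ext ω
  rw [Set.mem_ofPred_eq, Set.mem_ofPred_eq, ENNReal.ofReal_pow hδ.le,
    ENNReal.pow_le_pow_left_iff two_ne_zero]

variable {Θ Ω T : Type*} [MeasurableSpace Ω] [MeasurableSpace T] {S : Set Θ}
  {Pr : Θ → Measure Ω} {W : Θ → ℕ → Ω → T} {P : Θ → Measure T}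

lemma UnifTendstoZeroInProb.of_le_add_average {D : ℕ → Θ → Ω → ℝ≥0∞}
    (hPr : ∀ θ ∈ S, IsProbabilityMeasure (Pr θ))
    (hW : ∀ θ ∈ S, IsIIDSample (Pr θ) (W θ) (P θ))
    (h : ∀ κ : ℝ≥0, 0 < κ → ∃ (D' : ℕ → Θ → Ω → ℝ≥0∞) (G : T → ℝ≥0∞),
      UnifTendstoZeroInProb S Pr D' ∧ Measurable G ∧ (∀ θ ∈ S, ∫⁻ x, G x ∂(P θ) ≤ κ) ∧
        ∀ᶠ n in atTop, ∀ θ ∈ S, ∀ ω, D n θ ω ≤ D' n θ ω +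
          ((n : ℝ≥0∞)⁻¹ * ∑ i : Fin n, G (W θ i ω) + ∫⁻ x, G x ∂(P θ))) :
    UnifTendstoZeroInProb S Pr D := by
  refine of_le_add_of_lintegral_le fun κ hκ => ?_
  obtain ⟨D', G, hD', hG, hG_le, hD⟩ := h (κ / 2) (half_pos hκ)
  refine ⟨D', _, hD', hD.mono fun n hn θ hθ => ⟨hn θ hθ, ?_, ?_⟩⟩
  · have hsum : Measurable fun ω => ∑ i : Fin n, G (W θ i ω) :=
      Finset.measurable_sum _ fun i _ => hG.comp ((hW θ hθ).1 i)
    exact ((hsum.const_mul _).add_const _).aemeasurable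
  · have := hPr θ hθ
    rw [lintegral_add_right _ measurable_const, lintegral_const, measure_univ, mul_one,
      ← add_halves κ, ENNReal.coe_add]
    exact add_le_add (((hW θ hθ).lintegral_average_le hG n).trans (hG_le θ hθ)) (hG_le θ hθ)

lemma IsIIDSample.lintegral_enorm_average_sub_sq_le {μ : Measure Ω} [IsProbabilityMeasure μ]
    {W : ℕ → Ω → T} {P : Measure T} (h : IsIIDSample μ W P) {F : T → ℝ} (hF : Measurable F)
    {τ : ℝ} (hFτ : ∀ x, |F x| ≤ τ) {n : ℕ} (hn : n ≠ 0) :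
    ∫⁻ ω, ‖(n : ℝ)⁻¹ * ∑ i : Fin n, (F (W i ω) - ∫ x, F x ∂P)‖ₑ ^ 2 ∂μ ≤
      ENNReal.ofReal ((2 * τ) ^ 2) / n := by
  have := h.isProbabilityMeasure
  have hFi : Integrable F P := Integrable.of_bound hF.aestronglyMeasurable τ (ae_of_all _ hFτ)
  set m := ∫ x, F x ∂P
  have hm : |m| ≤ τ := by
    simpa using norm_integral_le_of_norm_le_const (μ := P) (f := F) (ae_of_all _ hFτ)
  have h_meas : Measurable fun x => F x - m := hF.sub_const m
  have h_bound (x : T) : |F x - m| ≤ 2 * τ := by linarith [abs_sub (F x) m, hFτ x]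
  have h_mean : ∫ x, (F x - m) ∂P = 0 := by
    rw [integral_sub hFi (integrable_const _)]
    simp [m]
  have h_sq : ∫⁻ x, ‖F x - m‖ₑ ^ 2 ∂P ≤ ENNReal.ofReal ((2 * τ) ^ 2) := by
    refine (lintegral_mono fun x => ?_).trans_eq
      (b := ∫⁻ _, ENNReal.ofReal ((2 * τ) ^ 2) ∂P) (by simp)
    rw [Real.enorm_eq_ofReal_abs, ← ENNReal.ofReal_pow (abs_nonneg _)]
    exact ENNReal.ofReal_le_ofReal (pow_le_pow_left₀ (abs_nonneg _) (h_bound x) 2)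
  have h_sum := h.lintegral_enorm_sum_sq h_meas
    (MemLp.of_bound h_meas.aestronglyMeasurable (2 * τ) (ae_of_all _ h_bound)) h_mean n
  simp_rw [enorm_mul, mul_pow ‖_‖ₑ, enorm_natCast_inv hn]
  rw [lintegral_const_mul' _ _ (by simpa using hn), h_sum, sq, mul_assoc, ← mul_assoc _ (n : ℝ≥0∞),
    ENNReal.inv_mul_cancel (by simpa using hn) (by simp), one_mul, mul_comm, ← div_eq_mul_inv]
  exact ENNReal.div_le_div_right h_sq _

lemma unifTendstoZeroInProb_average_of_bounded {F : T → ℝ} (hF : Measurable F) {τ : ℝ}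
    (hFτ : ∀ x, |F x| ≤ τ) (hPr : ∀ θ ∈ S, IsProbabilityMeasure (Pr θ))
    (hW : ∀ θ ∈ S, IsIIDSample (Pr θ) (W θ) (P θ)) :
    UnifTendstoZeroInProb S Pr fun n θ ω =>
      ‖(n : ℝ)⁻¹ * ∑ i : Fin n, (F (W θ i ω) - ∫ x, F x ∂(P θ))‖ₑ := by
  have hrate : Tendsto (fun n : ℕ => ENNReal.ofReal ((2 * τ) ^ 2) / n) atTop (𝓝 0) := by
    simpa using ENNReal.Tendsto.const_div (a := ENNReal.ofReal ((2 * τ) ^ 2))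
      ENNReal.tendsto_nat_nhds_top (Or.inr ENNReal.ofReal_ne_top)
  refine .of_sq (.of_lintegral hrate ?_)
  filter_upwards [eventually_ne_atTop 0] with n hn θ hθ
  have := hPr θ hθ
  refine ⟨?_, (hW θ hθ).lintegral_enorm_average_sub_sq_le hF hFτ hn⟩
  have hsum : Measurable fun ω => ∑ i : Fin n, (F (W θ i ω) - ∫ x, F x ∂(P θ)) :=
    Finset.measurable_sum _ fun i _ => (hF.comp ((hW θ hθ).1 i)).sub_const _
  exact ((hsum.const_mul _).enorm.pow_const 2).aemeasurable

lemma exists_ofReal_rpow_neg_mul_le {γ : ℝ} (hγ : 0 < γ) (C : ℝ≥0) {κ : ℝ≥0} (hκ : 0 < κ) :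
    ∃ τ : ℝ, 0 < τ ∧ ENNReal.ofReal (τ ^ (-γ)) * C ≤ κ := by
  have hlim : Tendsto (fun τ : ℝ => τ ^ (-γ) * C) atTop (𝓝 0) := by
    simpa using (tendsto_rpow_neg_atTop hγ).mul_const (C : ℝ)
  obtain ⟨τ, hτ, hτ_pos⟩ :=
    ((hlim.eventually_lt_const (NNReal.coe_pos.2 hκ)).and (eventually_gt_atTop 0)).exists
  refine ⟨τ, hτ_pos, ?_⟩
  rw [← ENNReal.ofReal_coe_nnreal, ← ENNReal.ofReal_coe_nnreal,
    ← ENNReal.ofReal_mul (by positivity)]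
  exact ENNReal.ofReal_le_ofReal hτ.le

omit [MeasurableSpace T] in
lemma enorm_sub_truncation_le {γ : ℝ} (hγ : 0 ≤ γ) {τ : ℝ} (hτ : 0 < τ) (F : T → ℝ) (x : T) :
    ‖F x - truncation F τ x‖ₑ ≤ ENNReal.ofReal (τ ^ (-γ)) * ‖F x‖ₑ ^ (1 + γ) := by
  rcases lt_or_ge |F x| τ with hx | hx
  · simp [truncation_eq_self hx]
  have hx_pos : 0 < |F x| := hτ.trans_le hx
  calc ‖F x - truncation F τ x‖ₑ ≤ ‖F x‖ₑ := by
        simp only [truncation, Function.comp_apply, Set.indicator_apply, id_eq]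
        split_ifs <;> simp
    _ ≤ ENNReal.ofReal (τ ^ (-γ)) * ‖F x‖ₑ ^ (1 + γ) := by
        rw [Real.enorm_eq_ofReal_abs, ENNReal.ofReal_rpow_of_pos hx_pos,
          ← ENNReal.ofReal_mul (by positivity), Real.rpow_add hx_pos, Real.rpow_one,
          Real.rpow_neg hτ.le]
        refine ENNReal.ofReal_le_ofReal ?_
        rw [← div_eq_inv_mul, le_div_iff₀ (by positivity)]
        exact mul_le_mul_of_nonneg_left (Real.rpow_le_rpow hτ.le hx hγ) hx_pos.le

omit [MeasurableSpace T] in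
lemma enorm_average_sub_add_le {F F' : T → ℝ} {n : ℕ} (hn : n ≠ 0) (w : Fin n → T) (m m' : ℝ) :
    ‖(n : ℝ)⁻¹ * ∑ i, F (w i) - (m + m')‖ₑ ≤
      ‖(n : ℝ)⁻¹ * ∑ i, (F' (w i) - m)‖ₑ +
        ((n : ℝ≥0∞)⁻¹ * ∑ i, ‖F (w i) - F' (w i)‖ₑ + ‖m'‖ₑ) := by
  have hsplit : (n : ℝ)⁻¹ * ∑ i, F (w i) - (m + m') =
      (n : ℝ)⁻¹ * ∑ i, (F' (w i) - m) +
        ((n : ℝ)⁻¹ * ∑ i, (F (w i) - F' (w i)) - m') := by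
    have hn' : (n : ℝ) ≠ 0 := by exact_mod_cast hn
    simp only [Finset.sum_sub_distrib, Finset.sum_const, Finset.card_univ, Fintype.card_fin,
      nsmul_eq_mul]
    field_simp
    ring
  rw [hsplit]
  refine (enorm_add_le _ _).trans (add_le_add le_rfl (enorm_sub_le.trans (add_le_add ?_ le_rfl)))
  rw [enorm_mul, enorm_natCast_inv hn]
  gcongr
  exact enorm_sum_le _ _

lemma unifTendstoZeroInProb_average {γ : ℝ} (hγ : 0 < γ) {C : ℝ≥0} {F : T → ℝ}
    (hF : Measurable F) (hPr : ∀ θ ∈ S, IsProbabilityMeasure (Pr θ))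
    (hW : ∀ θ ∈ S, IsIIDSample (Pr θ) (W θ) (P θ))
    (hC : ∀ θ ∈ S, ∫⁻ x, ‖F x‖ₑ ^ (1 + γ) ∂(P θ) ≤ C) :
    UnifTendstoZeroInProb S Pr fun n θ ω =>
      ‖(n : ℝ)⁻¹ * ∑ i : Fin n, F (W θ i ω) - ∫ x, F x ∂(P θ)‖ₑ := by
  refine .of_le_add_average hPr hW fun κ hκ => ?_
  obtain ⟨τ, hτ_pos, hτ⟩ := exists_ofReal_rpow_neg_mul_le hγ C hκ
  set F' : T → ℝ := truncation F τ
  have hF' : Measurable F' := (measurable_id.indicator measurableSet_Ioc).comp hF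
  have hF'_le (x : T) : |F' x| ≤ |τ| := abs_truncation_le_bound F τ x
  have h_tail : ∀ θ ∈ S, ∫⁻ x, ‖F x - F' x‖ₑ ∂(P θ) ≤ κ := fun θ hθ =>
    calc ∫⁻ x, ‖F x - F' x‖ₑ ∂(P θ)
        ≤ ∫⁻ x, ENNReal.ofReal (τ ^ (-γ)) * ‖F x‖ₑ ^ (1 + γ) ∂(P θ) :=
          lintegral_mono (enorm_sub_truncation_le hγ.le hτ_pos F)
      _ ≤ ENNReal.ofReal (τ ^ (-γ)) * C := by
          rw [lintegral_const_mul _ (by fun_prop)]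
          gcongr
          exact hC θ hθ
      _ ≤ κ := hτ
  refine ⟨_, fun x => ‖F x - F' x‖ₑ, unifTendstoZeroInProb_average_of_bounded hF' hF'_le hPr hW,
    by fun_prop, h_tail, ?_⟩
  filter_upwards [eventually_ne_atTop 0] with n hn θ hθ ω
  have := hPr θ hθ
  have := (hW θ hθ).isProbabilityMeasure
  have hF'i : Integrable F' (P θ) :=
    Integrable.of_bound hF'.aestronglyMeasurable |τ| (ae_of_all _ hF'_le)
  have hdiff : Integrable (fun x => F x - F' x) (P θ) :=
    ⟨(hF.sub hF').aestronglyMeasurable, (h_tail θ hθ).trans_lt ENNReal.coe_lt_top⟩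
  have hmean : ∫ x, F x ∂(P θ) = ∫ x, F' x ∂(P θ) + ∫ x, (F x - F' x) ∂(P θ) := by
    simp [← integral_add hF'i hdiff]
  rw [hmean]
  refine (enorm_average_sub_add_le (F' := F') hn _ _ _).trans ?_
  gcongr
  exact enorm_integral_le_lintegral_enorm _

end ScalarLLN

section TraceLLN

variable {H : Type*} [NormedAddCommGroup H] [InnerProductSpace ℝ H] {ι : Type*}

lemma outer_basisProj_self (b : HilbertBasis ι ℝ H) (s : Finset ι) (x : H) :
    outer (basisProj b s x) (basisProj b s x) =
      ∑ p ∈ s, ∑ q ∈ s, (⟪b p, x⟫ * ⟪b q, x⟫) • outer (b p) (b q) := by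
  simp_rw [basisProj, outer_sum_left, outer_sum_right, outer_smul_left, outer_smul_right,
    smul_smul]

lemma smul_sum_outer_basisProj_self {n : ℕ} (b : HilbertBasis ι ℝ H) (s : Finset ι) (c : ℝ)
    (v : Fin n → H) :
    c • ∑ i, outer (basisProj b s (v i)) (basisProj b s (v i)) =
      ∑ p ∈ s, ∑ q ∈ s, (c * ∑ i, ⟪b p, v i⟫ * ⟪b q, v i⟫) • outer (b p) (b q) := by
  simp_rw [outer_basisProj_self, Finset.sum_comm (s := Finset.univ), ← Finset.sum_smul,
    Finset.smul_sum, smul_smul]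

lemma traceNorm_outer_basis_le (b : HilbertBasis ι ℝ H) (p q : ι) :
    traceNorm (outer (b p) (b q)) ≤ 1 :=
  (traceNorm_outer_le _ _).trans_eq (by
    rw [← ofReal_norm, ← ofReal_norm, b.orthonormal.1, b.orthonormal.1]; simp)

variable [CompleteSpace H]

lemma traceNorm_outer_self_sub_basisProj_le (b : HilbertBasis ι ℝ H) (s : Finset ι) (x : H) :
    traceNorm (outer x x - outer (basisProj b s x) (basisProj b s x)) ≤
      2 * (‖x‖ₑ * ‖x - basisProj b s x‖ₑ) :=
  calc traceNorm (outer x x - outer (basisProj b s x) (basisProj b s x))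
      ≤ ‖x - basisProj b s x‖ₑ * (‖x‖ₑ + ‖basisProj b s x‖ₑ) := traceNorm_outer_self_sub_le _ _
    _ ≤ ‖x - basisProj b s x‖ₑ * (‖x‖ₑ + ‖x‖ₑ) := by gcongr; exact enorm_basisProj_le b s x
    _ = 2 * (‖x‖ₑ * ‖x - basisProj b s x‖ₑ) := by ring

variable [MeasurableSpace H]

lemma integral_outer_basisProj_self {ρ : Measure H} (h2 : MemLp id 2 ρ)
    (b : HilbertBasis ι ℝ H) (s : Finset ι) :
    ∫ x, outer (basisProj b s x) (basisProj b s x) ∂ρ =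
      ∑ p ∈ s, ∑ q ∈ s, (∫ x, ⟪b p, x⟫ * ⟪b q, x⟫ ∂ρ) • outer (b p) (b q) := by
  have hint (p q : ι) :
      Integrable (fun x => (⟪b p, x⟫ * ⟪b q, x⟫) • outer (b p) (b q)) ρ :=
    ((h2.const_inner (b p)).integrable_mul (h2.const_inner (b q))).smul_const _
  simp_rw [outer_basisProj_self]
  rw [integral_finsetSum _ fun p _ => integrable_finsetSum _ fun q _ => hint p q]
  simp_rw [integral_finsetSum _ fun q _ => hint _ q, integral_smul_const]

lemma traceNorm_average_basisProj_sub_le {ρ : Measure H} (h2 : MemLp id 2 ρ)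
    (b : HilbertBasis ι ℝ H) (s : Finset ι) {n : ℕ} (v : Fin n → H) :
    traceNorm ((n : ℝ)⁻¹ • ∑ i, outer (basisProj b s (v i)) (basisProj b s (v i)) -
        ∫ x, outer (basisProj b s x) (basisProj b s x) ∂ρ) ≤
      ∑ p ∈ s, ∑ q ∈ s, ‖(n : ℝ)⁻¹ * ∑ i, ⟪b p, v i⟫ * ⟪b q, v i⟫ -
        ∫ x, ⟪b p, x⟫ * ⟪b q, x⟫ ∂ρ‖ₑ := by
  rw [smul_sum_outer_basisProj_self, integral_outer_basisProj_self h2]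
  simp_rw [← Finset.sum_sub_distrib, ← sub_smul]
  refine (traceNorm_sum_le _ _).trans (Finset.sum_le_sum fun p _ =>
    (traceNorm_sum_le _ _).trans (Finset.sum_le_sum fun q _ => ?_))
  exact (traceNorm_smul_le _ _).trans
    (mul_le_of_le_one_right' (traceNorm_outer_basis_le b p q))

variable [BorelSpace H] [SecondCountableTopology H]

lemma integrable_outer_basisProj_self {ρ : Measure H} (h2 : MemLp id 2 ρ)
    (b : HilbertBasis ι ℝ H) (s : Finset ι) :
    Integrable (fun x => outer (basisProj b s x) (basisProj b s x)) ρ := by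
  have hcont := continuous_basisProj b s
  refine (integrable_outer_self h2).mono
    (continuous_outer.comp (hcont.prodMk hcont)).aestronglyMeasurable (ae_of_all _ fun x => ?_)
  have hle : ‖basisProj b s x‖ ≤ ‖x‖ := enorm_le_iff_norm_le.1 (enorm_basisProj_le b s x)
  rw [norm_outer, norm_outer]
  gcongr

lemma traceNorm_average_sub_covOp_le {ρ : Measure H} (h2 : MemLp id 2 ρ)
    (b : HilbertBasis ι ℝ H) (s : Finset ι) {n : ℕ} (hn : n ≠ 0) (v : Fin n → H) :
    traceNorm ((n : ℝ)⁻¹ • ∑ i, outer (v i) (v i) - covOp ρ) ≤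
      ∑ p ∈ s, ∑ q ∈ s, ‖(n : ℝ)⁻¹ * ∑ i, ⟪b p, v i⟫ * ⟪b q, v i⟫ -
        ∫ x, ⟪b p, x⟫ * ⟪b q, x⟫ ∂ρ‖ₑ +
      ((n : ℝ≥0∞)⁻¹ * ∑ i, 2 * (‖v i‖ₑ * ‖v i - basisProj b s (v i)‖ₑ) +
        ∫⁻ x, 2 * (‖x‖ₑ * ‖x - basisProj b s x‖ₑ) ∂ρ) := by
  have hint := integrable_outer_self h2
  have hint_proj := integrable_outer_basisProj_self h2 b s
  have hsplit : (n : ℝ)⁻¹ • ∑ i, outer (v i) (v i) - covOp ρ =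
      ((n : ℝ)⁻¹ • ∑ i, outer (basisProj b s (v i)) (basisProj b s (v i)) -
        ∫ x, outer (basisProj b s x) (basisProj b s x) ∂ρ) +
      ((n : ℝ)⁻¹ • ∑ i, (outer (v i) (v i) - outer (basisProj b s (v i)) (basisProj b s (v i))) -
        ∫ x, (outer x x - outer (basisProj b s x) (basisProj b s x)) ∂ρ) := by
    rw [integral_sub hint hint_proj, Finset.sum_sub_distrib, smul_sub, covOp]
    abel
  rw [hsplit]
  refine (traceNorm_add_le _ _).trans (add_le_add (traceNorm_average_basisProj_sub_le h2 b s v)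
    ((traceNorm_sub_le _ _).trans (add_le_add ?_ (traceNorm_integral_le (hint.sub hint_proj)
      (traceNorm_outer_self_sub_basisProj_le b s)))))
  refine (traceNorm_smul_le _ _).trans ?_
  rw [enorm_natCast_inv hn]
  gcongr
  exact (traceNorm_sum_le _ _).trans (Finset.sum_le_sum fun i _ =>
    traceNorm_outer_self_sub_basisProj_le b s _)

namespace UnifCentredMoments

variable {Θ Ω : Type*} [MeasurableSpace Ω] {S : Set Θ} {Pr : Θ → Measure Ω}
  {V : Θ → ℕ → Ω → H} {lam : Θ → Measure H} {η : ℝ} {C : ℝ≥0} {b : HilbertBasis ι ℝ H}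

omit [CompleteSpace H] in
lemma unifTendstoZeroInProb_coord (h : UnifCentredMoments S lam η C b)
    (hPr : ∀ θ ∈ S, IsProbabilityMeasure (Pr θ))
    (hV : ∀ θ ∈ S, IsIIDSample (Pr θ) (V θ) (lam θ)) (p q : ι) :
    UnifTendstoZeroInProb S Pr fun n θ ω =>
      ‖(n : ℝ)⁻¹ * ∑ i : Fin n, ⟪b p, V θ i ω⟫ * ⟪b q, V θ i ω⟫ -
        ∫ x, ⟪b p, x⟫ * ⟪b q, x⟫ ∂(lam θ)‖ₑ := by
  have hcoord (r : ι) (x : H) : ‖⟪b r, x⟫‖ₑ ≤ ‖x‖ₑ :=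
    (enorm_inner_le_mul (b r) x).trans_eq (by
      rw [← ofReal_norm (b r), b.orthonormal.1 r, ENNReal.ofReal_one, one_mul])
  refine unifTendstoZeroInProb_average (F := fun x => ⟪b p, x⟫ * ⟪b q, x⟫) (half_pos h.pos)
    (by fun_prop) hPr hV fun θ hθ => (lintegral_mono fun x => ?_).trans (h.mom θ hθ)
  have := h.pos
  calc ‖⟪b p, x⟫ * ⟪b q, x⟫‖ₑ ^ (1 + η / 2) ≤ (‖x‖ₑ ^ (2 : ℝ)) ^ (1 + η / 2) := by
        refine ENNReal.rpow_le_rpow ?_ (by positivity)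
        rw [enorm_mul, ENNReal.rpow_two, sq]
        exact mul_le_mul' (hcoord p x) (hcoord q x)
    _ = ‖x‖ₑ ^ (2 + η) := by
        rw [← ENNReal.rpow_mul]
        congr 1
        ring

omit [CompleteSpace H] in
lemma exists_lintegral_mul_enorm_sub_basisProj_le (h : UnifCentredMoments S lam η C b)
    {κ : ℝ≥0} (hκ : 0 < κ) :
    ∃ s : Finset ι, ∀ θ ∈ S, ∫⁻ x, 2 * (‖x‖ₑ * ‖x - basisProj b s x‖ₑ) ∂(lam θ) ≤ κ := by
  set c : ℝ≥0 := κ / (4 * (1 + C)) with hc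
  have hc_pos : 0 < c := by positivity
  obtain ⟨s, hs⟩ := h.tail (c * (κ / 4) : ℝ≥0) (ENNReal.coe_pos.2 (by positivity))
  refine ⟨s, fun θ hθ => ?_⟩
  have hmeas : Measurable fun x : H => ‖x - basisProj b s x‖ₑ ^ 2 :=
    (continuous_id.sub (continuous_basisProj b s)).enorm.measurable.pow_const 2
  calc ∫⁻ x, 2 * (‖x‖ₑ * ‖x - basisProj b s x‖ₑ) ∂(lam θ)
      ≤ ∫⁻ x, 2 * (c * ‖x‖ₑ ^ 2 + (c⁻¹ : ℝ≥0) * ‖x - basisProj b s x‖ₑ ^ 2) ∂(lam θ) := by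
        gcongr
        exact mul_le_mul_sq_add_inv_mul_sq _ _ hc_pos
    _ = 2 * (c * ∫⁻ x, ‖x‖ₑ ^ 2 ∂(lam θ) +
          (c⁻¹ : ℝ≥0) * ∫⁻ x, ‖x - basisProj b s x‖ₑ ^ 2 ∂(lam θ)) := by
        rw [lintegral_const_mul _ (by fun_prop), lintegral_add_left (by fun_prop),
          lintegral_const_mul _ (by fun_prop), lintegral_const_mul _ hmeas]
    _ ≤ 2 * (c * (1 + C : ℝ≥0) + (c⁻¹ : ℝ≥0) * (c * (κ / 4) : ℝ≥0)) := by
        gcongr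
        · exact h.lintegral_enorm_sq_le hθ
        · exact hs θ hθ
    _ = ((2 * (c * (1 + C) + c⁻¹ * (c * (κ / 4))) : ℝ≥0) : ℝ≥0∞) := by push_cast; rfl
    _ = κ := by
        rw [inv_mul_cancel_left₀ hc_pos.ne', hc]
        congr 1
        field_simp
        norm_num

theorem unifTendstoZeroInProb_traceNorm (h : UnifCentredMoments S lam η C b)
    (hPr : ∀ θ ∈ S, IsProbabilityMeasure (Pr θ))
    (hV : ∀ θ ∈ S, IsIIDSample (Pr θ) (V θ) (lam θ)) :
    UnifTendstoZeroInProb S Pr fun n θ ω =>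
      traceNorm ((n : ℝ)⁻¹ • ∑ i : Fin n, outer (V θ i ω) (V θ i ω) - covOp (lam θ)) := by
  refine .of_le_add_average hPr hV fun κ hκ => ?_
  obtain ⟨s, hs⟩ := h.exists_lintegral_mul_enorm_sub_basisProj_le hκ
  have hmeas : Measurable fun x : H => ‖x - basisProj b s x‖ₑ :=
    (continuous_id.sub (continuous_basisProj b s)).enorm.measurable
  refine ⟨_, fun x => 2 * (‖x‖ₑ * ‖x - basisProj b s x‖ₑ),
    .sum s fun p _ => .sum s fun q _ => h.unifTendstoZeroInProb_coord hPr hV p q,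
    by fun_prop, hs, ?_⟩
  filter_upwards [eventually_ne_atTop 0] with n hn θ hθ ω
  exact traceNorm_average_sub_covOp_le (h.memLp_two hθ) b s hn _

end UnifCentredMoments

end TraceLLN

/-! ### Conditional independence and redrawing -/

section ConditionalDistribution

variable {Ω α β γ : Type*} [mΩ : MeasurableSpace Ω] [mγ : MeasurableSpace γ] [MeasurableSpace β]
  [StandardBorelSpace β] [Nonempty β] {μ : Measure Ω} [IsProbabilityMeasure μ]
  {X : Ω → α} {Y : Ω → β} {Z : Ω → γ}

lemma setIntegral_condExp_mul_condDistrib (hY : Measurable Y) (hZ : Measurable Z) {s : Set Ω}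
    {B : Set β} {C : Set γ} (hs : MeasurableSet s) (hB : MeasurableSet B) (hC : MeasurableSet C) :
    ∫ ω in Z ⁻¹' C, (μ⟦s | mγ.comap Z⟧ * μ⟦Y ⁻¹' B | mγ.comap Z⟧) ω ∂μ =
      ∫ ω in s ∩ Z ⁻¹' C, (condDistrib Y Z μ (Z ω)).real B ∂μ := by
  have hm : mγ.comap Z ≤ mΩ := hZ.comap_le
  set a : Ω → ℝ := s.indicator fun _ => 1
  set k : Ω → ℝ := fun ω => (condDistrib Y Z μ (Z ω)).real B
  have hk : k =ᵐ[μ] μ⟦Y ⁻¹' B | mγ.comap Z⟧ := condDistrib_ae_eq_condExp hZ hY hB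
  have hk_meas : StronglyMeasurable[mγ.comap Z] k :=
    (measurable_condDistrib hB).ennreal_toReal.stronglyMeasurable
  have hk_le (ω : Ω) : ‖k ω‖ ≤ 1 := by
    rw [Real.norm_of_nonneg measureReal_nonneg]
    exact measureReal_le_one
  have ha : Integrable a μ := (integrable_const _).indicator hs
  have hak : Integrable (a * k) μ :=
    ha.mul_bdd (c := 1) (hk_meas.mono hm).aestronglyMeasurable (ae_of_all _ hk_le)
  have hpull : μ[a | mγ.comap Z] * μ⟦Y ⁻¹' B | mγ.comap Z⟧ =ᵐ[μ] μ[a * k | mγ.comap Z] :=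
    (Filter.EventuallyEq.rfl.mul hk.symm).trans
      (condExp_mul_of_stronglyMeasurable_right hk_meas hak ha).symm
  calc ∫ ω in Z ⁻¹' C, (μ[a | mγ.comap Z] * μ⟦Y ⁻¹' B | mγ.comap Z⟧) ω ∂μ
      = ∫ ω in Z ⁻¹' C, (μ[a * k | mγ.comap Z]) ω ∂μ :=
        integral_congr_ae (ae_restrict_of_ae hpull)
    _ = ∫ ω in Z ⁻¹' C, (a * k) ω ∂μ := setIntegral_condExp hm hak ⟨C, hC, rfl⟩
    _ = ∫ ω in Z ⁻¹' C, s.indicator k ω ∂μ := by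
        refine integral_congr_ae (ae_of_all _ fun ω => ?_)
        by_cases hω : ω ∈ s <;> simp [a, hω]
    _ = ∫ ω in s ∩ Z ⁻¹' C, k ω ∂μ := by
        rw [integral_indicator hs, Measure.restrict_restrict hs]

variable [MeasurableSpace α]

lemma measure_inter_preimage_eq_setLIntegral_condDistrib (hX : Measurable X) (hY : Measurable Y)
    (hZ : Measurable Z) {A : Set α} {B : Set β} {C : Set γ}
    (h : μ⟦X ⁻¹' A ∩ Y ⁻¹' B | mγ.comap Z⟧ =ᵐ[μ]
      μ⟦X ⁻¹' A | mγ.comap Z⟧ * μ⟦Y ⁻¹' B | mγ.comap Z⟧)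
    (hA : MeasurableSet A) (hB : MeasurableSet B) (hC : MeasurableSet C) :
    μ (X ⁻¹' A ∩ Y ⁻¹' B ∩ Z ⁻¹' C) =
      ∫⁻ ω in X ⁻¹' A ∩ Z ⁻¹' C, condDistrib Y Z μ (Z ω) B ∂μ := by
  have hXY : MeasurableSet (X ⁻¹' A ∩ Y ⁻¹' B) := (hX hA).inter (hY hB)
  have hreal : μ.real (X ⁻¹' A ∩ Y ⁻¹' B ∩ Z ⁻¹' C) =
      ∫ ω in X ⁻¹' A ∩ Z ⁻¹' C, (condDistrib Y Z μ (Z ω)).real B ∂μ :=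
    calc μ.real (X ⁻¹' A ∩ Y ⁻¹' B ∩ Z ⁻¹' C)
        = ∫ ω in Z ⁻¹' C, (X ⁻¹' A ∩ Y ⁻¹' B).indicator (fun _ => (1 : ℝ)) ω ∂μ := by
          rw [integral_indicator_const _ hXY, measureReal_restrict_apply hXY, smul_eq_mul, mul_one]
      _ = ∫ ω in Z ⁻¹' C, (μ⟦X ⁻¹' A ∩ Y ⁻¹' B | mγ.comap Z⟧) ω ∂μ :=
          (setIntegral_condExp hZ.comap_le ((integrable_const _).indicator hXY)
            ⟨C, hC, rfl⟩).symm
      _ = ∫ ω in Z ⁻¹' C, (μ⟦X ⁻¹' A | mγ.comap Z⟧ * μ⟦Y ⁻¹' B | mγ.comap Z⟧) ω ∂μ :=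
          integral_congr_ae (ae_restrict_of_ae h)
      _ = ∫ ω in X ⁻¹' A ∩ Z ⁻¹' C, (condDistrib Y Z μ (Z ω)).real B ∂μ :=
          setIntegral_condExp_mul_condDistrib hY hZ (hX hA) hB hC
  have hmeas : Measurable fun ω => condDistrib Y Z μ (Z ω) B := (Kernel.measurable_coe _ hB).comp hZ
  rw [← ofReal_measureReal, hreal]
  simp_rw [measureReal_def]
  rw [integral_toReal hmeas.aemeasurable (ae_of_all _ fun _ => measure_lt_top _ _),
    ENNReal.ofReal_toReal]
  exact ((lintegral_mono fun _ => prob_le_one).trans_lt (by simp)).ne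

lemma map_eq_map_compProd_condDistrib (hX : Measurable X) (hY : Measurable Y) (hZ : Measurable Z)
    (h : ∀ A B, MeasurableSet A → MeasurableSet B →
      μ⟦X ⁻¹' A ∩ Y ⁻¹' B | mγ.comap Z⟧ =ᵐ[μ]
        μ⟦X ⁻¹' A | mγ.comap Z⟧ * μ⟦Y ⁻¹' B | mγ.comap Z⟧) :
    μ.map (fun ω => (X ω, Y ω, Z ω)) =
      (μ ⊗ₘ (condDistrib Y Z μ).comap Z hZ).map fun p => (X p.1, p.2, Z p.1) := by
  have hdata : Measurable fun ω => (X ω, Y ω, Z ω) := by fun_prop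
  have hredrawn : Measurable fun p : Ω × β => (X p.1, p.2, Z p.1) := by fun_prop
  have := Measure.isProbabilityMeasure_map (μ := μ) hdata.aemeasurable
  refine Measure.ext_prod₃ fun {A B C} hA hB hC => ?_
  have hbox : MeasurableSet (A ×ˢ B ×ˢ C) := hA.prod (hB.prod hC)
  have hpre : (fun ω => (X ω, Y ω, Z ω)) ⁻¹' A ×ˢ B ×ˢ C = X ⁻¹' A ∩ Y ⁻¹' B ∩ Z ⁻¹' C := by
    ext
    simp [and_assoc]
  rw [Measure.map_apply hdata hbox, hpre, Measure.map_apply hredrawn hbox,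
    Measure.compProd_apply (hredrawn hbox),
    measure_inter_preimage_eq_setLIntegral_condDistrib hX hY hZ (h A B hA hB) hA hB hC,
    ← lintegral_indicator ((hX hA).inter (hZ hC))]
  refine lintegral_congr fun ω => ?_
  by_cases hωA : X ω ∈ A <;> by_cases hωC : Z ω ∈ C <;>
    simp [hωA, hωC, Set.preimage, Set.mem_prod]

lemma lintegral_eq_lintegral_lintegral_condDistrib (hX : Measurable X) (hY : Measurable Y)
    (hZ : Measurable Z)
    (h : ∀ A B, MeasurableSet A → MeasurableSet B →
      μ⟦X ⁻¹' A ∩ Y ⁻¹' B | mγ.comap Z⟧ =ᵐ[μ]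
        μ⟦X ⁻¹' A | mγ.comap Z⟧ * μ⟦Y ⁻¹' B | mγ.comap Z⟧)
    {f : α × β × γ → ℝ≥0∞} (hf : Measurable f) :
    ∫⁻ ω, f (X ω, Y ω, Z ω) ∂μ =
      ∫⁻ ω, ∫⁻ y, f (X ω, y, Z ω) ∂(condDistrib Y Z μ (Z ω)) ∂μ := by
  have hredrawn : Measurable fun p : Ω × β => (X p.1, p.2, Z p.1) := by fun_prop
  rw [← lintegral_map (g := fun ω => (X ω, Y ω, Z ω)) hf (by fun_prop),
    map_eq_map_compProd_condDistrib hX hY hZ h, lintegral_map hf hredrawn]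
  exact Measure.lintegral_compProd (f := fun p => f (X p.1, p.2, Z p.1)) (hf.comp hredrawn)

end ConditionalDistribution

section Resampling

/-- Redrawing the middle component from the kernel `κ` given the last one leaves `P` invariant:
when `κ` is the conditional distribution of the middle component given the last one, this is the
conditional independence of the first two components given the last one. -/
def ResampleInvariant {U F 𝒵 : Type*} [MeasurableSpace U] [MeasurableSpace F] [MeasurableSpace 𝒵]
    (P : Measure (U × F × 𝒵)) (κ : Kernel 𝒵 F) : Prop :=
  ∀ G : U × F × 𝒵 → ℝ≥0∞, Measurable G →
    ∫⁻ w, G w ∂P = ∫⁻ w, ∫⁻ y, G (w.1, y, w.2.2) ∂(κ w.2.2) ∂P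

lemma lintegral_pi_update {T ι : Type*} [MeasurableSpace T] {P : Measure T}
    [IsProbabilityMeasure P] [Fintype ι] [DecidableEq ι] (i : ι) {G : (ι → T) → ℝ≥0∞}
    (hG : Measurable G) :
    ∫⁻ d, G d ∂(Measure.pi fun _ => P) =
      ∫⁻ d, ∫⁻ w, G (Function.update d i w) ∂P ∂(Measure.pi fun _ => P) := by
  have hupdate : Measurable fun p : (ι → T) × T => G (Function.update p.1 i p.2) :=
    hG.comp measurable_update'
  have hG_marginal : Measurable fun d => ∫⁻ w, G (Function.update d i w) ∂P :=
    hupdate.lintegral_prod_right'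
  have hmarginal : ∫⋯∫⁻_Finset.univ, G ∂(fun _ => P) =
      ∫⋯∫⁻_Finset.univ, (fun d => ∫⁻ w, G (Function.update d i w) ∂P) ∂(fun _ => P) := by
    rw [lmarginal_erase' _ hG (Finset.mem_univ i), lmarginal_erase' _ hG_marginal
      (Finset.mem_univ i)]
    simp
  obtain ⟨w⟩ := nonempty_of_isProbabilityMeasure P
  simpa only [lmarginal_univ] using congrFun hmarginal fun _ => w

variable {U F 𝒵 : Type*} [MeasurableSpace U] [MeasurableSpace F] [MeasurableSpace 𝒵]

/-- Replaces the middle component of the `i`th observation of a data set by a new value. -/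
def redraw {n : ℕ} (i : Fin n) (p : (Fin n → U × F × 𝒵) × F) : Fin n → U × F × 𝒵 :=
  Function.update p.1 i ((p.1 i).1, p.2, (p.1 i).2.2)

lemma measurable_redraw {n : ℕ} (i : Fin n) :
    Measurable (redraw (U := U) (F := F) (𝒵 := 𝒵) i) := by
  have hpair : Measurable fun p : (Fin n → U × F × 𝒵) × F =>
      (p.1, ((p.1 i).1, p.2, (p.1 i).2.2)) := by fun_prop
  exact measurable_update'.comp hpair

lemma ResampleInvariant.lintegral_pi {P : Measure (U × F × 𝒵)} [IsProbabilityMeasure P]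
    {κ : Kernel 𝒵 F} [IsMarkovKernel κ] (h : ResampleInvariant P κ) {n : ℕ} (i : Fin n)
    {G : (Fin n → U × F × 𝒵) → ℝ≥0∞} (hG : Measurable G) :
    ∫⁻ d, G d ∂(Measure.pi fun _ => P) =
      ∫⁻ d, ∫⁻ y, G (redraw i (d, y)) ∂(κ (d i).2.2) ∂(Measure.pi fun _ => P) := by
  have hz : Measurable fun d : Fin n → U × F × 𝒵 => (d i).2.2 := by fun_prop
  have hG_redraw : Measurable fun d : Fin n → U × F × 𝒵 =>
      ∫⁻ y, G (redraw i (d, y)) ∂(κ (d i).2.2) :=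
    Measurable.lintegral_kernel_prod_right' (κ := κ.comap _ hz) (hG.comp (measurable_redraw i))
  rw [lintegral_pi_update i hG, lintegral_pi_update i hG_redraw]
  refine lintegral_congr fun d => ?_
  rw [h (fun w => G (Function.update d i w)) (hG.comp (measurable_update d))]
  simp only [redraw, Function.update_self, Function.update_idem]

lemma integral_eq_zero_of_resample {D H : Type*} [MeasurableSpace D] {M : Measure D}
    [IsProbabilityMeasure M] [NormedAddCommGroup H] [InnerProductSpace ℝ H] [CompleteSpace H]
    [MeasurableSpace H] {K : Kernel D H} [IsMarkovKernel K] {res : D × H → D}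
    (hres : Measurable res)
    (hM : ∀ G : D → ℝ≥0∞, Measurable G → ∫⁻ d, G d ∂M = ∫⁻ d, ∫⁻ y, G (res (d, y)) ∂(K d) ∂M)
    {m h : D → H} (hm : ∀ᵐ d ∂M, Integrable id (K d) ∧ ∫ y, y ∂(K d) = m d) {G : D → ℝ}
    (hG : Integrable G M) (hGres : ∀ d y, G (res (d, y)) = ⟪h d, y - m d⟫) :
    ∫ d, G d ∂M = 0 := by
  have hM_map : (M ⊗ₘ K).map res = M := by
    refine Measure.ext_of_lintegral _ fun f hf => ?_
    rw [hM f hf, lintegral_map hf hres]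
    exact Measure.lintegral_compProd (f := fun p => f (res p)) (hf.comp hres)
  have hG_map : Integrable G ((M ⊗ₘ K).map res) := by rwa [hM_map]
  have hG_res : Integrable (fun p => G (res p)) (M ⊗ₘ K) :=
    (integrable_map_measure hG_map.1 hres.aemeasurable).1 hG_map
  rw [← hM_map, integral_map hres.aemeasurable hG_map.1, Measure.integral_compProd hG_res]
  refine integral_eq_zero_of_ae ?_
  filter_upwards [hm] with d ⟨hint, hmean⟩
  have hcentred : Integrable (fun y => y - m d) (K d) := hint.sub (integrable_const _)
  simp only [hGres, Pi.zero_apply]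
  rw [integral_inner hcentred, integral_sub (f := fun y => y) hint (integrable_const _)]
  simp [hmean]

end Resampling

section Noise

variable {U F E 𝒵 : Type*}

section Redraw

variable {n : ℕ} (i j : Fin n) (p : (Fin n → U × F × 𝒵) × F)

lemma redraw_of_ne {i j : Fin n} (h : j ≠ i) : redraw i p j = p.1 j :=
  Function.update_of_ne h _ _

@[simp] lemma redraw_self : redraw i p i = ((p.1 i).1, p.2, (p.1 i).2.2) :=
  Function.update_self _ _ _

@[simp] lemma redraw_fst : (redraw i p j).1 = (p.1 j).1 := by
  obtain rfl | h := eq_or_ne j i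
  · rw [redraw_self]
  · rw [redraw_of_ne p h]

@[simp] lemma redraw_snd_snd : (redraw i p j).2.2 = (p.1 j).2.2 := by
  obtain rfl | h := eq_or_ne j i
  · rw [redraw_self]
  · rw [redraw_of_ne p h]

end Redraw

variable [MeasurableSpace 𝒵] [NormedAddCommGroup F] [MeasurableSpace F]

/-- The second moment of `κ z` about `g z`. When `κ` is the conditional distribution of a random
element given `z` and `g` is its conditional mean, this is the conditional variance. -/
def kernelVar (κ : Kernel 𝒵 F) (g : 𝒵 → F) (z : 𝒵) : ℝ≥0∞ := ∫⁻ y, ‖y - g z‖ₑ ^ 2 ∂(κ z)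

/-- The sum of the squared norms of the coefficients `α d i`, weighted by the conditional variances
of the noise terms they multiply. -/
def weightedSum [NormedAddCommGroup E] (κ : Kernel 𝒵 F) (g : 𝒵 → F) {n : ℕ}
    (α : (Fin n → U × F × 𝒵) → Fin n → E) (d : Fin n → U × F × 𝒵) : ℝ≥0∞ :=
  ∑ i, ‖α d i‖ₑ ^ 2 * kernelVar κ g (d i).2.2

variable [BorelSpace F] [SecondCountableTopology F] {κ : Kernel 𝒵 F} [IsMarkovKernel κ]
  {g : 𝒵 → F} {n : ℕ}

lemma measurable_kernelVar (hg : Measurable g) : Measurable (kernelVar κ g) :=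
  Measurable.lintegral_kernel_prod_right' (f := fun p : 𝒵 × F => ‖p.2 - g p.1‖ₑ ^ 2)
    (by fun_prop)

variable [MeasurableSpace U] [NormedAddCommGroup E] [MeasurableSpace E] [BorelSpace E]
  {P : Measure (U × F × 𝒵)} {α : (Fin n → U × F × 𝒵) → Fin n → E} {c : ℝ≥0}

lemma measurable_enorm_sq_mul_kernelVar (hg : Measurable g) {i : Fin n}
    (hα : Measurable fun d => α d i) :
    Measurable fun d => ‖α d i‖ₑ ^ 2 * kernelVar κ g (d i).2.2 :=
  (hα.enorm.pow_const 2).mul ((measurable_kernelVar hg).comp (by fun_prop))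

lemma measurable_weightedSum (hg : Measurable g) (hα : ∀ i, Measurable fun d => α d i) :
    Measurable (weightedSum κ g α) :=
  Finset.measurable_sum _ fun i _ => measurable_enorm_sq_mul_kernelVar hg (hα i)

lemma measurable_enorm_sq_mul_noise (hg : Measurable g) {i : Fin n}
    (hα : Measurable fun d => α d i) :
    Measurable fun d => ‖α d i‖ₑ ^ 2 * ‖(d i).2.1 - g (d i).2.2‖ₑ ^ 2 :=
  (hα.enorm.pow_const 2).mul (by fun_prop)

omit [IsMarkovKernel κ] [MeasurableSpace U] [MeasurableSpace E] [BorelSpace E] [BorelSpace F]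
  [SecondCountableTopology F] in
lemma weightedSum_redraw (hres : ∀ d i j y, α (redraw i (d, y)) j = α d j)
    (d : Fin n → U × F × 𝒵) (i : Fin n) (y : F) :
    weightedSum κ g α (redraw i (d, y)) = weightedSum κ g α d := by
  simp [weightedSum, hres]

lemma setLIntegral_mul_noise_eq [IsProbabilityMeasure P] (hP : ResampleInvariant P κ)
    (hg : Measurable g) (hα : ∀ i, Measurable fun d => α d i)
    (hres : ∀ d i j y, α (redraw i (d, y)) j = α d j) (i : Fin n) :
    ∫⁻ d in {d | weightedSum κ g α d ≤ c}, ‖α d i‖ₑ ^ 2 * ‖(d i).2.1 - g (d i).2.2‖ₑ ^ 2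
        ∂(Measure.pi fun _ => P) =
      ∫⁻ d in {d | weightedSum κ g α d ≤ c}, ‖α d i‖ₑ ^ 2 * kernelVar κ g (d i).2.2
        ∂(Measure.pi fun _ => P) := by
  have hA : MeasurableSet {d | weightedSum κ g α d ≤ c} :=
    measurableSet_le (measurable_weightedSum hg hα) measurable_const
  rw [← lintegral_indicator hA, ← lintegral_indicator hA,
    hP.lintegral_pi i ((measurable_enorm_sq_mul_noise hg (hα i)).indicator hA)]
  refine lintegral_congr fun d => ?_
  by_cases hd : weightedSum κ g α d ≤ c
  · simp only [Set.indicator_apply, Set.mem_ofPred_eq, weightedSum_redraw hres, hd, hres,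
      redraw_self, if_true]
    exact lintegral_const_mul _ (by fun_prop)
  · simp [weightedSum_redraw hres, hd]

lemma setLIntegral_sum_mul_noise_le [IsProbabilityMeasure P] (hP : ResampleInvariant P κ)
    (hg : Measurable g) (hα : ∀ i, Measurable fun d => α d i)
    (hres : ∀ d i j y, α (redraw i (d, y)) j = α d j) :
    ∫⁻ d in {d | weightedSum κ g α d ≤ c},
      ∑ i, ‖α d i‖ₑ ^ 2 * ‖(d i).2.1 - g (d i).2.2‖ₑ ^ 2 ∂(Measure.pi fun _ => P) ≤ c := by
  have hA : MeasurableSet {d | weightedSum κ g α d ≤ c} :=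
    measurableSet_le (measurable_weightedSum hg hα) measurable_const
  rw [lintegral_finsetSum _ fun i _ => measurable_enorm_sq_mul_noise hg (hα i),
    Finset.sum_congr rfl fun i _ => setLIntegral_mul_noise_eq hP hg hα hres i,
    ← lintegral_finsetSum _ fun i _ => measurable_enorm_sq_mul_kernelVar hg (hα i)]
  refine (setLIntegral_mono' hA (g := fun _ => (c : ℝ≥0∞)) fun d hd => hd).trans ?_
  rw [setLIntegral_const]
  exact mul_le_of_le_one_right zero_le prob_le_one

variable [InnerProductSpace ℝ E] [CompleteSpace E] [SecondCountableTopology E]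
  [InnerProductSpace ℝ F] [CompleteSpace F]

omit [IsMarkovKernel κ] in
lemma stronglyMeasurable_outer_noise (hg : Measurable g) {i : Fin n}
    (hα : Measurable fun d => α d i) :
    StronglyMeasurable fun d => HS.outer (α d i) ((d i).2.1 - g (d i).2.2) :=
  HS.continuous_outer.comp_stronglyMeasurable
    (hα.prodMk (by fun_prop : Measurable fun d => (d i).2.1 - g (d i).2.2)).stronglyMeasurable

lemma memLp_two_outer_noise [IsProbabilityMeasure P] (hP : ResampleInvariant P κ)
    (hg : Measurable g) (hα : ∀ i, Measurable fun d => α d i)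
    (hres : ∀ d i j y, α (redraw i (d, y)) j = α d j) (i : Fin n) :
    MemLp (fun d => HS.outer (α d i) ((d i).2.1 - g (d i).2.2)) 2
      ((Measure.pi fun _ => P).restrict {d | weightedSum κ g α d ≤ c}) := by
  refine memLp_two_of_lintegral_ne_top
    (stronglyMeasurable_outer_noise hg (hα i)).aestronglyMeasurable ?_
  simp_rw [HS.enorm_outer, mul_pow]
  refine ne_top_of_le_ne_top ENNReal.coe_ne_top
    (le_trans (lintegral_mono fun d => ?_) (setLIntegral_sum_mul_noise_le hP hg hα hres))
  exact Finset.single_le_sum (f := fun i => ‖α d i‖ₑ ^ 2 * ‖(d i).2.1 - g (d i).2.2‖ₑ ^ 2)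
    (fun _ _ => zero_le) (Finset.mem_univ i)

/-- Redrawing the middle component of the `i`th observation changes neither the coefficients nor the
event, and averages the `i`th noise term to zero. -/
lemma setIntegral_inner_outer_noise_eq_zero [IsProbabilityMeasure P] (hP : ResampleInvariant P κ)
    (hg : Measurable g)
    (hκ : ∀ᵐ w ∂P, Integrable id (κ w.2.2) ∧ ∫ y, y ∂(κ w.2.2) = g w.2.2)
    (hα : ∀ i, Measurable fun d => α d i) (hres : ∀ d i j y, α (redraw i (d, y)) j = α d j)
    {i j : Fin n} (hij : i ≠ j) :
    ∫ d in {d | weightedSum κ g α d ≤ c}, ⟪HS.outer (α d i) ((d i).2.1 - g (d i).2.2),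
      HS.outer (α d j) ((d j).2.1 - g (d j).2.2)⟫ ∂(Measure.pi fun _ => P) = 0 := by
  set A := {d | weightedSum κ g α d ≤ c}
  have hA : MeasurableSet A := measurableSet_le (measurable_weightedSum hg hα) measurable_const
  have hz : Measurable fun d : Fin n → U × F × 𝒵 => (d i).2.2 := by fun_prop
  have hκ_pi : ∀ᵐ d ∂(Measure.pi fun _ : Fin n => P), Integrable id (κ (d i).2.2) ∧
      ∫ y, y ∂(κ (d i).2.2) = g (d i).2.2 :=
    (measurePreserving_eval (fun _ : Fin n => P) i).quasiMeasurePreserving.ae hκ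
  rw [← integral_indicator hA]
  refine integral_eq_zero_of_resample (K := κ.comap _ hz) (res := redraw i)
    (m := fun d => g (d i).2.2)
    (h := fun d => A.indicator (fun d => ⟪α d i, α d j⟫ • ((d j).2.1 - g (d j).2.2)) d)
    (measurable_redraw i) (fun G hG => hP.lintegral_pi i hG) hκ_pi
    ((integrable_indicator_iff hA).2 (integrable_inner_of_memLp_two
      (memLp_two_outer_noise hP hg hα hres i) (memLp_two_outer_noise hP hg hα hres j)))
    fun d y => ?_
  by_cases hd : weightedSum κ g α d ≤ c
  · simp only [A, Set.indicator_apply, Set.mem_ofPred_eq, weightedSum_redraw hres, hd, if_true,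
      HS.inner_outer_outer, hres, redraw_self, redraw_of_ne _ hij.symm, real_inner_smul_left]
    rw [real_inner_comm ((d j).2.1 - g (d j).2.2)]
  · simp [A, weightedSum_redraw hres, hd]

lemma setLIntegral_enorm_sum_outer_noise_sq_le [IsProbabilityMeasure P]
    (hP : ResampleInvariant P κ) (hg : Measurable g)
    (hκ : ∀ᵐ w ∂P, Integrable id (κ w.2.2) ∧ ∫ y, y ∂(κ w.2.2) = g w.2.2)
    (hα : ∀ i, Measurable fun d => α d i) (hres : ∀ d i j y, α (redraw i (d, y)) j = α d j) :
    ∫⁻ d in {d | weightedSum κ g α d ≤ c},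
      ‖∑ i, HS.outer (α d i) ((d i).2.1 - g (d i).2.2)‖ₑ ^ 2 ∂(Measure.pi fun _ => P) ≤ c := by
  rw [lintegral_enorm_sum_sq_of_orthogonal (memLp_two_outer_noise hP hg hα hres)
    fun i j hij => setIntegral_inner_outer_noise_eq_zero hP hg hκ hα hres hij]
  simp_rw [HS.enorm_outer, mul_pow]
  rw [← lintegral_finsetSum _ fun i _ => measurable_enorm_sq_mul_noise hg (hα i)]
  exact setLIntegral_sum_mul_noise_le hP hg hα hres

end Noise

section UniformNoise

lemma IsIIDSample.map_eq_pi {Ω T : Type*} [MeasurableSpace Ω] [MeasurableSpace T] {μ : Measure Ω}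
    [IsProbabilityMeasure μ] {W : ℕ → Ω → T} {P : Measure T} (hW : IsIIDSample μ W P) (n : ℕ) :
    μ.map (fun ω (i : Fin n) => W i ω) = Measure.pi fun _ => P := by
  rw [(iIndepFun_iff_map_fun_eq_pi_map (f := fun (i : Fin n) => W i)
    fun i => (hW.1 i).aemeasurable).1 (hW.iIndepFun_fin n)]
  simp only [hW.2.2]

lemma IsIIDSample.setLIntegral_average_le {Ω T : Type*} [MeasurableSpace Ω] [MeasurableSpace T]
    {μ : Measure Ω} [IsProbabilityMeasure μ] {W : ℕ → Ω → T} {P : Measure T}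
    (hW : IsIIDSample μ W P) {n : ℕ} (hn : n ≠ 0) {M G : (Fin n → T) → ℝ≥0∞} (hM : Measurable M)
    (hG : Measurable G) {c : ℝ≥0}
    (h : ∫⁻ d in {d | M d ≤ (n * c : ℝ≥0)}, G d ∂(Measure.pi fun _ => P) ≤ (n * c : ℝ≥0)) :
    ∫⁻ ω in {ω | M (fun i => W i ω) / n ≤ c}, (n : ℝ≥0∞)⁻¹ * G (fun i => W i ω) ∂μ ≤ c := by
  have hdata : Measurable fun ω (i : Fin n) => W i ω := measurable_pi_lambda _ fun i => hW.1 i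
  have hn0 : (n : ℝ≥0∞) ≠ 0 := by simpa using hn
  have hevent : {ω | M (fun i => W i ω) / n ≤ c} =
      (fun ω (i : Fin n) => W i ω) ⁻¹' {d | M d ≤ (n * c : ℝ≥0)} := by
    ext ω
    rw [Set.mem_preimage, Set.mem_ofPred_eq, Set.mem_ofPred_eq,
      ENNReal.div_le_iff hn0 (by simp), mul_comm, ENNReal.coe_mul, ENNReal.coe_natCast]
  rw [hevent, lintegral_const_mul' _ _ (by simpa using hn),
    ← setLIntegral_map (measurableSet_le hM measurable_const) hG hdata, hW.map_eq_pi n]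
  calc (n : ℝ≥0∞)⁻¹ * ∫⁻ d in {d | M d ≤ (n * c : ℝ≥0)}, G d ∂(Measure.pi fun _ => P)
      ≤ (n : ℝ≥0∞)⁻¹ * (n * c : ℝ≥0) := by gcongr
    _ = c := by
      rw [ENNReal.coe_mul, ENNReal.coe_natCast, ← mul_assoc, ENNReal.inv_mul_cancel hn0 (by simp),
        one_mul]

variable {Θ Ω : Type*} [MeasurableSpace Ω] {S : Set Θ} {Pr : Θ → Measure Ω}

lemma UnifTendstoZeroInProb.of_setLIntegral_le {D M : ℕ → Θ → Ω → ℝ≥0∞}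
    (hM : UnifTendstoZeroInProb S Pr M) (hM_meas : ∀ n, ∀ θ ∈ S, Measurable (M n θ))
    (hD_meas : ∀ n, ∀ θ ∈ S, Measurable (D n θ))
    (h : ∀ c : ℝ≥0, ∀ᶠ n in atTop, ∀ θ ∈ S, ∫⁻ ω in {ω | M n θ ω ≤ c}, D n θ ω ∂(Pr θ) ≤ c) :
    UnifTendstoZeroInProb S Pr D := by
  classical
  refine of_le_add_of_lintegral_le fun c hc => ⟨fun n θ ω => if M n θ ω ≤ c then 0 else ∞,
    fun n θ => {ω | M n θ ω ≤ c}.indicator (D n θ), fun δ hδ => ?_, ?_⟩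
  · refine tendsto_of_tendsto_of_tendsto_of_le_of_le tendsto_const_nhds
      (hM c (NNReal.coe_pos.2 hc)) (fun _ => zero_le) fun n =>
        iSup₂_mono fun θ _ => measure_mono fun ω hω => ?_
    by_contra h_not
    have hle : M n θ ω ≤ c := by simpa using (not_le.1 (Set.notMem_ofPred_iff.1 h_not)).le
    simp [hle, hδ.not_ge] at hω
  · filter_upwards [h c] with n hn θ hθ
    have hA : MeasurableSet {ω | M n θ ω ≤ c} := measurableSet_le (hM_meas n θ hθ) measurable_const
    refine ⟨fun ω => ?_, ((hD_meas n θ hθ).indicator hA).aemeasurable, ?_⟩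
    · by_cases hω : M n θ ω ≤ c <;> simp [hω]
    · rw [lintegral_indicator hA]
      exact hn θ hθ

lemma UnifTendstoZeroInProb.average_of_setLIntegral_le {T : Type*} [MeasurableSpace T]
    {P : Θ → Measure T} {W : ℕ → Ω → T} {M G : (n : ℕ) → Θ → (Fin n → T) → ℝ≥0∞}
    (hPr : ∀ θ ∈ S, IsProbabilityMeasure (Pr θ)) (hW : ∀ θ ∈ S, IsIIDSample (Pr θ) W (P θ))
    (hM_meas : ∀ n, ∀ θ ∈ S, Measurable (M n θ)) (hG_meas : ∀ n, ∀ θ ∈ S, Measurable (G n θ))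
    (h : ∀ n, ∀ θ ∈ S, ∀ c : ℝ≥0,
      ∫⁻ d in {d | M n θ d ≤ c}, G n θ d ∂(Measure.pi fun _ => P θ) ≤ c)
    (hM : UnifTendstoZeroInProb S Pr fun n θ ω => M n θ (fun i => W i ω) / n) :
    UnifTendstoZeroInProb S Pr fun n θ ω => (n : ℝ≥0∞)⁻¹ * G n θ fun i => W i ω := by
  have hdata (n : ℕ) : ∀ θ ∈ S, Measurable fun ω (i : Fin n) => W i ω := fun θ hθ =>
    measurable_pi_lambda _ fun i => (hW θ hθ).1 i
  refine hM.of_setLIntegral_le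
    (fun n θ hθ => ((hM_meas n θ hθ).comp (hdata n θ hθ)).div_const _)
    (fun n θ hθ => ((hG_meas n θ hθ).comp (hdata n θ hθ)).const_mul _) fun c => ?_
  filter_upwards [eventually_ne_atTop 0] with n hn θ hθ
  have := hPr θ hθ
  exact (hW θ hθ).setLIntegral_average_le hn (hM_meas n θ hθ) (hG_meas n θ hθ) (h n θ hθ _)

variable {U F E 𝒵 : Type*} [MeasurableSpace U] [MeasurableSpace 𝒵]
  [NormedAddCommGroup F] [MeasurableSpace F] [BorelSpace F] [SecondCountableTopology F]
  [NormedAddCommGroup E] [MeasurableSpace E] [BorelSpace E]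
  {P : Θ → Measure (U × F × 𝒵)} {κ : Θ → Kernel 𝒵 F} [∀ θ, IsMarkovKernel (κ θ)]
  {g : Θ → 𝒵 → F} {W : ℕ → Ω → U × F × 𝒵} {α : (n : ℕ) → Θ → (Fin n → U × F × 𝒵) → Fin n → E}

lemma unifTendstoZeroInProb_average_mul_noise
    (hPr : ∀ θ ∈ S, IsProbabilityMeasure (Pr θ)) (hW : ∀ θ ∈ S, IsIIDSample (Pr θ) W (P θ))
    (hP : ∀ θ ∈ S, ResampleInvariant (P θ) (κ θ)) (hg : ∀ θ ∈ S, Measurable (g θ))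
    (hα : ∀ n, ∀ θ ∈ S, ∀ i, Measurable fun d => α n θ d i)
    (hres : ∀ n θ d i j y, α n θ (redraw i (d, y)) j = α n θ d j)
    (h : UnifTendstoZeroInProb S Pr fun n θ ω =>
      weightedSum (κ θ) (g θ) (α n θ) (fun i => W i ω) / n) :
    UnifTendstoZeroInProb S Pr fun n θ ω => (n : ℝ≥0∞)⁻¹ *
      ∑ i, ‖α n θ (fun i => W i ω) i‖ₑ ^ 2 * ‖(W i ω).2.1 - g θ (W i ω).2.2‖ₑ ^ 2 := by
  refine .average_of_setLIntegral_le (M := fun n θ => weightedSum (κ θ) (g θ) (α n θ))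
    (G := fun n θ d => ∑ i, ‖α n θ d i‖ₑ ^ 2 * ‖(d i).2.1 - g θ (d i).2.2‖ₑ ^ 2) hPr hW
    (fun n θ hθ => measurable_weightedSum (hg θ hθ) (hα n θ hθ))
    (fun n θ hθ => Finset.measurable_sum _ fun i _ =>
      measurable_enorm_sq_mul_noise (hg θ hθ) (hα n θ hθ i)) (fun n θ hθ c => ?_) h
  have := hPr θ hθ
  have := (hW θ hθ).isProbabilityMeasure
  exact setLIntegral_sum_mul_noise_le (hP θ hθ) (hg θ hθ) (hα n θ hθ) (hres n θ)

lemma unifTendstoZeroInProb_enorm_sum_outer_noise_sq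
    [InnerProductSpace ℝ E] [CompleteSpace E] [SecondCountableTopology E]
    [InnerProductSpace ℝ F] [CompleteSpace F]
    (hPr : ∀ θ ∈ S, IsProbabilityMeasure (Pr θ)) (hW : ∀ θ ∈ S, IsIIDSample (Pr θ) W (P θ))
    (hP : ∀ θ ∈ S, ResampleInvariant (P θ) (κ θ)) (hg : ∀ θ ∈ S, Measurable (g θ))
    (hκ : ∀ θ ∈ S, ∀ᵐ w ∂(P θ), Integrable id (κ θ w.2.2) ∧ ∫ y, y ∂(κ θ w.2.2) = g θ w.2.2)
    (hα : ∀ n, ∀ θ ∈ S, ∀ i, Measurable fun d => α n θ d i)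
    (hres : ∀ n θ d i j y, α n θ (redraw i (d, y)) j = α n θ d j)
    (h : UnifTendstoZeroInProb S Pr fun n θ ω =>
      weightedSum (κ θ) (g θ) (α n θ) (fun i => W i ω) / n) :
    UnifTendstoZeroInProb S Pr fun n θ ω => (n : ℝ≥0∞)⁻¹ *
      ‖∑ i, HS.outer (α n θ (fun i => W i ω) i) ((W i ω).2.1 - g θ (W i ω).2.2)‖ₑ ^ 2 := by
  refine .average_of_setLIntegral_le (M := fun n θ => weightedSum (κ θ) (g θ) (α n θ))
    (G := fun n θ d => ‖∑ i, HS.outer (α n θ d i) ((d i).2.1 - g θ (d i).2.2)‖ₑ ^ 2) hPr hW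
    (fun n θ hθ => measurable_weightedSum (hg θ hθ) (hα n θ hθ))
    (fun n θ hθ => (Finset.stronglyMeasurable_fun_sum _ fun i _ =>
      stronglyMeasurable_outer_noise (hg θ hθ) (hα n θ hθ i)).enorm.pow_const 2)
    (fun n θ hθ c => ?_) h
  have := hPr θ hθ
  have := (hW θ hθ).isProbabilityMeasure
  exact setLIntegral_enorm_sum_outer_noise_sq_le (hP θ hθ) (hg θ hθ) (hκ θ hθ) (hα n θ hθ)
    (hres n θ)

end UniformNoise

/-! ### Perturbed samples -/

lemma add_sq_le_two_mul_sq_add (a b : ℝ≥0∞) : (a + b) ^ 2 ≤ 2 * a ^ 2 + 2 * b ^ 2 := by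
  rw [← mul_add]
  have h := ENNReal.rpow_add_le_mul_rpow_add_rpow a b (p := 2) one_le_two
  rw [show (2 : ℝ) - 1 = 1 by norm_num, ENNReal.rpow_one] at h
  exact_mod_cast h

section EmpiricalCovariance

variable {H : Type*} [NormedAddCommGroup H] [InnerProductSpace ℝ H]

lemma sum_outer_sub_mean {n : ℕ} (hn : n ≠ 0) (R : Fin n → H) :
    ∑ i, outer (R i - (n : ℝ)⁻¹ • ∑ j, R j) (R i - (n : ℝ)⁻¹ • ∑ j, R j) =
      ∑ i, outer (R i) (R i) -
        (n : ℝ) • outer ((n : ℝ)⁻¹ • ∑ j, R j) ((n : ℝ)⁻¹ • ∑ j, R j) := by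
  set m := (n : ℝ)⁻¹ • ∑ j, R j with hm
  have h_sum : ∑ j, R j = (n : ℝ) • m := by
    rw [hm, smul_smul, mul_inv_cancel₀ (by exact_mod_cast hn), one_smul]
  clear_value m
  have expand : ∀ i, outer (R i - m) (R i - m) =
      outer (R i) (R i) - outer m (R i) - outer (R i) m + outer m m := fun i => by
    rw [outer_sub_left, outer_sub_right, outer_sub_right]
    abel
  simp_rw [expand]
  rw [Finset.sum_add_distrib, Finset.sum_sub_distrib, Finset.sum_sub_distrib, ← outer_sum_left,
    ← outer_sum_right, h_sum, outer_smul_left, outer_smul_right, Finset.sum_const,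
    Finset.card_univ, Fintype.card_fin, ← Nat.cast_smul_eq_nsmul ℝ]
  abel

lemma empirical_cov_sub_eq {n : ℕ} (hn : 2 ≤ n) (R V : Fin n → H) (C : H →L[ℝ] H) :
    ((n : ℝ) - 1)⁻¹ • ∑ i, outer (R i - (n : ℝ)⁻¹ • ∑ j, R j) (R i - (n : ℝ)⁻¹ • ∑ j, R j) - C =
      ((n : ℝ) / (n - 1)) • ((n : ℝ)⁻¹ • ∑ i, (outer (R i) (R i) - outer (V i) (V i))) +
      ((n : ℝ) / (n - 1)) • ((n : ℝ)⁻¹ • ∑ i, outer (V i) (V i) - C) + ((n : ℝ) - 1)⁻¹ • C -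
      ((n : ℝ) / (n - 1)) • outer ((n : ℝ)⁻¹ • ∑ j, R j) ((n : ℝ)⁻¹ • ∑ j, R j) := by
  rw [sum_outer_sub_mean (by lia), Finset.sum_sub_distrib]
  have hn_two : (2 : ℝ) ≤ n := by exact_mod_cast hn
  have hn_ne : (n : ℝ) ≠ 0 := by positivity
  have hn_sub_ne : (n : ℝ) - 1 ≠ 0 := by linarith
  match_scalars <;> field_simp <;> ring

lemma traceNorm_empirical_cov_sub_le {n : ℕ} (hn : 2 ≤ n) (R V : Fin n → H) (C : H →L[ℝ] H) :
    traceNorm (((n : ℝ) - 1)⁻¹ •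
      ∑ i, outer (R i - (n : ℝ)⁻¹ • ∑ j, R j) (R i - (n : ℝ)⁻¹ • ∑ j, R j) - C) ≤
      2 * ((n : ℝ≥0∞)⁻¹ * ∑ i, ‖R i - V i‖ₑ * (‖R i‖ₑ + ‖V i‖ₑ)) +
      2 * traceNorm ((n : ℝ)⁻¹ • ∑ i, outer (V i) (V i) - C) +
      ((n - 1 : ℕ) : ℝ≥0∞)⁻¹ * traceNorm C + 2 * ‖(n : ℝ)⁻¹ • ∑ j, R j‖ₑ ^ 2 := by
  have hn_two : (2 : ℝ) ≤ n := by exact_mod_cast hn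
  have enorm_inv : ‖((n : ℝ) - 1)⁻¹‖ₑ = ((n - 1 : ℕ) : ℝ≥0∞)⁻¹ := by
    rw [← enorm_natCast_inv (by lia), Nat.cast_sub (by lia), Nat.cast_one]
  have enorm_div : ‖(n : ℝ) / (n - 1)‖ₑ ≤ 2 := by
    have hle : (n : ℝ) / (n - 1) ≤ 2 := by
      rw [div_le_iff₀ (by linarith)]; linarith
    rw [Real.enorm_of_nonneg (div_nonneg (by linarith) (by linarith))]
    exact (ENNReal.ofReal_le_ofReal hle).trans (by simp)
  rw [empirical_cov_sub_eq hn R V C]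
  refine (traceNorm_sub_le _ _).trans (add_le_add ((traceNorm_add_le _ _).trans (add_le_add
    ((traceNorm_add_le _ _).trans (add_le_add ?_ ?_)) ?_)) ?_)
  · refine (traceNorm_smul_le _ _).trans (mul_le_mul' enorm_div
      ((traceNorm_smul_le _ _).trans ?_))
    rw [enorm_natCast_inv (by lia)]
    gcongr
    exact (traceNorm_sum_le _ _).trans
      (Finset.sum_le_sum fun i _ => traceNorm_outer_self_sub_le _ _)
  · exact (traceNorm_smul_le _ _).trans (mul_le_mul' enorm_div le_rfl)
  · exact (traceNorm_smul_le _ _).trans (mul_le_mul' enorm_inv.le le_rfl)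
  · refine (traceNorm_smul_le _ _).trans (mul_le_mul' enorm_div ?_)
    rw [sq]
    exact traceNorm_outer_le _ _

end EmpiricalCovariance

section Perturbation

variable {H : Type*} [NormedAddCommGroup H]

lemma enorm_sub_mul_add_le (r v : H) {c : ℝ≥0} (hc : 0 < c) :
    ‖r - v‖ₑ * (‖r‖ₑ + ‖v‖ₑ) ≤ (2 * c⁻¹ + 1 : ℝ≥0) * ‖r - v‖ₑ ^ 2 + (2 * c : ℝ≥0) * ‖v‖ₑ ^ 2 := by
  have triangle : ‖r‖ₑ ≤ ‖v‖ₑ + ‖r - v‖ₑ := by simpa using enorm_add_le v (r - v)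
  calc ‖r - v‖ₑ * (‖r‖ₑ + ‖v‖ₑ)
      ≤ ‖r - v‖ₑ * (‖v‖ₑ + ‖r - v‖ₑ + ‖v‖ₑ) := by gcongr
    _ = 2 * (‖v‖ₑ * ‖r - v‖ₑ) + ‖r - v‖ₑ ^ 2 := by ring
    _ ≤ 2 * (c * ‖v‖ₑ ^ 2 + (c⁻¹ : ℝ≥0) * ‖r - v‖ₑ ^ 2) + ‖r - v‖ₑ ^ 2 := by
        gcongr
        exact mul_le_mul_sq_add_inv_mul_sq _ _ hc
    _ = _ := by push_cast; ring

variable [InnerProductSpace ℝ H]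

lemma enorm_average_sq_le {n : ℕ} (hn : n ≠ 0) (r v : Fin n → H) :
    ‖(n : ℝ)⁻¹ • ∑ i, r i‖ₑ ^ 2 ≤ 2 * ((n : ℝ≥0∞)⁻¹ * ‖(√(n : ℝ))⁻¹ • ∑ i, v i‖ₑ ^ 2) +
      2 * ((n : ℝ≥0∞)⁻¹ * ‖∑ i, (r i - v i)‖ₑ ^ 2) := by
  have hn_inv : (n : ℝ≥0∞)⁻¹ ≤ 1 :=
    ENNReal.inv_le_one.2 (by exact_mod_cast Nat.one_le_iff_ne_zero.2 hn)
  have h_sum : ∑ i, r i = ∑ i, v i + ∑ i, (r i - v i) := by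
    rw [Finset.sum_sub_distrib, add_sub_cancel]
  rw [enorm_smul, enorm_smul, mul_pow, mul_pow, enorm_natCast_inv hn,
    enorm_inv_sqrt_natCast_sq hn, h_sum]
  calc (n : ℝ≥0∞)⁻¹ ^ 2 * ‖∑ i, v i + ∑ i, (r i - v i)‖ₑ ^ 2
      ≤ (n : ℝ≥0∞)⁻¹ ^ 2 * (2 * ‖∑ i, v i‖ₑ ^ 2 + 2 * ‖∑ i, (r i - v i)‖ₑ ^ 2) := by
        gcongr
        exact (pow_le_pow_left' (enorm_add_le _ _) 2).trans (add_sq_le_two_mul_sq_add _ _)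
    _ = 2 * ((n : ℝ≥0∞)⁻¹ * ((n : ℝ≥0∞)⁻¹ * ‖∑ i, v i‖ₑ ^ 2)) +
        (n : ℝ≥0∞)⁻¹ * (2 * ((n : ℝ≥0∞)⁻¹ * ‖∑ i, (r i - v i)‖ₑ ^ 2)) := by ring
    _ ≤ _ := add_le_add le_rfl (mul_le_of_le_one_left zero_le hn_inv)

variable [SecondCountableTopology H] [MeasurableSpace H] [BorelSpace H]
  {Θ Ω ι : Type*} [MeasurableSpace Ω] {S : Set Θ} {Pr : Θ → Measure Ω}
  {V : Θ → ℕ → Ω → H} {lam : Θ → Measure H} {η : ℝ} {C : ℝ≥0} {b : HilbertBasis ι ℝ H}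
  {R : (n : ℕ) → Ω → Fin n → H}

namespace UnifCentredMoments

lemma unifTendstoZeroInProb_average_enorm_sub_mul_add
    (h : UnifCentredMoments S lam η C b) (hPr : ∀ θ ∈ S, IsProbabilityMeasure (Pr θ))
    (hV : ∀ θ ∈ S, IsIIDSample (Pr θ) (V θ) (lam θ))
    (hQ : UnifTendstoZeroInProb S Pr fun n θ ω =>
      (n : ℝ≥0∞)⁻¹ * ∑ i : Fin n, ‖R n ω i - V θ i ω‖ₑ ^ 2) :
    UnifTendstoZeroInProb S Pr fun n θ ω =>
      (n : ℝ≥0∞)⁻¹ * ∑ i : Fin n, ‖R n ω i - V θ i ω‖ₑ * (‖R n ω i‖ₑ + ‖V θ i ω‖ₑ) := by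
  refine .of_le_add_average hPr hV fun κ hκ => ?_
  set c : ℝ≥0 := κ / (2 * (1 + C)) with hc
  have hc_pos : 0 < c := by positivity
  refine ⟨_, fun x => (2 * c : ℝ≥0) * ‖x‖ₑ ^ 2, hQ.const_mul (2 * c⁻¹ + 1), by fun_prop,
    fun θ hθ => ?_,
    Eventually.of_forall fun n θ _ ω => le_trans ?_ (add_le_add_right le_self_add _)⟩
  · calc ∫⁻ x, (2 * c : ℝ≥0) * ‖x‖ₑ ^ 2 ∂(lam θ)
        = (2 * c : ℝ≥0) * ∫⁻ x, ‖x‖ₑ ^ 2 ∂(lam θ) := lintegral_const_mul _ (by fun_prop)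
      _ ≤ (2 * c : ℝ≥0) * (1 + C : ℝ≥0) := by
          gcongr
          exact h.lintegral_enorm_sq_le hθ
      _ = κ := by
          rw [← ENNReal.coe_mul, hc]
          congr 1
          field_simp
  · calc (n : ℝ≥0∞)⁻¹ * ∑ i : Fin n, ‖R n ω i - V θ i ω‖ₑ * (‖R n ω i‖ₑ + ‖V θ i ω‖ₑ)
        ≤ (n : ℝ≥0∞)⁻¹ * ∑ i : Fin n, ((2 * c⁻¹ + 1 : ℝ≥0) * ‖R n ω i - V θ i ω‖ₑ ^ 2 +
            (2 * c : ℝ≥0) * ‖V θ i ω‖ₑ ^ 2) := by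
          gcongr
          exact enorm_sub_mul_add_le _ _ hc_pos
      _ = _ := by
          rw [Finset.sum_add_distrib, ← Finset.mul_sum, mul_add, mul_left_comm]

variable [CompleteSpace H] [Countable ι]

lemma unifTendstoZeroInProb_enorm_average_sq
    (h : UnifCentredMoments S lam η C b) (hPr : ∀ θ ∈ S, IsProbabilityMeasure (Pr θ))
    (hV : ∀ θ ∈ S, IsIIDSample (Pr θ) (V θ) (lam θ))
    (hD : UnifTendstoZeroInProb S Pr fun n θ ω =>
      (n : ℝ≥0∞)⁻¹ * ‖∑ i : Fin n, (R n ω i - V θ i ω)‖ₑ ^ 2) :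
    UnifTendstoZeroInProb S Pr fun n _ ω => ‖(n : ℝ)⁻¹ • ∑ j, R n ω j‖ₑ ^ 2 := by
  have h_rate : Tendsto (fun n : ℕ => (n : ℝ≥0∞)⁻¹ * (1 + C : ℝ≥0)) atTop (𝓝 0) := by
    simpa only [zero_mul] using ENNReal.Tendsto.mul_const (b := ((1 + C : ℝ≥0) : ℝ≥0∞))
      ENNReal.tendsto_inv_nat_nhds_zero (Or.inr ENNReal.coe_ne_top)
  have h_normSum : UnifTendstoZeroInProb S Pr fun n θ ω =>
      (n : ℝ≥0∞)⁻¹ * ‖normSum (V θ) n ω‖ₑ ^ 2 := by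
    refine .of_lintegral h_rate (Eventually.of_forall fun n θ hθ => ?_)
    have := hPr θ hθ
    have := h.prob θ hθ
    have hm := measurable_normSum (hV θ hθ).1 n
    refine ⟨((hm.enorm.pow_const 2).const_mul _).aemeasurable, ?_⟩
    rw [lintegral_const_mul _ (hm.enorm.pow_const 2)]
    gcongr
    exact (lintegral_normSum_sq_le b (hV θ hθ) (h.memLp_two hθ) (h.mean θ hθ) n).trans
      (h.lintegral_enorm_sq_le hθ)
  refine ((h_normSum.const_mul 2).add (hD.const_mul 2)).of_le_eventually ?_
  filter_upwards [eventually_ne_atTop 0] with n hn θ _ ω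
  exact enorm_average_sq_le hn _ _

omit [Countable ι] in
lemma unifTendstoZeroInProb_inv_mul_traceNorm_covOp (h : UnifCentredMoments S lam η C b)
    (hPr : ∀ θ ∈ S, IsProbabilityMeasure (Pr θ)) :
    UnifTendstoZeroInProb S Pr fun n θ _ =>
      ((n - 1 : ℕ) : ℝ≥0∞)⁻¹ * traceNorm (covOp (lam θ)) := by
  have h_rate :
      Tendsto (fun n : ℕ => ((n - 1 : ℕ) : ℝ≥0∞)⁻¹ * (1 + C : ℝ≥0)) atTop (𝓝 0) := by
    simpa only [zero_mul, Function.comp_def] using ENNReal.Tendsto.mul_const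
      (b := ((1 + C : ℝ≥0) : ℝ≥0∞))
      (ENNReal.tendsto_inv_nat_nhds_zero.comp (tendsto_sub_atTop_nat 1))
      (Or.inr ENNReal.coe_ne_top)
  refine .of_lintegral h_rate (Eventually.of_forall fun n θ hθ => ⟨aemeasurable_const, ?_⟩)
  have := hPr θ hθ
  rw [lintegral_const, measure_univ, mul_one]
  gcongr
  exact traceNorm_covOp_le (h.lintegral_enorm_sq_le hθ)

theorem exists_gaussian_limit_of_perturbed
    (h : UnifCentredMoments S lam η C b) (hPr : ∀ θ ∈ S, IsProbabilityMeasure (Pr θ))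
    (hV : ∀ θ ∈ S, IsIIDSample (Pr θ) (V θ) (lam θ))
    (hR : ∀ n, ∀ θ ∈ S, ∀ i, Measurable fun ω => R n ω i)
    (hD : UnifTendstoZeroInProb S Pr fun n θ ω =>
      (n : ℝ≥0∞)⁻¹ * ‖∑ i : Fin n, (R n ω i - V θ i ω)‖ₑ ^ 2) :
    ∃ N : Θ → Measure H, (∀ θ ∈ S, IsCenteredGaussian (covOp (lam θ)) (N θ)) ∧
      UnifTendstoInDistribution S Pr (fun n ω => √(n : ℝ) • (n : ℝ)⁻¹ • ∑ i, R n ω i) N := by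
  obtain ⟨N, hN, hlim⟩ := h.exists_gaussian_limit hPr hV
  refine ⟨N, hN, .of_sub (T' := fun n θ => normSum (V θ) n) hPr (fun n θ hθ => ?_)
    (fun n θ hθ => measurable_normSum (hV θ hθ).1 n) hlim (.of_sq (hD.of_le_eventually ?_))⟩
  · exact ((Finset.measurable_sum _ fun i _ => hR n θ hθ i).const_smul (n : ℝ)⁻¹).const_smul _
  · filter_upwards [eventually_ne_atTop 0] with n hn θ _ ω
    rw [normSum, smul_smul, ← div_eq_mul_inv, Real.sqrt_div_self, ← smul_sub,
      ← Finset.sum_sub_distrib, enorm_smul, mul_pow, enorm_inv_sqrt_natCast_sq hn]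

theorem unifTendstoZeroInProb_traceNorm_of_perturbed
    (h : UnifCentredMoments S lam η C b) (hPr : ∀ θ ∈ S, IsProbabilityMeasure (Pr θ))
    (hV : ∀ θ ∈ S, IsIIDSample (Pr θ) (V θ) (lam θ))
    (hD : UnifTendstoZeroInProb S Pr fun n θ ω =>
      (n : ℝ≥0∞)⁻¹ * ‖∑ i : Fin n, (R n ω i - V θ i ω)‖ₑ ^ 2)
    (hQ : UnifTendstoZeroInProb S Pr fun n θ ω =>
      (n : ℝ≥0∞)⁻¹ * ∑ i : Fin n, ‖R n ω i - V θ i ω‖ₑ ^ 2) :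
    UnifTendstoZeroInProb S Pr fun n θ ω => traceNorm (((n : ℝ) - 1)⁻¹ •
      ∑ i, outer (R n ω i - (n : ℝ)⁻¹ • ∑ j, R n ω j) (R n ω i - (n : ℝ)⁻¹ • ∑ j, R n ω j) -
        covOp (lam θ)) := by
  refine (((((h.unifTendstoZeroInProb_average_enorm_sub_mul_add hPr hV hQ).const_mul 2).add
    ((h.unifTendstoZeroInProb_traceNorm hPr hV).const_mul 2)).add
    (h.unifTendstoZeroInProb_inv_mul_traceNorm_covOp hPr)).add
    ((h.unifTendstoZeroInProb_enorm_average_sq hPr hV hD).const_mul 2)).of_le_eventually ?_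
  filter_upwards [eventually_ge_atTop 2] with n hn θ _ ω
  exact traceNorm_empirical_cov_sub_le hn (R n ω) (fun i => V θ i ω) _

end UnifCentredMoments

end Perturbation

section PerturbedOuterProducts

variable {E F : Type*}
  [NormedAddCommGroup E] [InnerProductSpace ℝ E] [CompleteSpace E]
  [NormedAddCommGroup F] [InnerProductSpace ℝ F] [CompleteSpace F] {n : ℕ}

lemma enorm_sum_outer_comm (u : Fin n → E) (v : Fin n → F) :
    ‖∑ i, HS.outer (u i) (v i)‖ₑ = ‖∑ i, HS.outer (v i) (u i)‖ₑ := by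
  have h_sq : ‖∑ i, HS.outer (u i) (v i)‖ ^ 2 = ‖∑ i, HS.outer (v i) (u i)‖ ^ 2 := by
    simp_rw [← real_inner_self_eq_norm_sq, sum_inner, inner_sum, HS.inner_outer_outer, mul_comm]
  rw [← ofReal_norm, ← ofReal_norm, (sq_eq_sq₀ (norm_nonneg _) (norm_nonneg _)).1 h_sq]

lemma enorm_add_add_sq_le {G : Type*} [NormedAddCommGroup G] (x y z : G) :
    ‖x + y + z‖ₑ ^ 2 ≤ 4 * ‖x‖ₑ ^ 2 + 4 * ‖y‖ₑ ^ 2 + 2 * ‖z‖ₑ ^ 2 := by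
  calc ‖x + y + z‖ₑ ^ 2 ≤ (‖x‖ₑ + ‖y‖ₑ + ‖z‖ₑ) ^ 2 := by
        gcongr
        exact (enorm_add_le (x + y) z).trans (add_le_add (enorm_add_le x y) le_rfl)
    _ ≤ 2 * (2 * ‖x‖ₑ ^ 2 + 2 * ‖y‖ₑ ^ 2) + 2 * ‖z‖ₑ ^ 2 := by
        refine (add_sq_le_two_mul_sq_add _ _).trans ?_
        gcongr
        exact add_sq_le_two_mul_sq_add _ _
    _ = _ := by ring

lemma HS.outer_add_sub_outer (a e : E) (b x : F) :
    HS.outer (e + a) (x + b) - HS.outer e x =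
      HS.outer a x + HS.outer e b + HS.outer a b := by
  rw [HS.outer_add_left, HS.outer_add_right, HS.outer_add_right]
  abel

lemma enorm_sum_outer_sq_le (a : Fin n → E) (b : Fin n → F) :
    ‖∑ i, HS.outer (a i) (b i)‖ₑ ^ 2 ≤ (∑ i, ‖a i‖ₑ ^ 2) * ∑ i, ‖b i‖ₑ ^ 2 := by
  have cauchy_schwarz : (∑ i, ‖a i‖ₑ * ‖b i‖ₑ) ^ 2 ≤ (∑ i, ‖a i‖ₑ ^ 2) * ∑ i, ‖b i‖ₑ ^ 2 := by
    simp_rw [enorm_eq_nnnorm]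
    exact_mod_cast Finset.sum_mul_sq_le_sq_mul_sq Finset.univ (fun i => ‖a i‖₊) fun i => ‖b i‖₊
  refine le_trans ?_ cauchy_schwarz
  gcongr
  refine (enorm_sum_le _ _).trans (le_of_eq ?_)
  simp_rw [HS.enorm_outer]

lemma enorm_sum_outer_perturbed_sq_le (a e : Fin n → E) (b x : Fin n → F) :
    ‖∑ i, (HS.outer (e i + a i) (x i + b i) - HS.outer (e i) (x i))‖ₑ ^ 2 ≤
      4 * ‖∑ i, HS.outer (a i) (x i)‖ₑ ^ 2 + 4 * ‖∑ i, HS.outer (b i) (e i)‖ₑ ^ 2 +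
        2 * ((∑ i, ‖a i‖ₑ ^ 2) * ∑ i, ‖b i‖ₑ ^ 2) := by
  simp_rw [HS.outer_add_sub_outer, Finset.sum_add_distrib]
  refine (enorm_add_add_sq_le _ _ _).trans ?_
  rw [enorm_sum_outer_comm e b]
  gcongr
  exact enorm_sum_outer_sq_le a b

lemma sum_enorm_outer_perturbed_sq_le (a e : Fin n → E) (b x : Fin n → F) :
    ∑ i, ‖HS.outer (e i + a i) (x i + b i) - HS.outer (e i) (x i)‖ₑ ^ 2 ≤
      4 * ∑ i, ‖a i‖ₑ ^ 2 * ‖x i‖ₑ ^ 2 + 4 * ∑ i, ‖b i‖ₑ ^ 2 * ‖e i‖ₑ ^ 2 +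
        2 * ((∑ i, ‖a i‖ₑ ^ 2) * ∑ i, ‖b i‖ₑ ^ 2) := by
  have sum_mul_le : ∑ i, ‖a i‖ₑ ^ 2 * ‖b i‖ₑ ^ 2 ≤ (∑ i, ‖a i‖ₑ ^ 2) * ∑ i, ‖b i‖ₑ ^ 2 := by
    rw [Finset.sum_mul]
    refine Finset.sum_le_sum fun i _ => mul_le_mul_right ?_ _
    exact Finset.single_le_sum (f := fun i => ‖b i‖ₑ ^ 2) (fun _ _ => zero_le) (Finset.mem_univ i)
  calc ∑ i, ‖HS.outer (e i + a i) (x i + b i) - HS.outer (e i) (x i)‖ₑ ^ 2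
      ≤ ∑ i, (4 * (‖a i‖ₑ ^ 2 * ‖x i‖ₑ ^ 2) + 4 * (‖b i‖ₑ ^ 2 * ‖e i‖ₑ ^ 2) +
          2 * (‖a i‖ₑ ^ 2 * ‖b i‖ₑ ^ 2)) := by
        refine Finset.sum_le_sum fun i _ => ?_
        rw [HS.outer_add_sub_outer]
        refine (enorm_add_add_sq_le _ _ _).trans (le_of_eq ?_)
        simp_rw [HS.enorm_outer, mul_pow]
        ring
    _ = 4 * ∑ i, ‖a i‖ₑ ^ 2 * ‖x i‖ₑ ^ 2 + 4 * ∑ i, ‖b i‖ₑ ^ 2 * ‖e i‖ₑ ^ 2 +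
        2 * ∑ i, ‖a i‖ₑ ^ 2 * ‖b i‖ₑ ^ 2 := by
        rw [Finset.sum_add_distrib, Finset.sum_add_distrib, Finset.mul_sum, Finset.mul_sum,
          Finset.mul_sum]
    _ ≤ _ := by gcongr

end PerturbedOuterProducts

/-! ### Errors and residuals of the regressions -/

section ConditionalIndependence

lemma abs_indicator_one_le {α : Type*} (s : Set α) (x : α) :
    |s.indicator (fun _ => (1 : ℝ)) x| ≤ 1 := by
  by_cases hx : x ∈ s <;> simp [hx]

variable {HX HY 𝒵 : Type*} [MeasurableSpace HX] [MeasurableSpace HY] [MeasurableSpace 𝒵]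

lemma CondIndepGiven.condProb_inter {P : Measure (HX × HY × 𝒵)} (h : CondIndepGiven P)
    {A : Set HX} {B : Set HY} (hA : MeasurableSet A) (hB : MeasurableSet B) :
    P⟦(fun w => w.1) ⁻¹' A ∩ (fun w => w.2.1) ⁻¹' B |
        MeasurableSpace.comap (fun w => w.2.2) inferInstance⟧ =ᵐ[P]
      P⟦(fun w => w.1) ⁻¹' A | MeasurableSpace.comap (fun w => w.2.2) inferInstance⟧ *
        P⟦(fun w => w.2.1) ⁻¹' B | MeasurableSpace.comap (fun w => w.2.2) inferInstance⟧ := by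
  have h_indicator := h (A.indicator fun _ => 1) (B.indicator fun _ => 1)
    (measurable_const.indicator hA) (measurable_const.indicator hB)
    ⟨1, fun x => abs_indicator_one_le A x⟩ ⟨1, fun y => abs_indicator_one_le B y⟩
  have indicator_inter : ((fun w : HX × HY × 𝒵 => w.1) ⁻¹' A ∩ (fun w => w.2.1) ⁻¹' B).indicator
      (fun _ => (1 : ℝ)) =
        fun w => A.indicator (fun _ => 1) w.1 * B.indicator (fun _ => 1) w.2.1 := by
    funext w
    by_cases hwA : w.1 ∈ A <;> by_cases hwB : w.2.1 ∈ B <;> simp [hwA, hwB]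
  rw [indicator_inter]
  exact h_indicator

/-- Exchanges the roles of `X` and `Y`. -/
def swapXY {α β γ : Type*} (w : α × β × γ) : β × α × γ := (w.2.1, w.1, w.2.2)

lemma measurable_swapXY {α β γ : Type*} [MeasurableSpace α] [MeasurableSpace β]
    [MeasurableSpace γ] : Measurable (swapXY : α × β × γ → β × α × γ) :=
  measurable_snd.fst.prodMk (measurable_fst.prodMk measurable_snd.snd)

lemma ae_integrable_condDistrib {T G : Type*} [MeasurableSpace T] [NormedAddCommGroup G]
    [CompleteSpace G] [SecondCountableTopology G] [MeasurableSpace G] [BorelSpace G]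
    {μ : Measure T} [IsFiniteMeasure μ] {Y : T → G} {Z : T → 𝒵} (hZ : Measurable Z)
    (hYm : Measurable Y) (hY : Integrable Y μ) :
    ∀ᵐ z ∂(μ.map Z), Integrable id (condDistrib Y Z μ z) := by
  have hsnd : Integrable (fun p : 𝒵 × G => p.2) (μ.map fun w => (Z w, Y w)) :=
    (integrable_map_measure measurable_snd.aestronglyMeasurable
      (hZ.prodMk hYm).aemeasurable).2 hY
  exact Integrable.condDistrib_ae_map hYm.aemeasurable hsnd

end ConditionalIndependence

section ConditionalMeanX

variable {HX HY 𝒵 : Type*}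
  [NormedAddCommGroup HX] [CompleteSpace HX] [SecondCountableTopology HX]
  [MeasurableSpace HX] [BorelSpace HX]
  [MeasurableSpace HY] [MeasurableSpace 𝒵] (P : ProbabilityMeasure (HX × HY × 𝒵))

/-- The conditional distribution of `X` given `Z`. -/
abbrev kernelX : Kernel 𝒵 HX :=
  condDistrib (fun w : HX × HY × 𝒵 => w.1) (fun w => w.2.2) (P : Measure _)

variable {P} in
lemma resampleInvariant_kernelX (h : CondIndepGiven (P : Measure (HX × HY × 𝒵))) :
    ResampleInvariant ((P : Measure (HX × HY × 𝒵)).map swapXY) (kernelX P) := by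
  intro G hG
  have hG_redrawn :
      Measurable fun w : HY × HX × 𝒵 => ∫⁻ x, G (w.1, x, w.2.2) ∂(kernelX P w.2.2) :=
    Measurable.lintegral_kernel_prod_right' (κ := (kernelX P).comap _ measurable_snd.snd)
      (f := fun p : (HY × HX × 𝒵) × HX => G (p.1.1, p.2, p.1.2.2)) (by fun_prop)
  rw [lintegral_map hG measurable_swapXY, lintegral_map hG_redrawn measurable_swapXY]
  refine lintegral_eq_lintegral_lintegral_condDistrib (μ := (P : Measure (HX × HY × 𝒵)))
    (X := fun w : HX × HY × 𝒵 => w.2.1) (Y := fun w => w.1) (Z := fun w => w.2.2)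
    (by fun_prop) (by fun_prop) (by fun_prop) (fun A B hA hB => ?_) hG
  rw [Set.inter_comm, mul_comm]
  exact h.condProb_inter hB hA

variable [InnerProductSpace ℝ HX]

lemma measurable_fReg : Measurable (fReg P) :=
  (StronglyMeasurable.integral_kernel (κ := kernelX P) (f := fun x : HX => x)
    stronglyMeasurable_id).measurable

lemma measurable_eps : Measurable (eps P) :=
  measurable_fst.sub ((measurable_fReg P).comp measurable_snd.snd)

variable {P}

lemma ae_integrable_kernelX_and_integral_eq
    (hX : Integrable (fun w => w.1) (P : Measure (HX × HY × 𝒵))) :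
    ∀ᵐ w ∂((P : Measure (HX × HY × 𝒵)).map swapXY), Integrable id (kernelX P w.2.2) ∧
      ∫ x, x ∂(kernelX P w.2.2) = fReg P w.2.2 := by
  have hZ_law : (P : Measure (HX × HY × 𝒵)).map (fun w => w.2.2) =
      ((P : Measure (HX × HY × 𝒵)).map swapXY).map (fun w => w.2.2) := by
    rw [Measure.map_map (by fun_prop) measurable_swapXY]
    rfl
  have hint := ae_integrable_condDistrib
    (Z := fun w : HX × HY × 𝒵 => w.2.2) (by fun_prop) (by fun_prop) hX
  rw [hZ_law] at hint
  exact (ae_of_ae_map (by fun_prop) hint).mono fun _ hw => ⟨hw, rfl⟩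

end ConditionalMeanX

section ConditionalMeanY

variable {HX HY 𝒵 : Type*} [MeasurableSpace HX]
  [NormedAddCommGroup HY] [CompleteSpace HY] [SecondCountableTopology HY]
  [MeasurableSpace HY] [BorelSpace HY]
  [MeasurableSpace 𝒵] (P : ProbabilityMeasure (HX × HY × 𝒵))

/-- The conditional distribution of `Y` given `Z`. -/
abbrev kernelY : Kernel 𝒵 HY :=
  condDistrib (fun w : HX × HY × 𝒵 => w.2.1) (fun w => w.2.2) (P : Measure _)

variable {P} in
lemma resampleInvariant_kernelY (h : CondIndepGiven (P : Measure (HX × HY × 𝒵))) :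
    ResampleInvariant (P : Measure (HX × HY × 𝒵)) (kernelY P) := fun _ hG =>
  lintegral_eq_lintegral_lintegral_condDistrib (X := fun w : HX × HY × 𝒵 => w.1)
    (Y := fun w => w.2.1) (Z := fun w => w.2.2) (by fun_prop) (by fun_prop) (by fun_prop)
    (fun _ _ hA hB => h.condProb_inter hA hB) hG

variable [InnerProductSpace ℝ HY]

lemma measurable_gReg : Measurable (gReg P) :=
  (StronglyMeasurable.integral_kernel (κ := kernelY P) (f := fun y : HY => y)
    stronglyMeasurable_id).measurable

lemma measurable_xi : Measurable (xi P) :=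
  measurable_snd.fst.sub ((measurable_gReg P).comp measurable_snd.snd)

variable {P}

lemma ae_integrable_kernelY_and_integral_eq
    (hY : Integrable (fun w => w.2.1) (P : Measure (HX × HY × 𝒵))) :
    ∀ᵐ w ∂(P : Measure (HX × HY × 𝒵)), Integrable id (kernelY P w.2.2) ∧
      ∫ y, y ∂(kernelY P w.2.2) = gReg P w.2.2 :=
  (ae_of_ae_map measurable_snd.snd.aemeasurable (ae_integrable_condDistrib
    (Z := fun w : HX × HY × 𝒵 => w.2.2) (by fun_prop) (by fun_prop) hY)).mono
    fun _ hw => ⟨hw, rfl⟩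

end ConditionalMeanY

section ErrorLaw

variable {HX HY 𝒵 : Type*}
  [NormedAddCommGroup HX] [InnerProductSpace ℝ HX] [CompleteSpace HX]
  [SecondCountableTopology HX] [MeasurableSpace HX] [BorelSpace HX]
  [NormedAddCommGroup HY] [InnerProductSpace ℝ HY] [CompleteSpace HY]
  [SecondCountableTopology HY] [MeasurableSpace HY] [BorelSpace HY]
  [MeasurableSpace 𝒵]

/-- The distribution of the outer product `ε_P ⊗ ξ_P` of the errors. -/
def errLaw (P : ProbabilityMeasure (HX × HY × 𝒵)) : Measure (HS HX HY) :=
  (P : Measure (HX × HY × 𝒵)).map fun w => HS.outer (eps P w) (xi P w)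

variable {P : ProbabilityMeasure (HX × HY × 𝒵)}

lemma measurable_outer_errors :
    Measurable fun w : HX × HY × 𝒵 => HS.outer (eps P w) (xi P w) :=
  HS.continuous_outer.measurable.comp ((measurable_eps P).prodMk (measurable_xi P))

instance : IsProbabilityMeasure (errLaw P) :=
  Measure.isProbabilityMeasure_map measurable_outer_errors.aemeasurable

lemma lintegral_errLaw {f : HS HX HY → ℝ≥0∞} (hf : Measurable f) :
    ∫⁻ x, f x ∂(errLaw P) = ∫⁻ w, f (HS.outer (eps P w) (xi P w)) ∂(P : Measure (HX × HY × 𝒵)) :=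
  lintegral_map hf measurable_outer_errors

lemma lintegral_enorm_rpow_errLaw_le {η θ : ℝ} (hθ : 0 ≤ θ) (hθη : θ ≤ η) {C : ℝ≥0}
    (hC : ∫⁻ w, ‖eps P w‖ₑ ^ (2 + η) * ‖xi P w‖ₑ ^ (2 + η) ∂(P : Measure (HX × HY × 𝒵)) ≤ C) :
    ∫⁻ x, ‖x‖ₑ ^ (2 + θ) ∂(errLaw P) ≤ (1 + C : ℝ≥0) := by
  have hη : 0 ≤ 2 + η := by linarith
  calc ∫⁻ x, ‖x‖ₑ ^ (2 + θ) ∂(errLaw P)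
      = ∫⁻ w, ‖HS.outer (eps P w) (xi P w)‖ₑ ^ (2 + θ) ∂(P : Measure (HX × HY × 𝒵)) :=
        lintegral_errLaw (by fun_prop)
    _ ≤ ∫⁻ w, (1 + ‖eps P w‖ₑ ^ (2 + η) * ‖xi P w‖ₑ ^ (2 + η)) ∂(P : Measure (HX × HY × 𝒵)) := by
        refine lintegral_mono fun w => ?_
        rw [HS.enorm_outer, ← ENNReal.mul_rpow_of_nonneg _ _ hη]
        exact rpow_le_one_add_rpow (by linarith) (by linarith) _
    _ ≤ (1 + C : ℝ≥0) := by
        rw [lintegral_add_left measurable_const, lintegral_const, measure_univ, mul_one]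
        push_cast
        gcongr

lemma lintegral_enorm_sub_basisProj_sq_errLaw {ι κ : Type*} [Countable ι] [Countable κ]
    (eX : HilbertBasis ι ℝ HX) (eY : HilbertBasis κ ℝ HY) (s : Finset (ι × κ)) :
    ∫⁻ x, ‖x - basisProj (HS.outerBasis eX eY) s x‖ₑ ^ 2 ∂(errLaw P) =
      ∑' p : {p // p ∉ s}, ∫⁻ w, ‖⟪eX p.1.1, eps P w⟫‖ₑ ^ 2 * ‖⟪eY p.1.2, xi P w⟫‖ₑ ^ 2
        ∂(P : Measure (HX × HY × 𝒵)) := by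
  have hcoord (p : ι × κ) :
      Measurable fun x : HS HX HY => ‖⟪HS.outerBasis eX eY p, x⟫‖ₑ ^ 2 :=
    ((continuous_const.inner continuous_id).measurable.enorm).pow_const 2
  simp_rw [enorm_sub_basisProj_sq]
  rw [lintegral_tsum fun p : {p // p ∉ s} => (hcoord p).aemeasurable]
  refine tsum_congr fun p => ?_
  rw [lintegral_errLaw (hcoord p)]
  simp_rw [HS.outerBasis_apply, HS.inner_outer_outer, enorm_mul, mul_pow]

lemma finite_setOf_idx_add_lt (dX dY : ℕ∞) (K : ℕ) :
    {p : Idx dX × Idx dY | (p.1 : ℕ) + (p.2 : ℕ) < K}.Finite := by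
  refine Set.Finite.of_injOn (f := fun p => ((p.1 : ℕ), (p.2 : ℕ)))
    (t := Set.Iio K ×ˢ Set.Iio K) (fun p hp => ?_)
    (Subtype.val_injective.prodMap Subtype.val_injective).injOn
    ((Set.finite_Iio K).prod (Set.finite_Iio K))
  have hp_lt : (p.1 : ℕ) + (p.2 : ℕ) < K := hp
  exact ⟨Set.mem_Iio.2 (by lia), Set.mem_Iio.2 (by lia)⟩

lemma exists_finset_basisProj_tail_le {𝒬 : Set (ProbabilityMeasure (HX × HY × 𝒵))} {dX dY : ℕ∞}
    {eX : HilbertBasis (Idx dX) ℝ HX} {eY : HilbertBasis (Idx dY) ℝ HY}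
    (htail : Tendsto (fun K : ℕ => ⨆ P ∈ 𝒬,
      ∑' p : {p : Idx dX × Idx dY // K ≤ (p.1 : ℕ) + (p.2 : ℕ)},
        ∫⁻ w, ‖⟪eX p.1.1, eps P w⟫‖ₑ ^ 2 * ‖⟪eY p.1.2, xi P w⟫‖ₑ ^ 2
          ∂(P : Measure (HX × HY × 𝒵))) atTop (𝓝 0)) {δ : ℝ≥0∞} (hδ : 0 < δ) :
    ∃ s : Finset (Idx dX × Idx dY), ∀ P ∈ 𝒬,
      ∫⁻ x, ‖x - basisProj (HS.outerBasis eX eY) s x‖ₑ ^ 2 ∂(errLaw P) ≤ δ := by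
  obtain ⟨K, hK⟩ := (ENNReal.tendsto_nhds_zero.1 htail δ hδ).exists
  refine ⟨(finite_setOf_idx_add_lt dX dY K).toFinset, fun P hP => ?_⟩
  rw [lintegral_enorm_sub_basisProj_sq_errLaw]
  refine le_of_eq_of_le ?_ (iSup₂_le_iff.1 hK P hP)
  have notMem_iff (p : Idx dX × Idx dY) :
      p ∉ (finite_setOf_idx_add_lt dX dY K).toFinset ↔ K ≤ (p.1 : ℕ) + (p.2 : ℕ) := by simp
  exact (Equiv.subtypeEquivRight notMem_iff).tsum_eq
    fun p : {p : Idx dX × Idx dY // K ≤ (p.1 : ℕ) + (p.2 : ℕ)} =>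
      ∫⁻ w, ‖⟪eX p.1.1, eps P w⟫‖ₑ ^ 2 * ‖⟪eY p.1.2, xi P w⟫‖ₑ ^ 2 ∂(P : Measure (HX × HY × 𝒵))

variable [SecondCountableTopology (HS HX HY)]

lemma covOp_errLaw : covOp (errLaw P) = covP P :=
  integral_map measurable_outer_errors.aemeasurable
    (continuous_outer.comp (continuous_id.prodMk continuous_id)).aestronglyMeasurable

lemma integral_inner_errLaw (h : CondIndepGiven (P : Measure (HX × HY × 𝒵)))
    (hY : Integrable (fun w => w.2.1) (P : Measure (HX × HY × 𝒵)))
    (hL : MemLp id 2 (errLaw P)) (t : HS HX HY) :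
    ∫ x, ⟪t, x⟫ ∂(errLaw P) = 0 := by
  have hmeas : Measurable fun x : HS HX HY => ⟪t, x⟫ := by fun_prop
  have hint : Integrable (fun x => ⟪t, x⟫) (errLaw P) := (hL.const_inner t).integrable one_le_two
  rw [errLaw, integral_map measurable_outer_errors.aemeasurable hmeas.aestronglyMeasurable]
  refine integral_eq_zero_of_resample (K := (kernelY P).comap _ measurable_snd.snd)
    (res := fun p : (HX × HY × 𝒵) × HY => (p.1.1, p.2, p.1.2.2))
    (m := fun w => gReg P w.2.2) (h := fun w => t.toCLM (eps P w)) (by fun_prop)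
    (fun G hG => resampleInvariant_kernelY h G hG) (ae_integrable_kernelY_and_integral_eq hY)
    ((integrable_map_measure hmeas.aestronglyMeasurable
      measurable_outer_errors.aemeasurable).1 hint) fun w y => ?_
  rw [HS.inner_outer_right]
  rfl

lemma unifCentredMoments_errLaw {𝒬 : Set (ProbabilityMeasure (HX × HY × 𝒵))} {dX dY : ℕ∞}
    {eX : HilbertBasis (Idx dX) ℝ HX} {eY : HilbertBasis (Idx dY) ℝ HY}
    (hY : ∀ P ∈ 𝒬, Integrable (fun w => w.2.1) (P : Measure (HX × HY × 𝒵)))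
    (hnull : ∀ P ∈ 𝒬, CondIndepGiven (P : Measure (HX × HY × 𝒵)))
    {η : ℝ} (hη : 0 < η) {C : ℝ≥0}
    (hmom : ∀ P ∈ 𝒬, ∫⁻ w, ‖eps P w‖ₑ ^ (2 + η) * ‖xi P w‖ₑ ^ (2 + η)
      ∂(P : Measure (HX × HY × 𝒵)) ≤ C)
    (htail : Tendsto (fun K : ℕ => ⨆ P ∈ 𝒬,
      ∑' p : {p : Idx dX × Idx dY // K ≤ (p.1 : ℕ) + (p.2 : ℕ)},
        ∫⁻ w, ‖⟪eX p.1.1, eps P w⟫‖ₑ ^ 2 * ‖⟪eY p.1.2, xi P w⟫‖ₑ ^ 2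
          ∂(P : Measure (HX × HY × 𝒵))) atTop (𝓝 0)) :
    UnifCentredMoments 𝒬 errLaw (min η 1) (1 + C) (HS.outerBasis eX eY) := by
  have hmin : 0 < min η 1 := lt_min hη one_pos
  have hmom_errLaw : ∀ P ∈ 𝒬, ∫⁻ x, ‖x‖ₑ ^ (2 + min η 1) ∂(errLaw P) ≤ (1 + C : ℝ≥0) :=
    fun P hP => lintegral_enorm_rpow_errLaw_le hmin.le (min_le_left _ _) (hmom P hP)
  have hL2 : ∀ P ∈ 𝒬, MemLp id 2 (errLaw P) := fun P hP =>
    memLp_two_of_lintegral_ne_top aestronglyMeasurable_id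
      ((lintegral_enorm_sq_le_of_lintegral_rpow_le hmin.le
        (hmom_errLaw P hP)).trans_lt ENNReal.coe_lt_top).ne
  exact
    { prob := fun P _ => inferInstance
      pos := hmin
      le_one := min_le_right _ _
      mean := fun P hP => integral_inner_errLaw (hnull P hP) (hY P hP) (hL2 P hP)
      mom := hmom_errLaw
      tail := fun δ hδ => exists_finset_basisProj_tail_le htail hδ }

end ErrorLaw

section PredictionErrors

variable {E 𝒵 : Type*} [NormedAddCommGroup E]

/-- The in-sample errors `h(z_i) - ĥ(z_i)` of the estimate `ĥ` of `h`. -/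
def predError (r : RegressionMethod 𝒵 E) (h : 𝒵 → E) {n : ℕ} (x : Fin n → E) (z : Fin n → 𝒵)
    (i : Fin n) : E :=
  h (z i) - r n x z (z i)

lemma mul_mspe_mul_mspe {F : Type*} [NormedAddCommGroup F] (r : RegressionMethod 𝒵 E)
    (s : RegressionMethod 𝒵 F) (h : 𝒵 → E) (k : 𝒵 → F) {n : ℕ} (hn : n ≠ 0)
    (x : Fin n → E) (y : Fin n → F) (z : Fin n → 𝒵) :
    n * mspe r h n x z * mspe s k n y z =
      (n : ℝ≥0∞)⁻¹ * ((∑ i, ‖predError r h x z i‖ₑ ^ 2) * ∑ i, ‖predError s k y z i‖ₑ ^ 2) := by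
  rw [mspe, mspe, ENNReal.mul_div_cancel (by exact_mod_cast hn) (ENNReal.natCast_ne_top n),
    div_eq_mul_inv]
  simp only [predError]
  ring

variable [MeasurableSpace 𝒵] [MeasurableSpace E]

lemma measurable_predError [SecondCountableTopology E] [BorelSpace E] {F : Type*}
    [MeasurableSpace F] {r : RegressionMethod 𝒵 E} (hr : r.IsMeasurable) {h : 𝒵 → E}
    (hh : Measurable h) {n : ℕ} (i : Fin n) :
    Measurable fun d : Fin n → E × F × 𝒵 =>
      predError r h (fun j => (d j).1) (fun j => (d j).2.2) i := by
  have hxz : Measurable fun d : Fin n → E × F × 𝒵 => (fun j => (d j).1, fun j => (d j).2.2) := by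
    fun_prop
  exact (hh.comp (by fun_prop)).sub ((hr n i).comp hxz)

end PredictionErrors

section Residuals

variable {HX HY 𝒵 Ω : Type*}
  [NormedAddCommGroup HX] [InnerProductSpace ℝ HX] [CompleteSpace HX]
  [SecondCountableTopology HX] [MeasurableSpace HX] [BorelSpace HX]
  [NormedAddCommGroup HY] [InnerProductSpace ℝ HY] [CompleteSpace HY]
  [SecondCountableTopology HY] [MeasurableSpace HY] [BorelSpace HY]
  [MeasurableSpace 𝒵] [MeasurableSpace Ω] {𝒬 : Set (ProbabilityMeasure (HX × HY × 𝒵))}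
  {Pr : ProbabilityMeasure (HX × HY × 𝒵) → Measure Ω} {W : ℕ → Ω → HX × HY × 𝒵}
  {fhat : RegressionMethod 𝒵 HX} {ghat : RegressionMethod 𝒵 HY}

lemma measurable_scrR [SecondCountableTopology (HS HX HY)] (hfhat : fhat.IsMeasurable)
    (hghat : ghat.IsMeasurable) (hW : ∀ i, Measurable (W i)) (n : ℕ) (i : Fin n) :
    Measurable fun ω => scrR fhat ghat W n ω i := by
  have hx : Measurable (xData W n) := measurable_pi_lambda _ fun j => (hW j).fst
  have hy : Measurable (yData W n) := measurable_pi_lambda _ fun j => (hW j).snd.fst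
  have hz : Measurable (zData W n) := measurable_pi_lambda _ fun j => (hW j).snd.snd
  have hresid_x : Measurable fun ω => resid fhat n (xData W n ω) (zData W n ω) i :=
    (hW i).fst.sub ((hfhat n i).comp (hx.prodMk hz))
  have hresid_y : Measurable fun ω => resid ghat n (yData W n ω) (zData W n ω) i :=
    (hW i).snd.fst.sub ((hghat n i).comp (hy.prodMk hz))
  exact HS.continuous_outer.measurable.comp (hresid_x.prodMk hresid_y)

omit [MeasurableSpace Ω] in
lemma scrR_eq_outer_add (P : ProbabilityMeasure (HX × HY × 𝒵)) (n : ℕ) (ω : Ω) (i : Fin n) :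
    scrR fhat ghat W n ω i =
      HS.outer (eps P (W i ω) + predError fhat (fReg P) (xData W n ω) (zData W n ω) i)
        (xi P (W i ω) + predError ghat (gReg P) (yData W n ω) (zData W n ω) i) := by
  simp only [scrR, resid, eps, xi, predError, xData, yData, zData, sub_add_sub_cancel]

lemma unifTendstoZeroInProb_predError_xi
    (hPr : ∀ P ∈ 𝒬, IsProbabilityMeasure (Pr P))
    (hW : ∀ P ∈ 𝒬, IsIIDSample (Pr P) W (P : Measure (HX × HY × 𝒵)))
    (hfhat : fhat.IsMeasurable)
    (hY : ∀ P ∈ 𝒬, Integrable (fun w => w.2.1) (P : Measure (HX × HY × 𝒵)))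
    (hnull : ∀ P ∈ 𝒬, CondIndepGiven (P : Measure (HX × HY × 𝒵)))
    (h_wf : UnifTendstoZeroInProb 𝒬 Pr fun n P ω =>
      wmspe fhat (fReg P) (vVar P) n (xData W n ω) (zData W n ω)) :
    (UnifTendstoZeroInProb 𝒬 Pr fun n P ω => (n : ℝ≥0∞)⁻¹ * ∑ i : Fin n,
      ‖predError fhat (fReg P) (xData W n ω) (zData W n ω) i‖ₑ ^ 2 * ‖xi P (W i ω)‖ₑ ^ 2) ∧
    UnifTendstoZeroInProb 𝒬 Pr fun n P ω => (n : ℝ≥0∞)⁻¹ * ‖∑ i : Fin n,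
      HS.outer (predError fhat (fReg P) (xData W n ω) (zData W n ω) i) (xi P (W i ω))‖ₑ ^ 2 := by
  let α (n : ℕ) (P : ProbabilityMeasure (HX × HY × 𝒵)) (d : Fin n → HX × HY × 𝒵) : Fin n → HX :=
    predError fhat (fReg P) (fun j => (d j).1) (fun j => (d j).2.2)
  have hresample : ∀ P ∈ 𝒬, ResampleInvariant (P : Measure (HX × HY × 𝒵)) (kernelY P) :=
    fun P hP => resampleInvariant_kernelY (hnull P hP)
  have hα : ∀ n, ∀ P ∈ 𝒬, ∀ i, Measurable fun d => α n P d i := fun n P _ i =>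
    measurable_predError hfhat (measurable_fReg P) i
  have hα_redraw : ∀ n P d i j y, α n P (redraw i (d, y)) j = α n P d j := fun n P d i j y => by
    simp only [α, redraw_fst, redraw_snd_snd]
  exact ⟨unifTendstoZeroInProb_average_mul_noise (g := gReg) (α := α) hPr hW hresample
      (fun P _ => measurable_gReg P) hα hα_redraw h_wf,
    unifTendstoZeroInProb_enorm_sum_outer_noise_sq (g := gReg) (α := α) hPr hW hresample
      (fun P _ => measurable_gReg P)
      (fun P hP => ae_integrable_kernelY_and_integral_eq (hY P hP)) hα hα_redraw h_wf⟩

lemma unifTendstoZeroInProb_predError_eps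
    (hPr : ∀ P ∈ 𝒬, IsProbabilityMeasure (Pr P))
    (hW : ∀ P ∈ 𝒬, IsIIDSample (Pr P) W (P : Measure (HX × HY × 𝒵)))
    (hghat : ghat.IsMeasurable)
    (hX : ∀ P ∈ 𝒬, Integrable (fun w => w.1) (P : Measure (HX × HY × 𝒵)))
    (hnull : ∀ P ∈ 𝒬, CondIndepGiven (P : Measure (HX × HY × 𝒵)))
    (h_wg : UnifTendstoZeroInProb 𝒬 Pr fun n P ω =>
      wmspe ghat (gReg P) (uVar P) n (yData W n ω) (zData W n ω)) :
    (UnifTendstoZeroInProb 𝒬 Pr fun n P ω => (n : ℝ≥0∞)⁻¹ * ∑ i : Fin n,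
      ‖predError ghat (gReg P) (yData W n ω) (zData W n ω) i‖ₑ ^ 2 * ‖eps P (W i ω)‖ₑ ^ 2) ∧
    UnifTendstoZeroInProb 𝒬 Pr fun n P ω => (n : ℝ≥0∞)⁻¹ * ‖∑ i : Fin n,
      HS.outer (predError ghat (gReg P) (yData W n ω) (zData W n ω) i) (eps P (W i ω))‖ₑ ^ 2 := by
  let α (n : ℕ) (P : ProbabilityMeasure (HX × HY × 𝒵)) (d : Fin n → HY × HX × 𝒵) : Fin n → HY :=
    predError ghat (gReg P) (fun j => (d j).1) (fun j => (d j).2.2)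
  have hW_swap : ∀ P ∈ 𝒬, IsIIDSample (Pr P) (fun i ω => swapXY (W i ω))
      ((P : Measure (HX × HY × 𝒵)).map swapXY) := fun P hP => by
    have := hPr P hP
    exact (hW P hP).comp measurable_swapXY
  have hresample : ∀ P ∈ 𝒬,
      ResampleInvariant ((P : Measure (HX × HY × 𝒵)).map swapXY) (kernelX P) :=
    fun P hP => resampleInvariant_kernelX (hnull P hP)
  have hα : ∀ n, ∀ P ∈ 𝒬, ∀ i, Measurable fun d => α n P d i := fun n P _ i =>
    measurable_predError hghat (measurable_gReg P) i
  have hα_redraw : ∀ n P d i j x, α n P (redraw i (d, x)) j = α n P d j := fun n P d i j x => by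
    simp only [α, redraw_fst, redraw_snd_snd]
  exact ⟨unifTendstoZeroInProb_average_mul_noise (g := fReg)
      (W := fun i ω => swapXY (W i ω)) (α := α) hPr hW_swap hresample
      (fun P _ => measurable_fReg P) hα hα_redraw h_wg,
    unifTendstoZeroInProb_enorm_sum_outer_noise_sq (g := fReg)
      (W := fun i ω => swapXY (W i ω)) (α := α) hPr hW_swap hresample
      (fun P _ => measurable_fReg P)
      (fun P hP => ae_integrable_kernelX_and_integral_eq (hX P hP)) hα hα_redraw h_wg⟩

lemma unifTendstoZeroInProb_average_scrR_sub
    (h_prod : UnifTendstoZeroInProb 𝒬 Pr fun n P ω =>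
      n * mspe fhat (fReg P) n (xData W n ω) (zData W n ω) *
        mspe ghat (gReg P) n (yData W n ω) (zData W n ω))
    (h_xi : UnifTendstoZeroInProb 𝒬 Pr fun n P ω => (n : ℝ≥0∞)⁻¹ * ∑ i : Fin n,
      ‖predError fhat (fReg P) (xData W n ω) (zData W n ω) i‖ₑ ^ 2 * ‖xi P (W i ω)‖ₑ ^ 2)
    (h_eps : UnifTendstoZeroInProb 𝒬 Pr fun n P ω => (n : ℝ≥0∞)⁻¹ * ∑ i : Fin n,
      ‖predError ghat (gReg P) (yData W n ω) (zData W n ω) i‖ₑ ^ 2 * ‖eps P (W i ω)‖ₑ ^ 2) :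
    UnifTendstoZeroInProb 𝒬 Pr fun n P ω => (n : ℝ≥0∞)⁻¹ * ∑ i : Fin n,
      ‖scrR fhat ghat W n ω i - HS.outer (eps P (W i ω)) (xi P (W i ω))‖ₑ ^ 2 := by
  refine (((h_xi.const_mul 4).add (h_eps.const_mul 4)).add (h_prod.const_mul 2)).of_le_eventually ?_
  filter_upwards [eventually_ne_atTop 0] with n hn P _ ω
  simp only [scrR_eq_outer_add P n ω]
  refine (mul_le_mul_right (sum_enorm_outer_perturbed_sq_le _ _ _ _) _).trans (le_of_eq ?_)
  rw [mul_mspe_mul_mspe _ _ _ _ hn]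
  push_cast
  ring

lemma unifTendstoZeroInProb_enorm_sum_scrR_sub_sq
    (h_prod : UnifTendstoZeroInProb 𝒬 Pr fun n P ω =>
      n * mspe fhat (fReg P) n (xData W n ω) (zData W n ω) *
        mspe ghat (gReg P) n (yData W n ω) (zData W n ω))
    (h_xi : UnifTendstoZeroInProb 𝒬 Pr fun n P ω => (n : ℝ≥0∞)⁻¹ * ‖∑ i : Fin n,
      HS.outer (predError fhat (fReg P) (xData W n ω) (zData W n ω) i) (xi P (W i ω))‖ₑ ^ 2)
    (h_eps : UnifTendstoZeroInProb 𝒬 Pr fun n P ω => (n : ℝ≥0∞)⁻¹ * ‖∑ i : Fin n,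
      HS.outer (predError ghat (gReg P) (yData W n ω) (zData W n ω) i) (eps P (W i ω))‖ₑ ^ 2) :
    UnifTendstoZeroInProb 𝒬 Pr fun n P ω => (n : ℝ≥0∞)⁻¹ * ‖∑ i : Fin n,
      (scrR fhat ghat W n ω i - HS.outer (eps P (W i ω)) (xi P (W i ω)))‖ₑ ^ 2 := by
  refine (((h_xi.const_mul 4).add (h_eps.const_mul 4)).add (h_prod.const_mul 2)).of_le_eventually ?_
  filter_upwards [eventually_ne_atTop 0] with n hn P _ ω
  simp only [scrR_eq_outer_add P n ω]
  refine (mul_le_mul_right (enorm_sum_outer_perturbed_sq_le _ _ _ _) _).trans (le_of_eq ?_)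
  rw [mul_mspe_mul_mspe _ _ _ _ hn]
  push_cast
  ring

end Residuals

end GHCM

end

theorem mainTheorem2_general
    {HX HY 𝒵 Ω : Type*}
    [NormedAddCommGroup HX] [InnerProductSpace ℝ HX] [CompleteSpace HX]
    [SecondCountableTopology HX] [MeasurableSpace HX] [BorelSpace HX]
    [NormedAddCommGroup HY] [InnerProductSpace ℝ HY] [CompleteSpace HY]
    [SecondCountableTopology HY] [MeasurableSpace HY] [BorelSpace HY]
    [MeasurableSpace 𝒵] [MeasurableSpace Ω]
    (𝒫₀ : Set (ProbabilityMeasure (HX × HY × 𝒵)))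
    (Pr : ProbabilityMeasure (HX × HY × 𝒵) → Measure Ω)
    (W : ℕ → Ω → HX × HY × 𝒵)
    (hW : ∀ P ∈ 𝒫₀, GHCM.IsIIDSample (Pr P) W (P : Measure (HX × HY × 𝒵)))
    (fhat : GHCM.RegressionMethod 𝒵 HX) (ghat : GHCM.RegressionMethod 𝒵 HY)
    (hfhat : fhat.IsMeasurable) (hghat : ghat.IsMeasurable)
    (hX : ∀ P ∈ 𝒫₀, Integrable (fun w => w.1) (P : Measure (HX × HY × 𝒵)))
    (hY : ∀ P ∈ 𝒫₀, Integrable (fun w => w.2.1) (P : Measure (HX × HY × 𝒵)))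
    (hnull : ∀ P ∈ 𝒫₀, GHCM.CondIndepGiven (P : Measure (HX × HY × 𝒵)))
    (h_prod : GHCM.UnifTendstoZeroInProb 𝒫₀ Pr fun n P ω =>
      n * GHCM.mspe fhat (GHCM.fReg P) n (GHCM.xData W n ω) (GHCM.zData W n ω) *
        GHCM.mspe ghat (GHCM.gReg P) n (GHCM.yData W n ω) (GHCM.zData W n ω))
    (h_wf : GHCM.UnifTendstoZeroInProb 𝒫₀ Pr fun n P ω =>
      GHCM.wmspe fhat (GHCM.fReg P) (GHCM.vVar P) n (GHCM.xData W n ω) (GHCM.zData W n ω))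
    (h_wg : GHCM.UnifTendstoZeroInProb 𝒫₀ Pr fun n P ω =>
      GHCM.wmspe ghat (GHCM.gReg P) (GHCM.uVar P) n (GHCM.yData W n ω) (GHCM.zData W n ω))
    (h_mom_sup : ∃ η : ℝ, 0 < η ∧ ∃ C : ℝ≥0, ∀ P ∈ 𝒫₀,
      ∫⁻ w, ‖GHCM.eps P w‖ₑ ^ (2 + η) * ‖GHCM.xi P w‖ₑ ^ (2 + η)
        ∂(P : Measure (HX × HY × 𝒵)) ≤ C)
    (h_tail : ∃ (dX dY : ℕ∞) (eX : HilbertBasis (GHCM.Idx dX) ℝ HX)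
      (eY : HilbertBasis (GHCM.Idx dY) ℝ HY),
      Tendsto (fun K : ℕ => ⨆ P ∈ 𝒫₀,
        ∑' p : {p : GHCM.Idx dX × GHCM.Idx dY // K ≤ (p.1 : ℕ) + (p.2 : ℕ)},
          ∫⁻ w, ‖⟪eX p.1.1, GHCM.eps P w⟫‖ₑ ^ 2 * ‖⟪eY p.1.2, GHCM.xi P w⟫‖ₑ ^ 2
            ∂(P : Measure (HX × HY × 𝒵))) atTop (𝓝 0)) :
    (∃ N : ProbabilityMeasure (HX × HY × 𝒵) → Measure (GHCM.HS HX HY),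
      (∀ P ∈ 𝒫₀, GHCM.IsCenteredGaussian (GHCM.covP P) (N P)) ∧
      GHCM.UnifTendstoInDistribution 𝒫₀ Pr (GHCM.scrT fhat ghat W) N) ∧
    GHCM.UnifTendstoZeroInProb 𝒫₀ Pr (fun n P ω =>
      GHCM.traceNorm (GHCM.scrChat fhat ghat W n ω - GHCM.covP P)) := by
  obtain ⟨η, hη, C, hmom⟩ := h_mom_sup
  obtain ⟨dX, dY, eX, eY, htail⟩ := h_tail
  have : SecondCountableTopology (GHCM.HS HX HY) :=
    GHCM.secondCountableTopology_of_hilbertBasis (GHCM.HS.outerBasis eX eY)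
  have hmoments := GHCM.unifCentredMoments_errLaw hY hnull hη hmom htail
  have hPr : ∀ P ∈ 𝒫₀, IsProbabilityMeasure (Pr P) := fun P hP =>
    (hW P hP).isProbabilityMeasure_sampleSpace
  have hV : ∀ P ∈ 𝒫₀, GHCM.IsIIDSample (Pr P)
      (fun i ω => GHCM.HS.outer (GHCM.eps P (W i ω)) (GHCM.xi P (W i ω))) (GHCM.errLaw P) :=
    fun P hP => by
      have := hPr P hP
      exact (hW P hP).comp GHCM.measurable_outer_errors
  obtain ⟨average_xi, sum_xi⟩ :=
    GHCM.unifTendstoZeroInProb_predError_xi hPr hW hfhat hY hnull h_wf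
  obtain ⟨average_eps, sum_eps⟩ :=
    GHCM.unifTendstoZeroInProb_predError_eps hPr hW hghat hX hnull h_wg
  have average_R := GHCM.unifTendstoZeroInProb_average_scrR_sub h_prod average_xi average_eps
  have sum_R := GHCM.unifTendstoZeroInProb_enorm_sum_scrR_sub_sq h_prod sum_xi sum_eps
  obtain ⟨N, hN, hlim⟩ := hmoments.exists_gaussian_limit_of_perturbed hPr hV
    (fun n P hP => GHCM.measurable_scrR hfhat hghat (hW P hP).1 n) sum_R
  have hcov := hmoments.unifTendstoZeroInProb_traceNorm_of_perturbed hPr hV sum_R average_R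
  simp_rw [GHCM.covOp_errLaw] at hN hcov
  exact ⟨⟨N, hN, hlim⟩, hcov⟩

theorem mainTheorem2
    {HX HY 𝒵 Ω : Type*}
    [NormedAddCommGroup HX] [InnerProductSpace ℝ HX] [CompleteSpace HX]
    [SecondCountableTopology HX] [MeasurableSpace HX] [BorelSpace HX]
    [NormedAddCommGroup HY] [InnerProductSpace ℝ HY] [CompleteSpace HY]
    [SecondCountableTopology HY] [MeasurableSpace HY] [BorelSpace HY]
    [MeasurableSpace 𝒵] [MeasurableSpace Ω]
    (𝒫₀ : Set (ProbabilityMeasure (HX × HY × 𝒵)))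
    -- the data: under `Pr P` the `W i = (x_i, y_i, z_i)` are i.i.d. with distribution `P`
    (Pr : ProbabilityMeasure (HX × HY × 𝒵) → Measure Ω)
    (W : ℕ → Ω → HX × HY × 𝒵)
    (hW : ∀ P ∈ 𝒫₀, GHCM.IsIIDSample (Pr P) W (P : Measure (HX × HY × 𝒵)))
    -- the two regression methods
    (fhat : GHCM.RegressionMethod 𝒵 HX) (ghat : GHCM.RegressionMethod 𝒵 HY)
    (hfhat : fhat.IsMeasurable) (hghat : ghat.IsMeasurable)
    -- the regression functions exist, and the null hypothesis holds
    (hX : ∀ P ∈ 𝒫₀, Integrable (fun w => w.1) (P : Measure (HX × HY × 𝒵)))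
    (hY : ∀ P ∈ 𝒫₀, Integrable (fun w => w.2.1) (P : Measure (HX × HY × 𝒵)))
    (hnull : ∀ P ∈ 𝒫₀, GHCM.CondIndepGiven (P : Measure (HX × HY × 𝒵)))
    -- the product of the prediction errors tends to zero
    (h_prod : GHCM.UnifTendstoZeroInProb 𝒫₀ Pr fun n P ω =>
      n * GHCM.mspe fhat (GHCM.fReg P) n (GHCM.xData W n ω) (GHCM.zData W n ω) *
        GHCM.mspe ghat (GHCM.gReg P) n (GHCM.yData W n ω) (GHCM.zData W n ω))
    -- the weighted prediction errors tend to zero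
    (h_wf : GHCM.UnifTendstoZeroInProb 𝒫₀ Pr fun n P ω =>
      GHCM.wmspe fhat (GHCM.fReg P) (GHCM.vVar P) n (GHCM.xData W n ω) (GHCM.zData W n ω))
    (h_wg : GHCM.UnifTendstoZeroInProb 𝒫₀ Pr fun n P ω =>
      GHCM.wmspe ghat (GHCM.gReg P) (GHCM.uVar P) n (GHCM.yData W n ω) (GHCM.zData W n ω))
    -- moment conditions
    (h_mom_inf : 0 < (⨅ P ∈ 𝒫₀,
      ∫⁻ w, ‖GHCM.eps P w‖ₑ ^ 2 * ‖GHCM.xi P w‖ₑ ^ 2 ∂(P : Measure (HX × HY × 𝒵))))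
    (h_mom_sup : ∃ η : ℝ, 0 < η ∧ ∃ C : ℝ≥0, ∀ P ∈ 𝒫₀,
      ∫⁻ w, ‖GHCM.eps P w‖ₑ ^ (2 + η) * ‖GHCM.xi P w‖ₑ ^ (2 + η)
        ∂(P : Measure (HX × HY × 𝒵)) ≤ C)
    -- uniform tail condition in some orthonormal bases
    (h_tail : ∃ (dX dY : ℕ∞) (eX : HilbertBasis (GHCM.Idx dX) ℝ HX)
      (eY : HilbertBasis (GHCM.Idx dY) ℝ HY),
      Tendsto (fun K : ℕ => ⨆ P ∈ 𝒫₀,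
        ∑' p : {p : GHCM.Idx dX × GHCM.Idx dY // K ≤ (p.1 : ℕ) + (p.2 : ℕ)},
          ∫⁻ w, ‖⟪eX p.1.1, GHCM.eps P w⟫‖ₑ ^ 2 * ‖⟪eY p.1.2, GHCM.xi P w⟫‖ₑ ^ 2
            ∂(P : Measure (HX × HY × 𝒵))) atTop (𝓝 0)) :
    (∃ N : ProbabilityMeasure (HX × HY × 𝒵) → Measure (GHCM.HS HX HY),
      (∀ P ∈ 𝒫₀, GHCM.IsCenteredGaussian (GHCM.covP P) (N P)) ∧
      GHCM.UnifTendstoInDistribution 𝒫₀ Pr (GHCM.scrT fhat ghat W) N) ∧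
    GHCM.UnifTendstoZeroInProb 𝒫₀ Pr (fun n P ω =>
      GHCM.traceNorm (GHCM.scrChat fhat ghat W n ω - GHCM.covP P)) := by
  exact mainTheorem2_general 𝒫₀ Pr W hW fhat ghat hfhat hghat hX hY hnull h_prod h_wf h_wg
    h_mom_sup h_tail
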